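/- Let $m=m_n$ and $k=k_n$ be positive integers with $m k\le n$, and let $\lambda=\lambda_n>0$; all three may depend on $n$, and asymptotics are as $n\to\infty$. Let $\mathcal{C}_k$ be the collection of all $S\subseteq[n]=\{1,\dots,n\}$ with $|S|=k$, and let $\mathcal{C}_k^{\mathrm{con}}\subseteq\mathcal{C}_k$ be the collection of those $S$ that consist of $k$ consecutive integers. Let $\mathcal{K}_{k,m,n}$ be the family of all sets $K\subseteq[n]\times[n]$ of the form $K=\bigcup_{i=1}^m S_i\times T_i$ with $S_i,T_i\in\mathcal{C}_k$ for all $i$ and $(S_i\times T_i)\cap(S_j\times T_j)=\emptyset$ for all $i\ne j$, and define $\mathcal{K}^{\mathrm{con}}_{k,m,n}$ in the same way with $\mathcal{C}_k^{\mathrm{con}}$ in place of $\mathcal{C}_k$. Let $\mathbb{P}_{\mathcal{H}_0}$ be the law of an $n\times n$ random matrix $X$ with i.i.d. $\mathcal{N}(0,1)$ entries. In submatrix detection (respectively, consecutive submatrix detection), let $\mathbb{P}_{\mathcal{H}_1}$ be the law of the $n\times n$ random matrix $X$ obtained by drawing $K$ uniformly at random from $\mathcal{K}_{k,m,n}$ (respectively,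 from $\mathcal{K}^{\mathrm{con}}_{k,m,n}$) and then, given $K$, drawing the entries independently with $X_{ij}\sim\mathcal{N}(\lambda,1)$ if $(i,j)\in K$ and $X_{ij}\sim\mathcal{N}(0,1)$ otherwise. Let $d_{\mathrm{TV}}(\mathbb{P},\mathbb{Q})=\frac12\int|\mathrm{d}\mathbb{P}-\mathrm{d}\mathbb{Q}|$. 1. For submatrix detection, if $\lambda=o\left(\min\left\{\frac{n}{mk^2},\frac{1}{\sqrt{k}}\right\}\right)$, then $d_{\mathrm{TV}}(\mathbb{P}_{\mathcal{H}_0},\mathbb{P}_{\mathcal{H}_1})=o(1)$. 2. For consecutive submatrix detection, if $\lambda=o(1/k)$, then $d_{\mathrm{TV}}(\mathbb{P}_{\mathcal{H}_0},\mathbb{P}_{\mathcal{H}_1})=o(1)$. -/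

import Mathlib

open MeasureTheory ProbabilityTheory Filter Asymptotics

namespace PlantedSubmatrix

/-- The subsets of `[n]` of size `k`. -/
def sizeSets (n k : ℕ) : Finset (Finset (Fin n)) :=
  Finset.univ.filter fun S => S.card = k

/-- The subsets of `[n]` of size `k` with consecutive elements (no gaps). -/
def consecutiveSets (n k : ℕ) : Finset (Finset (Fin n)) :=
  Finset.univ.filter fun S => S.card = k ∧ ∀ a ∈ S, ∀ b ∈ S, Finset.Icc a b ⊆ S

/-- All subsets of `[n] × [n]` that are unions of `m` pairwise disjoint rectangles
`S i ×ˢ T i` with every `S i` and every `T i` taken from the collection `C`. -/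
def unionsOfRectangles {n : ℕ} (C : Finset (Finset (Fin n))) (m : ℕ) :
    Finset (Finset (Fin n × Fin n)) :=
  Finset.univ.filter fun K =>
    ∃ S T : Fin m → Finset (Fin n),
      (∀ i, S i ∈ C ∧ T i ∈ C) ∧
      (∀ i j, i ≠ j → Disjoint (S i ×ˢ T i) (S j ×ˢ T j)) ∧
      K = Finset.univ.biUnion fun i => S i ×ˢ T i

/-- The possible supports of `m` planted disjoint `k × k` submatrices, arbitrary indices. -/
def supports (n k m : ℕ) : Finset (Finset (Fin n × Fin n)) :=
  unionsOfRectangles (sizeSets n k) m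

/-- The possible supports of `m` planted disjoint `k × k` submatrices, consecutive indices. -/
def consecutiveSupports (n k m : ℕ) : Finset (Finset (Fin n × Fin n)) :=
  unionsOfRectangles (consecutiveSets n k) m

/-- The law of an `n × n` matrix with i.i.d. entries of law `Q`. -/
noncomputable def nullLaw (n : ℕ) (Q : Measure ℝ) : Measure (Fin n × Fin n → ℝ) :=
  Measure.pi fun _ => Q

/-- The law of an `n × n` matrix with independent entries, of law `P` on `K` and `Q` off `K`. -/
noncomputable def lawGiven {n : ℕ} (K : Finset (Fin n × Fin n)) (P Q : Measure ℝ) :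
    Measure (Fin n × Fin n → ℝ) :=
  Measure.pi fun p => if p ∈ K then P else Q

/-- The law of the matrix when the support `K` is drawn uniformly from the family `F` and, given
`K`, the entries are independent, of law `P` on `K` and `Q` off `K`. -/
noncomputable def plantedLaw {n : ℕ} (F : Finset (Finset (Fin n × Fin n))) (P Q : Measure ℝ) :
    Measure (Fin n × Fin n → ℝ) :=
  (F.card : ENNReal)⁻¹ • ∑ K ∈ F, lawGiven K P Q

/-- Total variation distance `½ ∫ |dμ - dν|`, with densities taken with respect to `μ + ν`. -/
noncomputable def tvDist {Ω : Type*} [MeasurableSpace Ω] (μ ν : Measure Ω) : ℝ :=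
  (1 / 2) * ∫ x, |(μ.rnDeriv (μ + ν) x).toReal - (ν.rnDeriv (μ + ν) x).toReal| ∂(μ + ν)

end PlantedSubmatrix

/-!
The proof is the second moment method. For the mixture over a family `G` of supports, the
likelihood ratio against the null law is the average of `∏ p ∈ K, exp (l x_p - l² / 2)`, and its
second moment is the average of `exp (l² |K ∩ K'|)` over pairs in `G`. By Cauchy–Schwarz the total
variation distance is at most the square root of this second moment minus one; passing from `G` to
a larger family `F` costs the proportion of `F \ G` (`tvDist_le_of_subfamily`). It remains to bound
the average of `exp (l² |K ∩ K'|)` over `K'` for fixed `K`.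

A support may be a union of disjoint rectangles in several ways, so a uniform support is not the
union of a uniform packing. The weight `packingWeight`, the inverse of the number of packings with
the same union, corrects this. Given all rectangles but one, the weight of the remaining rectangle
`R` is largest, and constant, when every packing of the union contains `R`
(`sum_packingWeight_update_le`). For consecutive index sets this always holds. For arbitrary index
sets it holds as soon as `R` has a row and a column not met by the other rectangles
(`exists_eq_of_mem_forcedRects`), which is a positive proportion of the choices of `R` if the other
rectangles leave a positive proportion of the rows and columns empty. Then the rectangles can be
resampled one at a time, each contributing a factor `1 + O (l² m k⁴ / n²)` to the exponential
moment, which gives the bound `exp (O (l² m² k⁴ / n²))`.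

For arbitrary index sets, `k = 1` is contained in the consecutive case, and the other parameters
fall into three regimes.
* If `2 m k ≤ n`, at least half of the rows and columns are always empty.
* If `1024 k² ≤ n` and `k ≥ 2`, all but an exponentially small proportion of the supports leave a
  64th of the rows and of the columns empty (`card_supports_sdiff_le`): sequential choices of forced
  rectangles show that the supports number at least `(4 / e²) ^ n C(n, k) ^ (2 m) / m!` up to small
  factors, while covering almost all rows by `m` subsets has probability about `exp (-n)` at most,
  and `e⁻¹ < 4 / e²`. To keep rows empty while resampling, Jensen's inequality splits the rectangles into 256
  blocks, and only the rectangles of one block are resampled.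
* If `1024 k² > n` and `2 m k > n`, the hypothesis makes `l² n` small. The family of supports is
  invariant under permutations of the rows and of the columns, and averaging over these replaces
  `|K ∩ K'|` by `|K| |K'| / n²` up to a constant (`sum_perm_exp_le`).
-/

namespace PlantedSubmatrix

/-! ### Total variation and the second moment of the likelihood ratio -/

theorem tvDist_withDensity {Ω : Type*} [MeasurableSpace Ω] (μ : Measure Ω) [IsFiniteMeasure μ]
    {L : Ω → ℝ} (hL : Measurable L) (h0 : ∀ x, 0 ≤ L x) (hint : Integrable L μ) :
    tvDist μ (μ.withDensity fun x => ENNReal.ofReal (L x)) = (1 / 2) * ∫ x, |1 - L x| ∂μ := by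
  set ν := μ.withDensity fun x => ENNReal.ofReal (L x) with hν
  have : IsFiniteMeasure ν := isFiniteMeasure_withDensity_ofReal hint.2
  set g : Ω → ENNReal := fun x => ENNReal.ofReal (1 + L x) with hg
  have hgm : Measurable g := (measurable_const.add hL).ennreal_ofReal
  have hsum : μ + ν = μ.withDensity g := by
    have : g = (fun _ => 1) + fun x => ENNReal.ofReal (L x) := by
      funext x
      simp [hg, ENNReal.ofReal_add zero_le_one (h0 x)]
    rw [this, withDensity_add_left measurable_const]
    simp [hν]
  have hm1 : Measurable fun x => ENNReal.ofReal (1 / (1 + L x)) := by fun_prop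
  have hm2 : Measurable fun x => ENNReal.ofReal (L x / (1 + L x)) := by fun_prop
  have h1 : (μ + ν).withDensity (fun x => ENNReal.ofReal (1 / (1 + L x))) = μ := by
    rw [hsum, ← withDensity_mul _ hgm hm1]
    have : (g * fun x => ENNReal.ofReal (1 / (1 + L x))) = fun _ => 1 := by
      funext x
      have := h0 x
      simp only [hg, Pi.mul_apply]
      rw [← ENNReal.ofReal_mul (by linarith), mul_one_div_cancel (by linarith)]
      simp
    rw [this]
    simp
  have h2 : (μ + ν).withDensity (fun x => ENNReal.ofReal (L x / (1 + L x))) = ν := by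
    rw [hsum, ← withDensity_mul _ hgm hm2, hν]
    congr 1
    funext x
    have := h0 x
    simp only [hg, Pi.mul_apply]
    rw [← ENNReal.ofReal_mul (by linarith), mul_div_cancel₀ _ (by linarith)]
  have r1 : μ.rnDeriv (μ + ν) =ᵐ[μ + ν] fun x => ENNReal.ofReal (1 / (1 + L x)) := by
    have := Measure.rnDeriv_withDensity (μ + ν) hm1
    rwa [h1] at this
  have r2 : ν.rnDeriv (μ + ν) =ᵐ[μ + ν] fun x => ENNReal.ofReal (L x / (1 + L x)) := by
    have := Measure.rnDeriv_withDensity (μ + ν) hm2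
    rwa [h2] at this
  unfold tvDist
  congr 1
  have e1 : ∫ x, |(μ.rnDeriv (μ + ν) x).toReal - (ν.rnDeriv (μ + ν) x).toReal| ∂(μ + ν)
      = ∫ x, |1 - L x| / (1 + L x) ∂(μ + ν) := by
    apply integral_congr_ae
    filter_upwards [r1, r2] with x hx1 hx2
    have := h0 x
    rw [hx1, hx2, ENNReal.toReal_ofReal (by positivity), ENNReal.toReal_ofReal (by positivity),
      ← sub_div, abs_div, abs_of_pos (by linarith : 0 < 1 + L x)]
  rw [e1, hsum, integral_withDensity_eq_integral_toReal_smul hgm (by simp [hg])]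
  apply integral_congr_ae
  refine Eventually.of_forall fun x => ?_
  have := h0 x
  simp only [hg, smul_eq_mul]
  rw [ENNReal.toReal_ofReal (by linarith), mul_div_cancel₀ _ (by linarith)]

/-- The likelihood ratio of the Gaussian law of mean `l` with respect to the standard one. -/
noncomputable def gaussianRatio (l x : ℝ) : ℝ := Real.exp (l * x - l ^ 2 / 2)

theorem gaussianReal_eq_withDensity (l : ℝ) :
    gaussianReal l 1
      = (gaussianReal 0 1).withDensity fun x => ENNReal.ofReal (gaussianRatio l x) := by
  rw [gaussianReal_of_var_ne_zero _ one_ne_zero, gaussianReal_of_var_ne_zero _ one_ne_zero,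
    ← withDensity_mul _ (measurable_gaussianPDF _ _)
      (by unfold gaussianRatio; fun_prop)]
  congr 1
  funext x
  simp only [gaussianPDF, Pi.mul_apply, gaussianRatio]
  rw [← ENNReal.ofReal_mul (gaussianPDFReal_nonneg _ _ _)]
  congr 1
  simp only [gaussianPDFReal, NNReal.coe_one, mul_assoc]
  rw [← Real.exp_add]
  congr 2
  ring

variable {n : ℕ}

/-- The likelihood ratio of the matrix law with planted support `K` with respect to the null
law. -/
noncomputable def likelihood (l : ℝ) (K : Finset (Fin n × Fin n)) (x : Fin n × Fin n → ℝ) : ℝ :=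
  ∏ p, if p ∈ K then gaussianRatio l (x p) else 1

theorem likelihood_nonneg (l : ℝ) (K : Finset (Fin n × Fin n)) (x : Fin n × Fin n → ℝ) :
    0 ≤ likelihood l K x :=
  Finset.prod_nonneg fun p _ => by
    split_ifs
    · exact (Real.exp_pos _).le
    · exact zero_le_one

theorem measurable_gaussianRatio (l : ℝ) : Measurable (gaussianRatio l) := by
  unfold gaussianRatio; fun_prop

theorem measurable_likelihood (l : ℝ) (K : Finset (Fin n × Fin n)) :
    Measurable (likelihood l K) := by
  unfold likelihood
  refine Finset.measurable_prod _ fun p _ => ?_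
  split_ifs
  · exact (measurable_gaussianRatio l).comp (measurable_pi_apply p)
  · exact measurable_const

theorem integrable_gaussianRatio (l : ℝ) : Integrable (gaussianRatio l) (gaussianReal 0 1) := by
  have := (integrable_exp_mul_gaussianReal (μ := 0) (v := 1) l).mul_const (Real.exp (-(l ^ 2 / 2)))
  refine this.congr (Eventually.of_forall fun x => ?_)
  simp only [gaussianRatio, ← Real.exp_add]
  ring_nf

theorem integral_exp_gaussian (t : ℝ) :
    ∫ x, Real.exp (t * x) ∂(gaussianReal 0 1) = Real.exp (t ^ 2 / 2) := by
  have := congrFun (mgf_fun_id_gaussianReal (μ := 0) (v := 1)) t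
  simpa [mgf] using this

theorem integral_gaussianRatio (l : ℝ) : ∫ x, gaussianRatio l x ∂(gaussianReal 0 1) = 1 := by
  have : ∀ x, gaussianRatio l x = Real.exp (l * x) * Real.exp (-(l ^ 2 / 2)) := fun x => by
    rw [← Real.exp_add, gaussianRatio]; ring_nf
  simp_rw [this]
  rw [integral_mul_const, integral_exp_gaussian, ← Real.exp_add]
  simp

theorem gaussianRatio_sq (l x : ℝ) :
    gaussianRatio l x * gaussianRatio l x = Real.exp (2 * l * x) * Real.exp (-l ^ 2) := by
  simp only [gaussianRatio, ← Real.exp_add]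
  ring_nf

theorem integrable_gaussianRatio_sq (l : ℝ) :
    Integrable (fun x => gaussianRatio l x * gaussianRatio l x) (gaussianReal 0 1) := by
  simp_rw [gaussianRatio_sq]
  exact (integrable_exp_mul_gaussianReal (2 * l)).mul_const _

theorem integral_gaussianRatio_sq (l : ℝ) :
    ∫ x, gaussianRatio l x * gaussianRatio l x ∂(gaussianReal 0 1) = Real.exp (l ^ 2) := by
  simp_rw [gaussianRatio_sq]
  rw [integral_mul_const, integral_exp_gaussian, ← Real.exp_add]
  ring_nf

instance (n : ℕ) : IsProbabilityMeasure (nullLaw n (gaussianReal 0 1)) := by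
  unfold nullLaw; infer_instance

theorem integrable_likelihood_mul (l : ℝ) (K K' : Finset (Fin n × Fin n)) :
    Integrable (fun x => likelihood l K x * likelihood l K' x) (nullLaw n (gaussianReal 0 1)) := by
  simp only [likelihood, ← Finset.prod_mul_distrib]
  refine Integrable.fintype_prod (f := fun p x => (if p ∈ K then gaussianRatio l x else 1)
    * (if p ∈ K' then gaussianRatio l x else 1)) fun p => ?_
  have := integrable_gaussianRatio l
  have := integrable_gaussianRatio_sq l
  split_ifs <;> simp_all

theorem integral_likelihood_mul (l : ℝ) (K K' : Finset (Fin n × Fin n)) :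
    ∫ x, likelihood l K x * likelihood l K' x ∂(nullLaw n (gaussianReal 0 1))
      = Real.exp (l ^ 2 * (K ∩ K').card) := by
  simp only [likelihood, ← Finset.prod_mul_distrib, nullLaw]
  rw [integral_fintype_prod_eq_prod (f := fun p x => (if p ∈ K then gaussianRatio l x else 1)
    * (if p ∈ K' then gaussianRatio l x else 1))]
  have : ∀ p : Fin n × Fin n, ∫ x, (if p ∈ K then gaussianRatio l x else 1)
    * (if p ∈ K' then gaussianRatio l x else 1) ∂(gaussianReal 0 1)
      = if p ∈ K ∩ K' then Real.exp (l ^ 2) else 1 := fun p => by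
    by_cases h : p ∈ K <;> by_cases h' : p ∈ K' <;>
      simp [h, h', integral_gaussianRatio, integral_gaussianRatio_sq]
  simp_rw [this]
  rw [Finset.prod_ite_mem, Finset.univ_inter, Finset.prod_const, ← Real.exp_nat_mul, mul_comm]

theorem integrable_likelihood (l : ℝ) (K : Finset (Fin n × Fin n)) :
    Integrable (likelihood l K) (nullLaw n (gaussianReal 0 1)) := by
  refine (integrable_likelihood_mul l K ∅).congr (Eventually.of_forall fun x => ?_)
  simp [likelihood]

theorem integral_likelihood (l : ℝ) (K : Finset (Fin n × Fin n)) :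
    ∫ x, likelihood l K x ∂(nullLaw n (gaussianReal 0 1)) = 1 := by
  simpa [likelihood] using integral_likelihood_mul l K ∅

theorem lawGiven_eq_withDensity (l : ℝ) (K : Finset (Fin n × Fin n)) :
    lawGiven K (gaussianReal l 1) (gaussianReal 0 1)
      = (nullLaw n (gaussianReal 0 1)).withDensity
          fun x => ENNReal.ofReal (likelihood l K x) := by
  have : ∀ p, IsProbabilityMeasure (if p ∈ K then gaussianReal l 1 else gaussianReal 0 1) := by
    intro p; split_ifs <;> infer_instance
  unfold lawGiven
  refine Measure.pi_eq fun s hs => ?_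
  rw [withDensity_apply _ (MeasurableSet.univ_pi hs),
    ← ofReal_integral_eq_lintegral_ofReal (integrable_likelihood l K).integrableOn
      (Eventually.of_forall fun x => likelihood_nonneg l K x)]
  unfold nullLaw likelihood
  rw [Measure.restrict_pi_pi]
  rw [integral_fintype_prod_eq_prod (f := fun p x => if p ∈ K then gaussianRatio l x else 1),
    ENNReal.ofReal_prod_of_nonneg]
  · refine Finset.prod_congr rfl fun p _ => ?_
    split_ifs
    · rw [gaussianReal_eq_withDensity l, withDensity_apply _ (hs p),
        ofReal_integral_eq_lintegral_ofReal (integrable_gaussianRatio l).integrableOn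
          (Eventually.of_forall fun x => (Real.exp_pos _).le)]
    · simp
  · intro p _
    refine integral_nonneg fun x => ?_
    simp only [Pi.zero_apply]
    split_ifs
    · exact (Real.exp_pos _).le
    · exact zero_le_one

/-- The average over a family of supports of the corresponding likelihood ratios. -/
noncomputable def avgLikelihood (l : ℝ) (F : Finset (Finset (Fin n × Fin n)))
    (x : Fin n × Fin n → ℝ) : ℝ :=
  (F.card : ℝ)⁻¹ * ∑ K ∈ F, likelihood l K x

theorem plantedLaw_eq_withDensity (l : ℝ) {F : Finset (Finset (Fin n × Fin n))}
    (hF : F.Nonempty) :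
    plantedLaw F (gaussianReal l 1) (gaussianReal 0 1)
      = (nullLaw n (gaussianReal 0 1)).withDensity
          fun x => ENNReal.ofReal (avgLikelihood l F x) := by
  have hc : (0 : ℝ) < F.card := by exact_mod_cast hF.card_pos
  ext s hs
  rw [withDensity_apply _ hs]
  simp only [plantedLaw, avgLikelihood, Measure.smul_apply, Measure.finsetSum_apply, smul_eq_mul]
  simp_rw [lawGiven_eq_withDensity, withDensity_apply _ hs,
    ENNReal.ofReal_mul (inv_nonneg.2 hc.le),
    ENNReal.ofReal_sum_of_nonneg fun K _ => likelihood_nonneg l K _]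
  rw [lintegral_const_mul _ (Finset.measurable_sum _ fun K _ =>
      (measurable_likelihood l K).ennreal_ofReal),
    lintegral_finsetSum _ fun K _ => (measurable_likelihood l K).ennreal_ofReal,
    ENNReal.ofReal_inv_of_pos hc, ENNReal.ofReal_natCast]

theorem integrable_avgLikelihood (l : ℝ) (F : Finset (Finset (Fin n × Fin n))) :
    Integrable (avgLikelihood l F) (nullLaw n (gaussianReal 0 1)) :=
  (integrable_finsetSum _ fun K _ => integrable_likelihood l K).const_mul _

theorem avgLikelihood_nonneg (l : ℝ) (F : Finset (Finset (Fin n × Fin n)))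
    (x : Fin n × Fin n → ℝ) : 0 ≤ avgLikelihood l F x :=
  mul_nonneg (by positivity) (Finset.sum_nonneg fun K _ => likelihood_nonneg l K x)

theorem measurable_avgLikelihood (l : ℝ) (F : Finset (Finset (Fin n × Fin n))) :
    Measurable (avgLikelihood l F) :=
  (Finset.measurable_sum _ fun K _ => measurable_likelihood l K).const_mul _

theorem tvDist_nullLaw_plantedLaw (l : ℝ) {F : Finset (Finset (Fin n × Fin n))}
    (hF : F.Nonempty) :
    tvDist (nullLaw n (gaussianReal 0 1)) (plantedLaw F (gaussianReal l 1) (gaussianReal 0 1))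
      = (1 / 2) * ∫ x, |1 - avgLikelihood l F x| ∂(nullLaw n (gaussianReal 0 1)) := by
  rw [plantedLaw_eq_withDensity l hF]
  exact tvDist_withDensity _ (measurable_avgLikelihood l F) (avgLikelihood_nonneg l F)
    (integrable_avgLikelihood l F)

/-- Cauchy-Schwarz bounds the `L¹` distance of the likelihood ratio to `1` by its second moment,
which is the exponential moment of the overlap of two independent supports. -/
theorem integral_abs_one_sub_avgLikelihood_le (l : ℝ) {F : Finset (Finset (Fin n × Fin n))}
    (hF : F.Nonempty) {A : ℝ}
    (hA : ∀ K ∈ F, ∑ K' ∈ F, Real.exp (l ^ 2 * (K ∩ K').card) ≤ A * F.card) :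
    ∫ x, |1 - avgLikelihood l F x| ∂(nullLaw n (gaussianReal 0 1)) ≤ Real.sqrt (A - 1) := by
  set P := nullLaw n (gaussianReal 0 1)
  have hc : (0 : ℝ) < F.card := by exact_mod_cast hF.card_pos
  have hLint := integrable_avgLikelihood (n := n) l F
  have hsq : ∀ x, avgLikelihood l F x ^ 2 = ((F.card : ℝ)⁻¹) ^ 2 *
      ∑ K ∈ F, ∑ K' ∈ F, likelihood l K x * likelihood l K' x := fun x => by
    rw [avgLikelihood, mul_pow, sq (∑ K ∈ F, _), Finset.sum_mul_sum]
  have hsqint : Integrable (fun x => avgLikelihood l F x ^ 2) P := by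
    simp_rw [hsq]
    exact (integrable_finsetSum _ fun K _ => integrable_finsetSum _ fun K' _ =>
      integrable_likelihood_mul l K K').const_mul _
  have hmean : ∫ x, avgLikelihood l F x ∂P = 1 := by
    simp only [avgLikelihood]
    rw [integral_const_mul, integral_finsetSum _ fun K _ => integrable_likelihood l K]
    simp only [integral_likelihood, Finset.sum_const, nsmul_eq_mul, mul_one]
    exact inv_mul_cancel₀ hc.ne'
  have hsecond : ∫ x, avgLikelihood l F x ^ 2 ∂P ≤ A := by
    simp_rw [hsq]
    rw [integral_const_mul, integral_finsetSum _ fun K _ => integrable_finsetSum _ fun K' _ =>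
      integrable_likelihood_mul l K K']
    simp_rw [integral_finsetSum F fun K' _ => integrable_likelihood_mul l _ K']
    simp only [integral_likelihood_mul]
    calc _ ≤ ((F.card : ℝ)⁻¹) ^ 2 * ∑ K ∈ F, A * F.card := by
          gcongr with K hK
          exact hA K hK
      _ = A := by
          rw [Finset.sum_const, nsmul_eq_mul]
          field_simp
  have hint : Integrable (fun x => (1 - avgLikelihood l F x) ^ 2) P := by
    have : (fun x => (1 - avgLikelihood l F x) ^ 2)
        = fun x => 1 - 2 * avgLikelihood l F x + avgLikelihood l F x ^ 2 := by
      funext x; ring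
    rw [this]
    exact ((integrable_const _).sub (hLint.const_mul 2)).add hsqint
  have hval : ∫ x, (1 - avgLikelihood l F x) ^ 2 ∂P ≤ A - 1 := by
    have : (fun x => (1 - avgLikelihood l F x) ^ 2)
        = fun x => (1 - 2 * avgLikelihood l F x) + avgLikelihood l F x ^ 2 := by
      funext x; ring
    have hlin : Integrable (fun x => 1 - 2 * avgLikelihood l F x) P :=
      (integrable_const _).sub (hLint.const_mul 2)
    rw [this, integral_add hlin hsqint,
      integral_sub (integrable_const _) (hLint.const_mul 2), integral_const_mul, hmean]
    simp
    linarith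
  have habs : Integrable (fun x => |1 - avgLikelihood l F x|) P :=
    ((integrable_const _).sub hLint).abs
  apply Real.le_sqrt_of_sq_le
  refine le_trans ?_ hval
  have hv := variance_nonneg (fun x => |1 - avgLikelihood l F x|) P
  rw [variance_eq_sub] at hv
  · simp only [Pi.pow_apply, sq_abs] at hv
    linarith
  · rw [memLp_two_iff_integrable_sq habs.aestronglyMeasurable]
    simpa [sq_abs] using hint

/-- The total variation distance to the null law is small as soon as two supports from a
subfamily `G` containing most of `F` have a small overlap. -/
theorem tvDist_le_of_subfamily (l : ℝ) {F G : Finset (Finset (Fin n × Fin n))}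
    (hG : G.Nonempty) (hGF : G ⊆ F) {A : ℝ}
    (hA : ∀ K ∈ G, ∑ K' ∈ G, Real.exp (l ^ 2 * (K ∩ K').card) ≤ A * G.card) :
    tvDist (nullLaw n (gaussianReal 0 1)) (plantedLaw F (gaussianReal l 1) (gaussianReal 0 1))
      ≤ Real.sqrt (A - 1) + (F \ G).card / F.card := by
  have hF : F.Nonempty := hG.mono hGF
  rw [tvDist_nullLaw_plantedLaw l hF]
  set P := nullLaw n (gaussianReal 0 1)
  have hc : (0 : ℝ) < F.card := by exact_mod_cast hF.card_pos
  have hg : (0 : ℝ) < G.card := by exact_mod_cast hG.card_pos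
  have hGle : (G.card : ℝ) ≤ F.card := by exact_mod_cast Finset.card_le_card hGF
  have hcard : ((F \ G).card : ℝ) = F.card - G.card := by
    rw [Finset.card_sdiff_of_subset hGF, Nat.cast_sub (Finset.card_le_card hGF)]
  have hpt : ∀ x, |1 - avgLikelihood l F x| ≤ |1 - avgLikelihood l G x|
      + (F.card : ℝ)⁻¹ * ∑ K ∈ F \ G, (1 + likelihood l K x) := fun x => by
    have hsplit : 1 - avgLikelihood l F x = (G.card / F.card) * (1 - avgLikelihood l G x)
        + (F.card : ℝ)⁻¹ * ∑ K ∈ F \ G, (1 - likelihood l K x) := by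
      simp only [avgLikelihood, ← Finset.sum_sdiff hGF, Finset.sum_sub_distrib, Finset.sum_const,
        nsmul_eq_mul, mul_one, hcard]
      field_simp
      ring
    rw [hsplit]
    refine (abs_add_le _ _).trans ?_
    refine add_le_add ?_ ?_
    · rw [abs_mul, abs_of_nonneg (by positivity)]
      exact mul_le_of_le_one_left (abs_nonneg _) ((div_le_one hc).2 hGle)
    · rw [abs_mul, abs_of_nonneg (by positivity)]
      gcongr
      refine (Finset.abs_sum_le_sum_abs _ _).trans ?_
      gcongr with K _
      have := likelihood_nonneg l K x
      exact abs_le.2 ⟨by linarith, by linarith⟩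
  have hi1 : Integrable (fun x => |1 - avgLikelihood l G x|) P :=
    ((integrable_const _).sub (integrable_avgLikelihood l G)).abs
  have hi2 : Integrable (fun x => (F.card : ℝ)⁻¹ * ∑ K ∈ F \ G, (1 + likelihood l K x)) P :=
    (integrable_finsetSum _ fun K _ =>
      (integrable_const _).add (integrable_likelihood l K)).const_mul _
  have hle : ∫ x, |1 - avgLikelihood l F x| ∂P ≤ ∫ x, (|1 - avgLikelihood l G x|
      + (F.card : ℝ)⁻¹ * ∑ K ∈ F \ G, (1 + likelihood l K x)) ∂P :=
    integral_mono ((integrable_const _).sub (integrable_avgLikelihood l F)).abs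
      (hi1.add hi2) hpt
  have hsum : ∫ x, (F.card : ℝ)⁻¹ * ∑ K ∈ F \ G, (1 + likelihood l K x) ∂P
      = 2 * ((F \ G).card / F.card) := by
    have hi : ∀ K ∈ F \ G, Integrable (fun x => 1 + likelihood l K x) P := fun K _ =>
      (integrable_const _).add (integrable_likelihood l K)
    rw [integral_const_mul, integral_finsetSum _ hi]
    have : ∀ K : Finset (Fin n × Fin n), ∫ x, (1 + likelihood l K x) ∂P = 2 := fun K => by
      rw [integral_add (integrable_const _) (integrable_likelihood l K), integral_likelihood]
      simp
      norm_num
    simp only [this, Finset.sum_const, nsmul_eq_mul]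
    ring
  have h1 := integral_abs_one_sub_avgLikelihood_le l hG hA
  rw [integral_add hi1 hi2, hsum] at hle
  have : 0 ≤ Real.sqrt (A - 1) := Real.sqrt_nonneg _
  linarith

/-! ### Resampling one coordinate at a time -/

section Resampling

variable {ι α : Type*} [Fintype ι] [DecidableEq ι] [Fintype α]

theorem sum_sum_update (Φ : (ι → α) → ℝ) (i : ι) :
    ∑ ω, ∑ a, Φ (Function.update ω i a) = Fintype.card α * ∑ ω, Φ ω := by
  classical
  let e : (ι → α) × α → (ι → α) × α := fun p => (Function.update p.1 i p.2, p.1 i)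
  have he : Function.Involutive e := fun p => by simp [e]
  have h1 : ∑ p : (ι → α) × α, Φ (e p).1 = ∑ p : (ι → α) × α, Φ p.1 :=
    Equiv.sum_comp (Function.Involutive.toPerm e he) fun p => Φ p.1
  rw [Fintype.sum_prod_type, Fintype.sum_prod_type] at h1
  simpa [e, Finset.mul_sum] using h1

/-- If resampling any coordinate of `J` under the weight `w` changes the mean of `g` at this
coordinate to at most `c`, then the mean of the product of `g` over `J` is at most `c ^ #J`. No
independence of the coordinates is needed, since the bound is uniform in the other coordinates. -/
theorem sum_mul_prod_le_pow (w : (ι → α) → ℝ) {g : α → ℝ}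
    (hg : ∀ a, 0 ≤ g a) {c : ℝ} (hc : 0 ≤ c) (J : Finset ι)
    (h : ∀ ω, ∀ i ∈ J, ∑ a, w (Function.update ω i a) * g a
      ≤ c * ∑ a, w (Function.update ω i a)) :
    ∑ ω, w ω * ∏ i ∈ J, g (ω i) ≤ c ^ J.card * ∑ ω, w ω := by
  classical
  induction J using Finset.induction_on with
  | empty => simp
  | insert i J hi ih =>
    have ih' := ih fun ω j hj => h ω j (Finset.mem_insert_of_mem hj)
    rcases isEmpty_or_nonempty α with hα | hα
    · have : IsEmpty (ι → α) := ⟨fun ω => hα.false (ω i)⟩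
      simp
    have hpos : (0 : ℝ) < Fintype.card α := by exact_mod_cast Fintype.card_pos
    have hprod : ∀ (ω : ι → α) (a : α),
        ∏ j ∈ J, g (Function.update ω i a j) = ∏ j ∈ J, g (ω j) := fun ω a =>
      Finset.prod_congr rfl fun j hj => by
        rw [Function.update_of_ne]
        rintro rfl
        exact hi hj
    have key : Fintype.card α * ∑ ω, w ω * ∏ j ∈ insert i J, g (ω j)
        ≤ Fintype.card α * (c * ∑ ω, w ω * ∏ j ∈ J, g (ω j)) := by
      rw [← sum_sum_update _ i, mul_left_comm, ← sum_sum_update _ i, Finset.mul_sum]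
      refine Finset.sum_le_sum fun ω _ => ?_
      simp only [Finset.prod_insert hi, hprod, Function.update_self, ← Finset.sum_mul, ← mul_assoc]
      exact mul_le_mul_of_nonneg_right (h ω i (Finset.mem_insert_self _ _))
        (Finset.prod_nonneg fun j _ => hg _)
    rw [Finset.card_insert_of_notMem hi, pow_succ']
    calc _ ≤ c * ∑ ω, w ω * ∏ j ∈ J, g (ω j) := le_of_mul_le_mul_left key hpos
      _ ≤ c * (c ^ J.card * ∑ ω, w ω) := mul_le_mul_of_nonneg_left ih' hc
      _ = _ := by ring

end Resampling

/-! ### Packings of rectangles and the uniform law on their unions -/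

/-- A combinatorial rectangle, given by its set of rows and its set of columns. -/
abbrev Rect (n : ℕ) := Finset (Fin n) × Finset (Fin n)

variable {n m : ℕ}

/-- The entries of the matrix in a rectangle. -/
def cells (R : Rect n) : Finset (Fin n × Fin n) := R.1 ×ˢ R.2

/-- The set of entries covered by a tuple of rectangles. -/
def tupleUnion (ω : Fin m → Rect n) : Finset (Fin n × Fin n) :=
  Finset.univ.biUnion fun i => cells (ω i)

/-- The ordered tuples of `m` pairwise disjoint rectangles with sides in the collection `C`. -/
def packings (C : Finset (Finset (Fin n))) (m : ℕ) : Finset (Fin m → Rect n) :=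
  Finset.univ.filter fun ω => (∀ i, (ω i).1 ∈ C ∧ (ω i).2 ∈ C) ∧
    ∀ i j, i ≠ j → Disjoint (cells (ω i)) (cells (ω j))

theorem mem_packings {C : Finset (Finset (Fin n))} {ω : Fin m → Rect n} :
    ω ∈ packings C m ↔ (∀ i, (ω i).1 ∈ C ∧ (ω i).2 ∈ C) ∧
      ∀ i j, i ≠ j → Disjoint (cells (ω i)) (cells (ω j)) := by
  simp [packings]

theorem mem_tupleUnion {ω : Fin m → Rect n} {p : Fin n × Fin n} :
    p ∈ tupleUnion ω ↔ ∃ i, p ∈ cells (ω i) := by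
  simp [tupleUnion]

theorem unionsOfRectangles_eq_image (C : Finset (Finset (Fin n))) (m : ℕ) :
    unionsOfRectangles C m = (packings C m).image tupleUnion := by
  ext K
  simp only [unionsOfRectangles, Finset.mem_filter, Finset.mem_univ, true_and, Finset.mem_image,
    mem_packings]
  constructor
  · rintro ⟨S, T, h1, h2, rfl⟩
    exact ⟨fun i => (S i, T i), ⟨h1, h2⟩, rfl⟩
  · rintro ⟨ω, ⟨h1, h2⟩, rfl⟩
    exact ⟨fun i => (ω i).1, fun i => (ω i).2, h1, h2, rfl⟩

/-- The number of ordered packings with union `K`. A union may have several packings that are not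
permutations of each other, for instance when two rectangles have the same rows. -/
def packingCount (C : Finset (Finset (Fin n))) (m : ℕ) (K : Finset (Fin n × Fin n)) : ℕ :=
  ((packings C m).filter fun ω => tupleUnion ω = K).card

/-- The weight on tuples of rectangles that makes the union of the tuple uniform on
`unionsOfRectangles C m`. -/
noncomputable def packingWeight (C : Finset (Finset (Fin n))) (m : ℕ) (ω : Fin m → Rect n) : ℝ :=
  if ω ∈ packings C m then ((packingCount C m (tupleUnion ω) : ℝ))⁻¹ else 0

theorem packingWeight_nonneg (C : Finset (Finset (Fin n))) (m : ℕ) (ω : Fin m → Rect n) :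
    0 ≤ packingWeight C m ω := by
  unfold packingWeight
  split_ifs <;> positivity

theorem sum_packingWeight_mul (C : Finset (Finset (Fin n))) (m : ℕ)
    (Φ : Finset (Fin n × Fin n) → ℝ) :
    ∑ ω, packingWeight C m ω * Φ (tupleUnion ω) = ∑ K ∈ unionsOfRectangles C m, Φ K := by
  simp only [packingWeight, ite_mul, zero_mul]
  rw [← Finset.sum_filter, Finset.filter_univ_mem, unionsOfRectangles_eq_image,
    ← Finset.sum_fiberwise_of_maps_to (fun ω hω => Finset.mem_image_of_mem tupleUnion hω)]
  refine Finset.sum_congr rfl fun K hK => ?_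
  have hpos : 0 < packingCount C m K := by
    obtain ⟨ω, hω, rfl⟩ := Finset.mem_image.1 hK
    exact Finset.card_pos.2 ⟨ω, Finset.mem_filter.2 ⟨hω, rfl⟩⟩
  rw [Finset.sum_congr rfl (g := fun _ => (packingCount C m K : ℝ)⁻¹ * Φ K)]
  · rw [Finset.sum_const, nsmul_eq_mul, ← mul_assoc]
    have : (packingCount C m K : ℝ) ≠ 0 := by positivity
    change (packingCount C m K : ℝ) * _ * _ = _
    field_simp
  · intro ω hω
    rw [(Finset.mem_filter.1 hω).2]

theorem card_tupleUnion {k : ℕ} {C : Finset (Finset (Fin n))} (hC : ∀ S ∈ C, S.card = k)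
    {ω : Fin m → Rect n} (hω : ω ∈ packings C m) : (tupleUnion ω).card = m * k ^ 2 := by
  rw [mem_packings] at hω
  rw [tupleUnion, Finset.card_biUnion fun i _ j _ hij => hω.2 i j hij]
  simp only [cells, Finset.card_product, hC _ (hω.1 _).1, hC _ (hω.1 _).2]
  simp [sq]

theorem card_inter_tupleUnion {C : Finset (Finset (Fin n))}
    {ω : Fin m → Rect n} (hω : ω ∈ packings C m) (K : Finset (Fin n × Fin n)) :
    (K ∩ tupleUnion ω).card = ∑ i, (K ∩ cells (ω i)).card := by
  rw [mem_packings] at hω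
  rw [tupleUnion, Finset.inter_biUnion, Finset.card_biUnion]
  intro i _ j _ hij
  exact (hω.2 i j hij).mono Finset.inter_subset_right Finset.inter_subset_right

/-- The rectangles that can stand at position `i`, given the other rectangles of `ω`. -/
def available (C : Finset (Finset (Fin n))) (ω : Fin m → Rect n) (i : Fin m) : Finset (Rect n) :=
  Finset.univ.filter fun R => Function.update ω i R ∈ packings C m

/-- The entries covered by the rectangles of `ω` other than the one at position `i`. -/
def restUnion (ω : Fin m → Rect n) (i : Fin m) : Finset (Fin n × Fin n) :=
  (Finset.univ.erase i).biUnion fun j => cells (ω j)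

theorem tupleUnion_update (ω : Fin m → Rect n) (i : Fin m) (R : Rect n) :
    tupleUnion (Function.update ω i R) = restUnion ω i ∪ cells R := by
  ext p
  simp only [mem_tupleUnion, restUnion, Finset.mem_union, Finset.mem_biUnion, Finset.mem_erase,
    Finset.mem_univ, and_true]
  constructor
  · rintro ⟨j, hj⟩
    by_cases h : j = i
    · subst h; right; simpa using hj
    · left; exact ⟨j, h, by simpa [h] using hj⟩
  · rintro (⟨j, h, hj⟩ | hR)
    · exact ⟨j, by simpa [h] using hj⟩
    · exact ⟨i, by simpa using hR⟩

theorem disjoint_restUnion_of_mem_available {C : Finset (Finset (Fin n))} {ω : Fin m → Rect n}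
    {i : Fin m} {R : Rect n} (hR : R ∈ available C ω i) : Disjoint (cells R) (restUnion ω i) := by
  have h := (mem_packings.1 (Finset.mem_filter.1 hR).2).2
  rw [restUnion, Finset.disjoint_biUnion_right]
  intro j hj
  have hji := Finset.ne_of_mem_erase hj
  simpa [hji] using h i j hji.symm

theorem mem_available_iff {C : Finset (Finset (Fin n))} {ω : Fin m → Rect n}
    {i : Fin m} {R₀ R : Rect n} (hR₀ : R₀ ∈ available C ω i) :
    R ∈ available C ω i ↔ (R.1 ∈ C ∧ R.2 ∈ C) ∧ Disjoint (cells R) (restUnion ω i) := by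
  constructor
  · intro hR
    refine ⟨?_, disjoint_restUnion_of_mem_available hR⟩
    simpa using (mem_packings.1 (Finset.mem_filter.1 hR).2).1 i
  · rintro ⟨hRC, hdis⟩
    have h₀ := mem_packings.1 (Finset.mem_filter.1 hR₀).2
    rw [restUnion, Finset.disjoint_biUnion_right] at hdis
    refine Finset.mem_filter.2 ⟨Finset.mem_univ _, mem_packings.2 ⟨fun j => ?_, fun j j' hjj => ?_⟩⟩
    · by_cases h : j = i
      · subst h; simpa using hRC
      · simpa [h] using h₀.1 j
    · by_cases h : j = i
      · subst h
        simpa [hjj.symm] using hdis j' (by simp [hjj.symm])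
      · by_cases h' : j' = i
        · subst h'
          simpa [h] using (hdis j (by simp [h])).symm
        · simpa [h, h'] using h₀.2 j j' hjj

/-- The number of packings of the union of `R` and of the other rectangles of `ω` that have `R`
among their rectangles. -/
def blockCount (C : Finset (Finset (Fin n))) (ω : Fin m → Rect n) (i : Fin m) (R : Rect n) : ℕ :=
  ((packings C m).filter fun ω' =>
    tupleUnion ω' = restUnion ω i ∪ cells R ∧ ∃ j, ω' j = R).card

/-- Replacing the rectangle `R₀` by `R` in a packing shows that `blockCount` does not depend on
the available rectangle. -/
theorem blockCount_le_blockCount {C : Finset (Finset (Fin n))} (hC : ∀ S ∈ C, S.Nonempty)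
    {ω : Fin m → Rect n} {i : Fin m} {R₀ R : Rect n} (hR₀ : R₀ ∈ available C ω i)
    (hR : R ∈ available C ω i) : blockCount C ω i R₀ ≤ blockCount C ω i R := by
  classical
  have hRC := ((mem_available_iff hR₀).1 hR).1
  have hd₀ := disjoint_restUnion_of_mem_available hR₀
  have hd := disjoint_restUnion_of_mem_available hR
  have hsub : ∀ ω' ∈ packings C m, tupleUnion ω' = restUnion ω i ∪ cells R₀ → ∀ j₀, ω' j₀ = R₀ →
      ∀ j, j ≠ j₀ → cells (ω' j) ⊆ restUnion ω i := by
    intro ω' hω' hU j₀ hj₀ j hj p hp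
    have : p ∈ restUnion ω i ∪ cells R₀ := hU ▸ mem_tupleUnion.2 ⟨j, hp⟩
    rcases Finset.mem_union.1 this with h | h
    · exact h
    · exact absurd hp (Finset.disjoint_right.1 ((mem_packings.1 hω').2 j j₀ hj) (hj₀ ▸ h))
  have hne : ∀ ω' ∈ packings C m, ∀ j, (cells (ω' j)).Nonempty := fun ω' hω' j =>
    (hC _ ((mem_packings.1 hω').1 j).1).product (hC _ ((mem_packings.1 hω').1 j).2)
  have hneR : ∀ ω' ∈ packings C m, tupleUnion ω' = restUnion ω i ∪ cells R₀ → ∀ j₀, ω' j₀ = R₀ →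
      ∀ j, j ≠ j₀ → ω' j ≠ R ∧ ω' j ≠ R₀ := by
    intro ω' hω' hU j₀ hj₀ j hj
    obtain ⟨p, hp⟩ := hne ω' hω' j
    have hp' := hsub ω' hω' hU j₀ hj₀ j hj hp
    constructor
    · intro h
      exact Finset.disjoint_right.1 hd hp' (h ▸ hp)
    · intro h
      exact Finset.disjoint_right.1 hd₀ hp' (h ▸ hp)
  refine Finset.card_le_card_of_injOn (fun ω' j => if ω' j = R₀ then R else ω' j) ?_ ?_
  · intro ω' hω'
    obtain ⟨hp, hU, j₀, hj₀⟩ := Finset.mem_filter.1 (Finset.mem_coe.1 hω')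
    refine Finset.mem_coe.2 (Finset.mem_filter.2 ⟨mem_packings.2 ⟨fun j => ?_, fun j j' hjj => ?_⟩,
      ?_, j₀, by simp [hj₀]⟩)
    · dsimp only
      split_ifs
      · exact hRC
      · exact (mem_packings.1 hp).1 j
    · by_cases h : j = j₀
      · subst h
        simp only [hj₀, if_true, (hneR ω' hp hU j hj₀ j' hjj.symm).2, if_false]
        exact hd.mono_right (hsub ω' hp hU j hj₀ j' hjj.symm)
      · by_cases h' : j' = j₀
        · subst h'
          simp only [hj₀, if_true, (hneR ω' hp hU j' hj₀ j hjj).2, if_false]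
          exact (hd.mono_right (hsub ω' hp hU j' hj₀ j hjj)).symm
        · simp only [(hneR ω' hp hU j₀ hj₀ j h).2, (hneR ω' hp hU j₀ hj₀ j' h').2, if_false]
          exact (mem_packings.1 hp).2 j j' hjj
    · ext p
      rw [mem_tupleUnion, Finset.mem_union]
      constructor
      · rintro ⟨j, hj⟩
        by_cases h : j = j₀
        · subst h; right; simpa [hj₀] using hj
        · left
          simp only [(hneR ω' hp hU j₀ hj₀ j h).2, if_false] at hj
          exact hsub ω' hp hU j₀ hj₀ j h hj
      · rintro (h | h)
        · obtain ⟨j, hj⟩ := mem_tupleUnion.1 (hU ▸ Finset.mem_union_left _ h : p ∈ tupleUnion ω')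
          have hjR : ω' j ≠ R₀ := fun hjR => Finset.disjoint_right.1 hd₀ h (hjR ▸ hj)
          exact ⟨j, by simpa [hjR] using hj⟩
        · exact ⟨j₀, by simpa [hj₀] using h⟩
  · intro ω₁ h₁ ω₂ h₂ heq
    obtain ⟨hp₁, hU₁, j₁, hj₁⟩ := Finset.mem_filter.1 (Finset.mem_coe.1 h₁)
    obtain ⟨hp₂, hU₂, j₂, hj₂⟩ := Finset.mem_filter.1 (Finset.mem_coe.1 h₂)
    funext j
    have hj := congrFun heq j
    dsimp only at hj
    by_cases e₁ : j = j₁ <;> by_cases e₂ : j = j₂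
    · rw [e₁, hj₁, ← e₁, e₂, hj₂]
    · have := hneR ω₂ hp₂ hU₂ j₂ hj₂ j e₂
      rw [if_pos (e₁ ▸ hj₁), if_neg this.2] at hj
      exact absurd hj.symm this.1
    · have := hneR ω₁ hp₁ hU₁ j₁ hj₁ j e₁
      rw [if_neg this.2, if_pos (e₂ ▸ hj₂)] at hj
      exact absurd hj this.1
    · rwa [if_neg (hneR ω₁ hp₁ hU₁ j₁ hj₁ j e₁).2, if_neg (hneR ω₂ hp₂ hU₂ j₂ hj₂ j e₂).2] at hj

/-- Conditionally on the other rectangles of `ω`, the rectangle at position `i` is dominated, up to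
the factor `κ`, by the uniform law on the available rectangles. Here `G` consists of rectangles
`R` that belong to every packing of the union they complete; such rectangles have the largest
weight among the available ones, so it suffices that they are numerous. -/
theorem sum_packingWeight_update_le {C : Finset (Finset (Fin n))} (hC : ∀ S ∈ C, S.Nonempty)
    (ω : Fin m → Rect n) (i : Fin m) {G : Finset (Rect n)} (hG : G ⊆ available C ω i)
    (hforced : ∀ R ∈ G, ∀ ω' ∈ packings C m,
      tupleUnion ω' = restUnion ω i ∪ cells R → ∃ j, ω' j = R)
    {g : Rect n → ℝ} (hg : ∀ R, 0 ≤ g R) {κ β : ℝ} (hβ0 : 0 ≤ β)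
    (hκ : ((available C ω i).card : ℝ) ≤ κ * G.card)
    (hβ : ∑ R ∈ available C ω i, g R ≤ β * (available C ω i).card) :
    ∑ R, packingWeight C m (Function.update ω i R) * g R
      ≤ κ * β * ∑ R, packingWeight C m (Function.update ω i R) := by
  classical
  have hzero : ∀ R, R ∉ available C ω i → packingWeight C m (Function.update ω i R) = 0 := by
    intro R hR
    rw [packingWeight, if_neg]
    simpa [available] using hR
  rcases (available C ω i).eq_empty_or_nonempty with he | ⟨R₀, hR₀⟩
  · simp [hzero, he]
  set a : ℝ := (blockCount C ω i R₀ : ℝ) with ha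
  have hblock : ∀ R ∈ available C ω i, (blockCount C ω i R : ℝ) = a := fun R hR => by
    rw [ha, Nat.cast_inj]
    exact le_antisymm (blockCount_le_blockCount hC hR hR₀) (blockCount_le_blockCount hC hR₀ hR)
  have hapos : 0 < a := by
    rw [ha, Nat.cast_pos, blockCount, Finset.card_pos]
    exact ⟨Function.update ω i R₀, Finset.mem_filter.2 ⟨(Finset.mem_filter.1 hR₀).2,
      tupleUnion_update ω i R₀, i, by simp⟩⟩
  have hle : ∀ R ∈ available C ω i, packingWeight C m (Function.update ω i R) ≤ a⁻¹ := by
    intro R hR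
    rw [packingWeight, if_pos (Finset.mem_filter.1 hR).2]
    refine inv_anti₀ hapos ?_
    rw [← hblock R hR, Nat.cast_le, tupleUnion_update]
    exact Finset.card_le_card fun ω' hω' => by
      rw [Finset.mem_filter] at hω' ⊢
      exact ⟨hω'.1, hω'.2.1⟩
  have heq : ∀ R ∈ G, packingWeight C m (Function.update ω i R) = a⁻¹ := by
    intro R hR
    rw [packingWeight, if_pos (Finset.mem_filter.1 (hG hR)).2, ← hblock R (hG hR),
      tupleUnion_update, packingCount, blockCount]
    congr 3
    refine Finset.filter_congr fun ω' hω' => ?_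
    exact ⟨fun h => ⟨h, hforced R hR ω' hω' h⟩, fun h => h.1⟩
  have hGsum : a⁻¹ * G.card ≤ ∑ R, packingWeight C m (Function.update ω i R) := by
    calc a⁻¹ * G.card = ∑ R ∈ G, packingWeight C m (Function.update ω i R) := by
          rw [Finset.sum_congr rfl heq, Finset.sum_const, nsmul_eq_mul, mul_comm]
      _ ≤ _ := Finset.sum_le_sum_of_subset_of_nonneg (Finset.subset_univ _)
          fun R _ _ => packingWeight_nonneg C m _
  have hκ0 : 0 ≤ κ := by
    by_contra hneg
    have h1 : (0 : ℝ) < (available C ω i).card := by exact_mod_cast Finset.card_pos.2 ⟨R₀, hR₀⟩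
    have h2 : κ * G.card ≤ 0 := mul_nonpos_of_nonpos_of_nonneg (by linarith) (by positivity)
    linarith
  calc ∑ R, packingWeight C m (Function.update ω i R) * g R
      = ∑ R ∈ available C ω i, packingWeight C m (Function.update ω i R) * g R := by
        symm
        refine Finset.sum_subset (Finset.subset_univ _) fun R _ hR => ?_
        rw [hzero R hR, zero_mul]
    _ ≤ ∑ R ∈ available C ω i, a⁻¹ * g R :=
        Finset.sum_le_sum fun R hR => mul_le_mul_of_nonneg_right (hle R hR) (hg R)
    _ = a⁻¹ * ∑ R ∈ available C ω i, g R := by rw [Finset.mul_sum]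
    _ ≤ a⁻¹ * (β * (κ * G.card)) := by
        gcongr
        exact hβ.trans (by gcongr)
    _ = κ * β * (a⁻¹ * G.card) := by ring
    _ ≤ _ := by gcongr

theorem sum_packingWeight (C : Finset (Finset (Fin n))) (m : ℕ) :
    ∑ ω, packingWeight C m ω = (unionsOfRectangles C m).card := by
  have := sum_packingWeight_mul C m fun _ => 1
  simpa using this

/-- The exponential moment of the overlap of a fixed set `K` with the rectangles in positions `J`,
restricted to an event `χ` that only depends on the positions outside `J`. -/
theorem sum_packingWeight_mul_exp_le {C : Finset (Finset (Fin n))} (hC : ∀ S ∈ C, S.Nonempty)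
    (K : Finset (Fin n × Fin n)) {μ : ℝ} (hμ : 0 ≤ μ) (J : Finset (Fin m))
    (χ : (Fin m → Rect n) → Prop) [DecidablePred χ]
    (hχ : ∀ ω, ∀ i ∈ J, ∀ R, χ (Function.update ω i R) ↔ χ ω) {κ β : ℝ} (hκ0 : 0 ≤ κ)
    (hβ0 : 0 ≤ β)
    (h : ∀ ω, χ ω → ∀ i ∈ J, (available C ω i).Nonempty → ∃ G ⊆ available C ω i,
      (∀ R ∈ G, ∀ ω' ∈ packings C m, tupleUnion ω' = restUnion ω i ∪ cells R → ∃ j, ω' j = R) ∧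
      ((available C ω i).card : ℝ) ≤ κ * G.card ∧
      ∑ R ∈ available C ω i, (Real.exp (μ * (K ∩ cells R).card) - 1)
        ≤ β * (available C ω i).card) :
    ∑ ω, packingWeight C m ω * (if χ ω then
        Real.exp (∑ i ∈ J, μ * (K ∩ cells (ω i)).card) else 0)
      ≤ (1 + κ * β) ^ J.card * (unionsOfRectangles C m).card := by
  classical
  have hexp : ∀ R : Rect n, 0 ≤ Real.exp (μ * (K ∩ cells R).card) - 1 := fun R =>
    sub_nonneg.2 (Real.one_le_exp (by positivity))
  have key := sum_mul_prod_le_pow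
    (fun ω : Fin m → Rect n => if χ ω then packingWeight C m ω else 0)
    (g := fun R => Real.exp (μ * (K ∩ cells R).card)) (fun R => (Real.exp_pos _).le)
    (c := 1 + κ * β) (by positivity) J ?_
  · calc _ = ∑ ω, (if χ ω then packingWeight C m ω else 0) *
          ∏ i ∈ J, Real.exp (μ * (K ∩ cells (ω i)).card) := by
          refine Finset.sum_congr rfl fun ω _ => ?_
          rw [Real.exp_sum]
          split_ifs <;> simp
      _ ≤ _ := key
      _ ≤ _ := by
          rw [← sum_packingWeight]
          gcongr with ω
          split_ifs
          · exact le_rfl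
          · exact packingWeight_nonneg C m ω
  · intro ω i hi
    simp only [hχ ω i hi]
    by_cases hω : χ ω
    · simp only [hω, if_true]
      rcases (available C ω i).eq_empty_or_nonempty with he | hne
      · have hzero : ∀ R, packingWeight C m (Function.update ω i R) = 0 := fun R => by
          rw [packingWeight, if_neg]
          intro hR
          have : R ∈ available C ω i := Finset.mem_filter.2 ⟨Finset.mem_univ _, hR⟩
          simp [he] at this
        simp [hzero]
      · obtain ⟨G, hG, hforced, hcard, hsum⟩ := h ω hω i hi hne
        have := sum_packingWeight_update_le hC ω i hG hforced hexp hβ0 hcard hsum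
        simp only [mul_sub, mul_one, Finset.sum_sub_distrib] at this
        linarith
    · simp [hω]

variable {n m k : ℕ}

/-! ### Consecutive index sets -/

/-- The set of the `k` consecutive indices starting at `s`. -/
def interval (n k s : ℕ) : Finset (Fin n) := Finset.univ.filter fun x => s ≤ x.val ∧ x.val < s + k

theorem mem_interval {s : ℕ} {x : Fin n} : x ∈ interval n k s ↔ s ≤ x.val ∧ x.val < s + k := by
  simp [interval]

theorem card_interval {s : ℕ} (hs : s + k ≤ n) : (interval n k s).card = k := by
  have : (interval n k s).map Fin.valEmbedding = Finset.Ico s (s + k) := by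
    ext x
    simp only [Finset.mem_map, mem_interval, Fin.valEmbedding_apply, Finset.mem_Ico]
    constructor
    · rintro ⟨y, hy, rfl⟩; exact hy
    · intro hx; exact ⟨⟨x, by omega⟩, hx, rfl⟩
  rw [← Finset.card_map Fin.valEmbedding, this, Nat.card_Ico]
  omega

theorem mem_consecutiveSets_iff (hk : 1 ≤ k) {S : Finset (Fin n)} :
    S ∈ consecutiveSets n k ↔ ∃ s, s + k ≤ n ∧ S = interval n k s := by
  simp only [consecutiveSets, Finset.mem_filter, Finset.mem_univ, true_and]
  constructor
  · rintro ⟨hcard, hconv⟩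
    have hne : S.Nonempty := Finset.card_pos.1 (by omega)
    have hS : S = Finset.Icc (S.min' hne) (S.max' hne) := by
      refine Finset.Subset.antisymm (fun x hx => ?_)
        (hconv _ (S.min'_mem hne) _ (S.max'_mem hne))
      exact Finset.mem_Icc.2 ⟨S.min'_le x hx, S.le_max' x hx⟩
    have hc : (S.max' hne).val + 1 - (S.min' hne).val = k := by
      rw [← Fin.card_Icc, ← hS, hcard]
    have := (S.max' hne).isLt
    refine ⟨(S.min' hne).val, by omega, ?_⟩
    refine hS.trans ?_
    ext x
    simp only [mem_interval, Finset.mem_Icc, Fin.le_def]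
    omega
  · rintro ⟨s, hs, rfl⟩
    refine ⟨card_interval hs, fun a ha b hb x hx => ?_⟩
    rw [mem_interval] at *
    rw [Finset.mem_Icc, Fin.le_def, Fin.le_def] at hx
    omega

theorem interval_injOn (hk : 1 ≤ k) {s t : ℕ} (hs : s + k ≤ n) (ht : t + k ≤ n)
    (h : interval n k s = interval n k t) : s = t := by
  have h1 : (⟨s, by omega⟩ : Fin n) ∈ interval n k t := h ▸ mem_interval.2 (by simp; omega)
  have h2 : (⟨t, by omega⟩ : Fin n) ∈ interval n k s := h ▸ mem_interval.2 (by simp; omega)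
  rw [mem_interval] at h1 h2
  simp at h1 h2
  omega

theorem consecutiveSets_eq_image (hk : 1 ≤ k) (hkn : k ≤ n) :
    consecutiveSets n k = (Finset.range (n + 1 - k)).image (interval n k) := by
  ext S
  rw [mem_consecutiveSets_iff hk, Finset.mem_image]
  constructor
  · rintro ⟨s, hs, rfl⟩; exact ⟨s, Finset.mem_range.2 (by omega), rfl⟩
  · rintro ⟨s, hs, rfl⟩
    rw [Finset.mem_range] at hs
    exact ⟨s, by omega, rfl⟩

theorem card_consecutiveSets (hk : 1 ≤ k) (hkn : k ≤ n) :
    (consecutiveSets n k).card = n + 1 - k := by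
  rw [consecutiveSets_eq_image hk hkn, Finset.card_image_of_injOn, Finset.card_range]
  intro s hs t ht h
  simp only [Finset.coe_range, Set.mem_Iio] at hs ht
  exact interval_injOn hk (by omega) (by omega) h

theorem card_of_mem_consecutiveSets {S : Finset (Fin n)} (hS : S ∈ consecutiveSets n k) :
    S.card = k := by
  simp only [consecutiveSets, Finset.mem_filter] at hS
  exact hS.2.1

/-- The consecutive sets meeting a given one start less than `k` away from it. -/
theorem card_filter_not_disjoint_le (hk : 1 ≤ k) {S₀ : Finset (Fin n)}
    (hS₀ : S₀ ∈ consecutiveSets n k) :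
    ((consecutiveSets n k).filter fun S => ¬ Disjoint S S₀).card ≤ 2 * k := by
  obtain ⟨s, hs, rfl⟩ := (mem_consecutiveSets_iff hk).1 hS₀
  have : ((consecutiveSets n k).filter fun S => ¬ Disjoint S (interval n k s))
      ⊆ (Finset.Ico (s - k) (s + k)).image (interval n k) := by
    intro S hS
    obtain ⟨hS, hd⟩ := Finset.mem_filter.1 hS
    obtain ⟨t, ht, rfl⟩ := (mem_consecutiveSets_iff hk).1 hS
    obtain ⟨x, hx, hx'⟩ := Finset.not_disjoint_iff.1 hd
    rw [mem_interval] at hx hx'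
    exact Finset.mem_image.2 ⟨t, Finset.mem_Ico.2 (by omega), rfl⟩
  refine (Finset.card_le_card this).trans (Finset.card_image_le.trans ?_)
  rw [Nat.card_Ico]
  omega

theorem disjoint_cells_iff {R R' : Rect n} :
    Disjoint (cells R) (cells R') ↔ Disjoint R.1 R'.1 ∨ Disjoint R.2 R'.2 :=
  Finset.disjoint_product

theorem card_filter_meets_le (hk : 1 ≤ k) {ω : Fin m → Rect n} (s : Finset (Fin m))
    (hω : ∀ j ∈ s, (ω j).1 ∈ consecutiveSets n k ∧ (ω j).2 ∈ consecutiveSets n k) :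
    ((consecutiveSets n k ×ˢ consecutiveSets n k).filter fun R =>
      ¬ Disjoint (cells R) (s.biUnion fun j => cells (ω j))).card ≤ s.card * (4 * k ^ 2) := by
  have hsub : ((consecutiveSets n k ×ˢ consecutiveSets n k).filter fun R =>
      ¬ Disjoint (cells R) (s.biUnion fun j => cells (ω j)))
      ⊆ s.biUnion fun j => ((consecutiveSets n k).filter fun S => ¬ Disjoint S (ω j).1) ×ˢ
        ((consecutiveSets n k).filter fun S => ¬ Disjoint S (ω j).2) := by
    intro R hR
    obtain ⟨hR, hd⟩ := Finset.mem_filter.1 hR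
    rw [Finset.disjoint_biUnion_right] at hd
    push Not at hd
    obtain ⟨j, hj, hd⟩ := hd
    rw [disjoint_cells_iff] at hd
    push Not at hd
    rw [Finset.mem_product] at hR
    exact Finset.mem_biUnion.2 ⟨j, hj, Finset.mem_product.2
      ⟨Finset.mem_filter.2 ⟨hR.1, hd.1⟩, Finset.mem_filter.2 ⟨hR.2, hd.2⟩⟩⟩
  refine (Finset.card_le_card hsub).trans (Finset.card_biUnion_le_card_mul _ _ _ fun j hj => ?_)
  rw [Finset.card_product]
  calc _ ≤ (2 * k) * (2 * k) := Nat.mul_le_mul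
        (card_filter_not_disjoint_le hk (hω j hj).1)
        (card_filter_not_disjoint_le hk (hω j hj).2)
    _ = 4 * k ^ 2 := by ring

/-- A union of disjoint `k × k` squares has only one packing, up to order: the square of smallest
corner of the one packing and the square covering this corner in the other packing have the same
corner. -/
theorem exists_eq_of_tupleUnion_eq (hk : 1 ≤ k) {ω ω' : Fin m → Rect n}
    (hω : ω ∈ packings (consecutiveSets n k) m) (hω' : ω' ∈ packings (consecutiveSets n k) m)
    (hU : tupleUnion ω' = tupleUnion ω) (i : Fin m) : ∃ j, ω' j = ω i := by
  suffices ∀ N s t, s + t = N → s + k ≤ n → t + k ≤ n → ∀ ω ω' : Fin m → Rect n,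
      ω ∈ packings (consecutiveSets n k) m → ω' ∈ packings (consecutiveSets n k) m →
      tupleUnion ω' = tupleUnion ω → ∀ i, ω i = (interval n k s, interval n k t) →
      ∃ j, ω' j = ω i by
    obtain ⟨s, hs, hs'⟩ := (mem_consecutiveSets_iff hk).1 ((mem_packings.1 hω).1 i).1
    obtain ⟨t, ht, ht'⟩ := (mem_consecutiveSets_iff hk).1 ((mem_packings.1 hω).1 i).2
    exact this _ s t rfl hs ht ω ω' hω hω' hU i (Prod.ext hs' ht')
  intro N
  induction N using Nat.strong_induction_on with
  | _ N ih =>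
    intro s t hN hs ht ω ω' hω hω' hU i hi
    have hx : ((⟨s, by omega⟩, ⟨t, by omega⟩) : Fin n × Fin n) ∈ cells (ω i) := by
      rw [hi, cells, Finset.mem_product, mem_interval, mem_interval]
      simp; omega
    obtain ⟨j, hj⟩ := mem_tupleUnion.1 (hU ▸ mem_tupleUnion.2 ⟨i, hx⟩)
    obtain ⟨s', hs', hs''⟩ := (mem_consecutiveSets_iff hk).1 ((mem_packings.1 hω').1 j).1
    obtain ⟨t', ht', ht''⟩ := (mem_consecutiveSets_iff hk).1 ((mem_packings.1 hω').1 j).2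
    have hjeq : ω' j = (interval n k s', interval n k t') := Prod.ext hs'' ht''
    have hj' := hj
    rw [hjeq, cells, Finset.mem_product, mem_interval, mem_interval] at hj'
    simp only at hj'
    by_cases heq : s' = s ∧ t' = t
    · exact ⟨j, by rw [hjeq, hi, heq.1, heq.2]⟩
    · obtain ⟨i', hi'⟩ := ih (s' + t') (by omega) s' t' rfl hs' ht' ω' ω hω' hω hU.symm j hjeq
      by_cases hii : i' = i
      · exact ⟨j, by rw [← hi', hii]⟩
      · exact absurd hx (Finset.disjoint_left.1 ((mem_packings.1 hω).2 i' i hii) (hi' ▸ hj))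

theorem consecutiveSupports_nonempty (hmk : m * k ≤ n) : (consecutiveSupports n k m).Nonempty := by
  rcases Nat.eq_zero_or_pos k with rfl | hk
  · rw [consecutiveSupports, unionsOfRectangles_eq_image, Finset.image_nonempty]
    refine ⟨fun _ => (∅, ∅), mem_packings.2 ⟨fun i => ?_, fun i j hij => ?_⟩⟩
    · simp [consecutiveSets]
    · simp [cells]
  rw [consecutiveSupports, unionsOfRectangles_eq_image, Finset.image_nonempty]
  have hik : ∀ i : Fin m, i.val * k + k ≤ n := fun i => by
    have : (i.val + 1) * k ≤ m * k := Nat.mul_le_mul_right k i.isLt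
    linarith
  refine ⟨fun i => (interval n k (i.val * k), interval n k (i.val * k)), mem_packings.2
    ⟨fun i => ?_, fun i j hij => ?_⟩⟩
  · exact ⟨(mem_consecutiveSets_iff hk).2 ⟨_, hik i, rfl⟩,
      (mem_consecutiveSets_iff hk).2 ⟨_, hik i, rfl⟩⟩
  · rw [disjoint_cells_iff]
    left
    rw [Finset.disjoint_left]
    intro x hx hx'
    rw [mem_interval] at hx hx'
    have h1 : i.val * k < (j.val + 1) * k := by linarith
    have h2 : j.val * k < (i.val + 1) * k := by linarith
    have := Nat.lt_of_mul_lt_mul_right h1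
    have := Nat.lt_of_mul_lt_mul_right h2
    exact hij (Fin.ext (by omega))

theorem exp_sub_one_le_two_mul {x : ℝ} (h0 : 0 ≤ x) (h1 : x ≤ 1) : Real.exp x - 1 ≤ 2 * x := by
  have := Real.abs_exp_sub_one_le (x := x) (by rwa [abs_of_nonneg h0])
  rw [abs_of_nonneg h0] at this
  exact (le_abs_self _).trans this

theorem card_le_of_mem_unionsOfRectangles {C : Finset (Finset (Fin n))}
    (hC : ∀ S ∈ C, S.card = k) {K : Finset (Fin n × Fin n)} (hK : K ∈ unionsOfRectangles C m) :
    K.card = m * k ^ 2 := by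
  rw [unionsOfRectangles_eq_image] at hK
  obtain ⟨ω, hω, rfl⟩ := Finset.mem_image.1 hK
  exact card_tupleUnion hC hω

/-- The exponential moment of the overlap of a union of squares with a random one. -/
theorem sum_exp_inter_consecutiveSupports_le (hk : 1 ≤ k) (hmk : m * k ≤ n) {l : ℝ}
    (hl : l ^ 2 * k ^ 2 ≤ 1) {K : Finset (Fin n × Fin n)} (hK : K ∈ consecutiveSupports n k m) :
    ∑ K' ∈ consecutiveSupports n k m, Real.exp (l ^ 2 * (K ∩ K').card)
      ≤ Real.exp (32 * (l ^ 2 * k ^ 2)) * (consecutiveSupports n k m).card := by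
  classical
  have hkR : (1 : ℝ) ≤ k := by exact_mod_cast hk
  have hmkR : (m : ℝ) * k ≤ n := by exact_mod_cast hmk
  have hl0 : 0 ≤ l ^ 2 * (k : ℝ) ^ 2 := by positivity
  by_cases hlarge : n ≤ 16 * k
  · have hn : (n : ℝ) ≤ 16 * k := by exact_mod_cast hlarge
    calc _ ≤ ∑ K' ∈ consecutiveSupports n k m, Real.exp (32 * (l ^ 2 * k ^ 2)) := by
          refine Finset.sum_le_sum fun K' _ => Real.exp_le_exp.2 ?_
          have h1 : ((K ∩ K').card : ℝ) ≤ m * k ^ 2 := by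
            rw [← Nat.cast_pow, ← Nat.cast_mul, Nat.cast_le,
              ← card_le_of_mem_unionsOfRectangles (fun S => card_of_mem_consecutiveSets) hK]
            exact Finset.card_le_card Finset.inter_subset_left
          have h2 : (m : ℝ) * k ^ 2 ≤ 16 * k ^ 2 := by nlinarith
          calc l ^ 2 * ((K ∩ K').card : ℝ) ≤ l ^ 2 * (16 * k ^ 2) := by
                gcongr; linarith
            _ ≤ _ := by linarith
      _ = _ := by rw [Finset.sum_const, nsmul_eq_mul, mul_comm]
  have hsmall : 16 * k < n := not_le.1 hlarge
  have hnR : (16 : ℝ) * k < n := by exact_mod_cast hsmall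
  have hn0 : (0 : ℝ) < n := by linarith
  have hkn : k ≤ n := by omega
  set C := consecutiveSets n k with hCdef
  have hCne : ∀ S ∈ C, S.Nonempty := fun S hS =>
    Finset.card_pos.1 (by rw [card_of_mem_consecutiveSets hS]; omega)
  obtain ⟨ψ, hψ, hψK⟩ : ∃ ψ ∈ packings C m, tupleUnion ψ = K := by
    rw [consecutiveSupports, unionsOfRectangles_eq_image] at hK
    simpa using hK
  have hM : ((C ×ˢ C).card : ℝ) = (n + 1 - k : ℝ) ^ 2 := by
    rw [Finset.card_product, card_consecutiveSets hk hkn, Nat.cast_mul,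
      Nat.cast_sub (by omega)]
    push_cast
    ring
  have hM' : (n : ℝ) ^ 2 * (225 / 256) ≤ (C ×ˢ C).card := by
    rw [hM]
    nlinarith
  have key := sum_packingWeight_mul_exp_le (m := m) hCne K (sq_nonneg l) Finset.univ
    (fun _ => True) (fun _ _ _ _ => Iff.rfl) (κ := 1)
    (β := 32 * (m * (l ^ 2 * k ^ 4)) / n ^ 2) zero_le_one (by positivity) ?_
  · have hL : ∑ K' ∈ consecutiveSupports n k m, Real.exp (l ^ 2 * (K ∩ K').card)
        = ∑ ω, packingWeight C m ω * (if True then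
          Real.exp (∑ i ∈ Finset.univ, l ^ 2 * (K ∩ cells (ω i)).card) else 0) := by
      rw [consecutiveSupports, ← sum_packingWeight_mul]
      refine Finset.sum_congr rfl fun ω _ => ?_
      by_cases hω : ω ∈ packings C m
      · simp only [if_true]
        rw [card_inter_tupleUnion hω, Nat.cast_sum, Finset.mul_sum]
      · simp [packingWeight, ← hCdef, hω]
    rw [hL]
    refine key.trans ?_
    change _ ≤ _ * ((unionsOfRectangles C m).card : ℝ)
    gcongr
    rw [one_mul, Finset.card_univ, Fintype.card_fin, add_comm]
    calc _ ≤ Real.exp (32 * (m * (l ^ 2 * k ^ 4)) / n ^ 2) ^ m := by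
          gcongr
          exact Real.add_one_le_exp _
      _ = Real.exp (32 * (l ^ 2 * k ^ 2) * ((m * k) / n) ^ 2) := by
          rw [← Real.exp_nat_mul]
          congr 1
          field_simp
      _ ≤ _ := by
          rw [Real.exp_le_exp]
          refine mul_le_of_le_one_right (by positivity) (pow_le_one₀ (by positivity) ?_)
          rwa [div_le_one hn0]
  · intro ω _ i _ hne
    obtain ⟨R₀, hR₀⟩ := hne
    refine ⟨available C ω i, subset_rfl, ?_, by simp, ?_⟩
    · intro R hR ω' hω' hU
      have hupd := (Finset.mem_filter.1 hR).2
      rw [← tupleUnion_update] at hU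
      obtain ⟨j, hj⟩ := exists_eq_of_tupleUnion_eq hk hupd hω' hU i
      exact ⟨j, by simpa using hj⟩
    · have hωC : ∀ j ∈ Finset.univ.erase i, (ω j).1 ∈ C ∧ (ω j).2 ∈ C := fun j hj => by
        have := (mem_packings.1 (Finset.mem_filter.1 hR₀).2).1 j
        simpa [Finset.ne_of_mem_erase hj] using this
      have hav : ((C ×ˢ C).filter fun R => Disjoint (cells R) (restUnion ω i))
          ⊆ available C ω i := fun R hR => by
        rw [mem_available_iff hR₀]
        obtain ⟨h1, h2⟩ := Finset.mem_filter.1 hR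
        exact ⟨Finset.mem_product.1 h1, h2⟩
      have hblocked := card_filter_meets_le hk (Finset.univ.erase i) hωC
      have hsplit := Finset.card_filter_add_card_filter_not (s := C ×ˢ C)
        (fun R => Disjoint (cells R) (restUnion ω i))
      have hcard : ((C ×ˢ C).card : ℝ) ≤ (available C ω i).card + m * (4 * k ^ 2) := by
        have h1 := Finset.card_le_card hav
        have h2 : (Finset.univ.erase i).card * (4 * k ^ 2) ≤ m * (4 * k ^ 2) :=
          Nat.mul_le_mul_right _ (by simp)
        have : (C ×ˢ C).card ≤ (available C ω i).card + m * (4 * k ^ 2) := by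
          rw [← hsplit]
          exact Nat.add_le_add h1 (hblocked.trans h2)
        exact_mod_cast this
      have hmk2 : (m : ℝ) * (4 * k ^ 2) ≤ n ^ 2 / 4 := by nlinarith
      have hav2 : (n : ℝ) ^ 2 / 2 ≤ (available C ω i).card := by nlinarith
      have hmeet : (((C ×ˢ C).filter fun R => ¬ Disjoint (cells R) K).card : ℝ)
          ≤ m * (4 * k ^ 2) := by
        have := card_filter_meets_le hk (ω := ψ) Finset.univ
          fun j _ => (mem_packings.1 hψ).1 j
        rw [Finset.card_univ, Fintype.card_fin] at this
        rw [← hψK]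
        exact_mod_cast this
      have hterm : ∀ R ∈ available C ω i, Real.exp (l ^ 2 * (K ∩ cells R).card) - 1
          ≤ if ¬ Disjoint (cells R) K then 2 * (l ^ 2 * k ^ 2) else 0 := by
        intro R hR
        have hRC := ((mem_available_iff hR₀).1 hR).1
        split_ifs with hd
        · have : ((K ∩ cells R).card : ℝ) = 0 := by
            rw [Finset.inter_comm, Finset.disjoint_iff_inter_eq_empty.1 hd]; simp
          simp [this]
        · have hle : ((K ∩ cells R).card : ℝ) ≤ k ^ 2 := by
            have : (K ∩ cells R).card ≤ k ^ 2 := by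
              refine (Finset.card_le_card Finset.inter_subset_right).trans ?_
              rw [cells, Finset.card_product, card_of_mem_consecutiveSets hRC.1,
                card_of_mem_consecutiveSets hRC.2, sq]
            exact_mod_cast this
          have h1 : l ^ 2 * ((K ∩ cells R).card : ℝ) ≤ l ^ 2 * k ^ 2 := by gcongr
          have := exp_sub_one_le_two_mul (x := l ^ 2 * ((K ∩ cells R).card : ℝ)) (by positivity)
            (h1.trans hl)
          linarith
      have hav3 : available C ω i ⊆ C ×ˢ C := fun R hR =>
        Finset.mem_product.2 ((mem_available_iff hR₀).1 hR).1
      calc _ ≤ ∑ R ∈ available C ω i, if ¬ Disjoint (cells R) K then 2 * (l ^ 2 * (k : ℝ) ^ 2)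
              else 0 := Finset.sum_le_sum hterm
        _ ≤ ∑ R ∈ C ×ˢ C, if ¬ Disjoint (cells R) K then 2 * (l ^ 2 * (k : ℝ) ^ 2) else 0 :=
            Finset.sum_le_sum_of_subset_of_nonneg hav3 fun R _ _ => by split_ifs <;> positivity
        _ = ((C ×ˢ C).filter fun R => ¬ Disjoint (cells R) K).card * (2 * (l ^ 2 * k ^ 2)) := by
            rw [← Finset.sum_filter, Finset.sum_const, nsmul_eq_mul]
        _ ≤ m * (4 * k ^ 2) * (2 * (l ^ 2 * k ^ 2)) := by gcongr
        _ ≤ 32 * (m * (l ^ 2 * k ^ 4)) / n ^ 2 * (n ^ 2 / 2) := by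
            have : 32 * (m * (l ^ 2 * (k : ℝ) ^ 4)) / n ^ 2 * (n ^ 2 / 2)
              = 16 * (m * (l ^ 2 * k ^ 4)) := by field_simp; ring
            rw [this]
            have : 0 ≤ m * (l ^ 2 * (k : ℝ) ^ 4) := by positivity
            linarith
        _ ≤ _ := by gcongr

/-- In consecutive submatrix detection the distance is controlled by `l * k` alone. -/
theorem tvDist_consecutiveSupports_le (hk : 1 ≤ k) (hmk : m * k ≤ n) {l : ℝ}
    (hl : l ^ 2 * k ^ 2 ≤ 1) :
    tvDist (nullLaw n (gaussianReal 0 1))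
        (plantedLaw (consecutiveSupports n k m) (gaussianReal l 1) (gaussianReal 0 1))
      ≤ Real.sqrt (Real.exp (32 * (l ^ 2 * k ^ 2)) - 1) := by
  have := tvDist_le_of_subfamily l (consecutiveSupports_nonempty hmk) subset_rfl
    fun K hK => sum_exp_inter_consecutiveSupports_le hk hmk hl hK
  simpa using this

theorem sizeSets_one (n : ℕ) : sizeSets n 1 = consecutiveSets n 1 := by
  ext S
  simp only [sizeSets, consecutiveSets, Finset.mem_filter, Finset.mem_univ, true_and]
  refine ⟨fun h => ⟨h, ?_⟩, fun h => h.1⟩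
  obtain ⟨x, rfl⟩ := Finset.card_eq_one.1 h
  simp

/-! ### Sampling without replacement -/

section Sampling

variable {α : Type*} [DecidableEq α]

theorem succ_mul_sum_powersetCard_prod (y : α → ℝ) (A : Finset α) (k : ℕ) :
    ((k : ℝ) + 1) * ∑ S ∈ A.powersetCard (k + 1), ∏ s ∈ S, y s
      = ∑ a ∈ A, y a * ∑ S ∈ (A.erase a).powersetCard k, ∏ s ∈ S, y s := by
  have h1 : ((k : ℝ) + 1) * ∑ S ∈ A.powersetCard (k + 1), ∏ s ∈ S, y s
      = ∑ S ∈ A.powersetCard (k + 1), ∑ a ∈ S, ∏ s ∈ S, y s := by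
    rw [Finset.mul_sum]
    refine Finset.sum_congr rfl fun S hS => ?_
    rw [Finset.sum_const, (Finset.mem_powersetCard.1 hS).2, nsmul_eq_mul]
    push_cast
    ring
  rw [h1]
  simp only [Finset.mul_sum]
  rw [Finset.sum_sigma', Finset.sum_sigma']
  refine Finset.sum_bij' (fun p _ => ⟨p.2, p.1.erase p.2⟩) (fun p _ => ⟨insert p.1 p.2, p.1⟩)
    ?_ ?_ ?_ ?_ ?_
  · rintro ⟨S, a⟩ h
    simp only [Finset.mem_sigma, Finset.mem_powersetCard] at h ⊢
    refine ⟨h.1.1 h.2, Finset.erase_subset_erase _ h.1.1, ?_⟩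
    rw [Finset.card_erase_of_mem h.2, h.1.2]
    rfl
  · rintro ⟨a, S⟩ h
    simp only [Finset.mem_sigma, Finset.mem_powersetCard] at h ⊢
    have ha : a ∉ S := fun hmem => Finset.notMem_erase a A (h.2.1 hmem)
    refine ⟨⟨Finset.insert_subset h.1 (h.2.1.trans (Finset.erase_subset _ _)), ?_⟩,
      Finset.mem_insert_self _ _⟩
    rw [Finset.card_insert_of_notMem ha, h.2.2]
  · rintro ⟨S, a⟩ h
    simp only [Finset.mem_sigma, Finset.mem_powersetCard] at h
    simp [Finset.insert_erase h.2]
  · rintro ⟨a, S⟩ h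
    simp only [Finset.mem_sigma, Finset.mem_powersetCard] at h
    have ha : a ∉ S := fun hmem => Finset.notMem_erase a A (h.2.1 hmem)
    simp [Finset.erase_insert ha]
  · rintro ⟨S, a⟩ h
    simp only [Finset.mem_sigma] at h
    exact (Finset.mul_prod_erase S y h.2).symm

/-- The mean of a product over a random `k`-subset, drawn without replacement: while the subset is
revealed element by element, at least `D` elements remain, so every new element contributes a
factor at most `1 + U / D`. -/
theorem sum_powersetCard_prod_one_add_le {u : α → ℝ} {U D : ℝ} (hD : 0 < D) (k : ℕ)
    (A : Finset α) (hu : ∀ a ∈ A, 0 ≤ u a) (hU : ∑ a ∈ A, u a ≤ U) (hA : D + k ≤ A.card + 1) :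
    ∑ S ∈ A.powersetCard k, ∏ s ∈ S, (1 + u s) ≤ A.card.choose k * (1 + U / D) ^ k := by
  induction k generalizing A with
  | zero => simp
  | succ k ih =>
    have hU0 : 0 ≤ U := (Finset.sum_nonneg hu).trans hU
    have hDA : D ≤ A.card := by push_cast at hA; have : (0:ℝ) ≤ k := by positivity
                                linarith
    have hApos : 0 < A.card := by
      have : (0 : ℝ) < A.card := hD.trans_le hDA
      exact_mod_cast this
    have hstep : ∀ a ∈ A, ∑ S ∈ (A.erase a).powersetCard k, ∏ s ∈ S, (1 + u s)
        ≤ (A.card - 1).choose k * (1 + U / D) ^ k := by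
      intro a ha
      rw [← Finset.card_erase_of_mem ha]
      refine ih _ (fun b hb => hu b (Finset.mem_of_mem_erase hb)) ?_ ?_
      · refine (Finset.sum_le_sum_of_subset_of_nonneg (Finset.erase_subset _ _)
          fun b hb _ => hu b hb).trans hU
      · rw [Finset.card_erase_of_mem ha, Nat.cast_sub hApos]
        push_cast at hA ⊢
        linarith
    have hkey : ((k : ℝ) + 1) * ∑ S ∈ A.powersetCard (k + 1), ∏ s ∈ S, (1 + u s)
        ≤ ((k : ℝ) + 1) * (A.card.choose (k + 1) * (1 + U / D) ^ (k + 1)) := by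
      rw [succ_mul_sum_powersetCard_prod]
      calc _ ≤ ∑ a ∈ A, (1 + u a) * ((A.card - 1).choose k * (1 + U / D) ^ k) := by
            refine Finset.sum_le_sum fun a ha => mul_le_mul_of_nonneg_left (hstep a ha) ?_
            have := hu a ha
            linarith
        _ = (A.card + ∑ a ∈ A, u a) * ((A.card - 1).choose k * (1 + U / D) ^ k) := by
            rw [← Finset.sum_mul, Finset.sum_add_distrib, Finset.sum_const, nsmul_eq_mul, mul_one]
        _ ≤ (A.card * (1 + U / D)) * ((A.card - 1).choose k * (1 + U / D) ^ k) := by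
            gcongr
            have : U ≤ A.card * (U / D) := by
              rw [mul_div_assoc', le_div_iff₀ hD, mul_comm]
              gcongr
            linarith
        _ = ((A.card : ℝ) * (A.card - 1).choose k) * (1 + U / D) ^ (k + 1) := by ring
        _ = _ := by
            have : A.card * (A.card - 1).choose k = A.card.choose (k + 1) * (k + 1) := by
              have := Nat.add_one_mul_choose_eq (A.card - 1) k
              rwa [Nat.sub_add_cancel hApos] at this
            have : (A.card : ℝ) * (A.card - 1).choose k = A.card.choose (k + 1) * (k + 1) := by
              exact_mod_cast this
            rw [this]
            ring
    exact le_of_mul_le_mul_left hkey (by positivity)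

theorem sum_powersetCard_exp_le {x : α → ℝ} {D : ℝ} (hD : 0 < D) (k : ℕ)
    (A : Finset α) (h0 : ∀ a ∈ A, 0 ≤ x a) (h1 : ∀ a ∈ A, x a ≤ 1) (hA : D + k ≤ A.card + 1) :
    ∑ S ∈ A.powersetCard k, Real.exp (∑ s ∈ S, x s)
      ≤ A.card.choose k * Real.exp (2 * k / D * ∑ a ∈ A, x a) := by
  have hsum : ∑ a ∈ A, (Real.exp (x a) - 1) ≤ 2 * ∑ a ∈ A, x a := by
    rw [Finset.mul_sum]
    exact Finset.sum_le_sum fun a ha => exp_sub_one_le_two_mul (h0 a ha) (h1 a ha)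
  have := sum_powersetCard_prod_one_add_le hD k A
    (fun a ha => sub_nonneg.2 (Real.one_le_exp (h0 a ha))) hsum hA
  simp only [add_sub_cancel, ← Real.exp_sum] at this
  refine this.trans ?_
  have hx : 0 ≤ ∑ a ∈ A, x a := Finset.sum_nonneg h0
  gcongr
  calc (1 + (2 * ∑ a ∈ A, x a) / D) ^ k ≤ Real.exp ((2 * ∑ a ∈ A, x a) / D) ^ k := by
        gcongr
        rw [add_comm]
        exact Real.add_one_le_exp _
    _ = _ := by
        rw [← Real.exp_nat_mul]
        congr 1
        ring

theorem choose_mul_pow_le_choose_mul_pow {a b : ℕ} (hab : a ≤ b) (k : ℕ) :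
    a.choose k * b ^ k ≤ b.choose k * a ^ k := by
  have hdesc : a.descFactorial k * b ^ k ≤ b.descFactorial k * a ^ k := by
    induction k with
    | zero => simp
    | succ k ih =>
      rw [Nat.descFactorial_succ, Nat.descFactorial_succ, pow_succ, pow_succ]
      have h : (a - k) * b ≤ (b - k) * a := by
        rw [Nat.sub_mul, Nat.sub_mul, mul_comm b a]
        exact Nat.sub_le_sub_left (Nat.mul_le_mul_left k hab) _
      calc _ = ((a - k) * b) * (a.descFactorial k * b ^ k) := by ring
        _ ≤ ((b - k) * a) * (b.descFactorial k * a ^ k) := Nat.mul_le_mul h ih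
        _ = _ := by ring
  rw [Nat.descFactorial_eq_factorial_mul_choose, Nat.descFactorial_eq_factorial_mul_choose,
    mul_assoc, mul_assoc] at hdesc
  exact Nat.le_of_mul_le_mul_left hdesc (Nat.factorial_pos k)

/-- A random `k`-subset of `A` misses a subset `E` with probability at most `v ^ k`, where `v`
bounds the proportion of the complement of `E`. -/
theorem le_card_filter_not_disjoint (k : ℕ) {A E : Finset α} (hE : E ⊆ A) {v : ℝ}
    (hvE : (A.card : ℝ) - E.card ≤ v * A.card) :
    (1 - v ^ k) * A.card.choose k
      ≤ ((A.powersetCard k).filter fun S => ¬ Disjoint S E).card := by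
  have hd : (A.powersetCard k).filter (fun S => Disjoint S E) = (A \ E).powersetCard k := by
    ext S
    simp only [Finset.mem_filter, Finset.mem_powersetCard, Finset.subset_sdiff]
    tauto
  have hsplit := Finset.card_filter_add_card_filter_not (s := A.powersetCard k)
    (fun S => Disjoint S E)
  rw [hd, Finset.card_powersetCard, Finset.card_powersetCard] at hsplit
  have hcE : ((A \ E).card : ℝ) = A.card - E.card := by
    rw [Finset.card_sdiff_of_subset hE, Nat.cast_sub (Finset.card_le_card hE)]
  have hle : ((A \ E).card.choose k : ℝ) ≤ v ^ k * A.card.choose k := by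
    rcases Nat.eq_zero_or_pos A.card with h0 | hpos
    · have hA : A = ∅ := Finset.card_eq_zero.1 h0
      subst hA
      rcases Nat.eq_zero_or_pos k with rfl | hk
      · simp
      · simp [Nat.choose_eq_zero_of_lt hk]
    have hposR : (0 : ℝ) < A.card := by exact_mod_cast hpos
    have h := choose_mul_pow_le_choose_mul_pow (Finset.card_le_card (Finset.sdiff_subset :
      A \ E ⊆ A)) k
    have hR : ((A \ E).card.choose k : ℝ) * (A.card : ℝ) ^ k
        ≤ A.card.choose k * ((A \ E).card : ℝ) ^ k := by exact_mod_cast h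
    have h2 : ((A \ E).card : ℝ) ^ k ≤ (v * A.card) ^ k := by
      gcongr
      rw [hcE]
      exact hvE
    have h3 : ((A \ E).card.choose k : ℝ) * (A.card : ℝ) ^ k
        ≤ (v ^ k * A.card.choose k) * (A.card : ℝ) ^ k := by
      calc _ ≤ A.card.choose k * (v * A.card) ^ k := hR.trans (by gcongr)
        _ = _ := by rw [mul_pow]; ring
    exact le_of_mul_le_mul_right h3 (by positivity)
  have : ((A \ E).card.choose k : ℝ) + ((A.powersetCard k).filter fun S => ¬ Disjoint S E).card
      = A.card.choose k := by exact_mod_cast hsplit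
  linarith

end Sampling

/-! ### Rectangles with arbitrary sides outside a given set of entries -/

variable {n m k : ℕ}

theorem sizeSets_eq_powersetCard (n k : ℕ) :
    sizeSets n k = (Finset.univ : Finset (Fin n)).powersetCard k := by
  ext S
  simp [sizeSets, Finset.mem_powersetCard]

theorem mem_sizeSets {S : Finset (Fin n)} : S ∈ sizeSets n k ↔ S.card = k := by
  simp [sizeSets]

/-- The rows without an entry of `W` in a column of `T`. -/
def freeRows (W : Finset (Fin n × Fin n)) (T : Finset (Fin n)) : Finset (Fin n) :=
  Finset.univ.filter fun r => ∀ c ∈ T, (r, c) ∉ W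

/-- The columns without an entry of `W` in a row of `S`. -/
def freeCols (W : Finset (Fin n × Fin n)) (S : Finset (Fin n)) : Finset (Fin n) :=
  Finset.univ.filter fun c => ∀ r ∈ S, (r, c) ∉ W

/-- The rows without any entry of `W`. -/
def emptyRows (W : Finset (Fin n × Fin n)) : Finset (Fin n) := freeRows W Finset.univ

/-- The columns without any entry of `W`. -/
def emptyCols (W : Finset (Fin n × Fin n)) : Finset (Fin n) := freeCols W Finset.univ

theorem mem_emptyRows {W : Finset (Fin n × Fin n)} {r : Fin n} :
    r ∈ emptyRows W ↔ ∀ c, (r, c) ∉ W := by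
  simp [emptyRows, freeRows]

theorem mem_emptyCols {W : Finset (Fin n × Fin n)} {c : Fin n} :
    c ∈ emptyCols W ↔ ∀ r, (r, c) ∉ W := by
  simp [emptyCols, freeCols]

theorem emptyRows_subset_freeRows (W : Finset (Fin n × Fin n)) (T : Finset (Fin n)) :
    emptyRows W ⊆ freeRows W T := fun _ hr =>
  Finset.mem_filter.2 ⟨Finset.mem_univ _, fun c _ => mem_emptyRows.1 hr c⟩

theorem emptyCols_subset_freeCols (W : Finset (Fin n × Fin n)) (S : Finset (Fin n)) :
    emptyCols W ⊆ freeCols W S := fun _ hc =>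
  Finset.mem_filter.2 ⟨Finset.mem_univ _, fun r _ => mem_emptyCols.1 hc r⟩

/-- The `k × k` rectangles disjoint from `W`. -/
def openRects (W : Finset (Fin n × Fin n)) (k : ℕ) : Finset (Rect n) :=
  (sizeSets n k ×ˢ sizeSets n k).filter fun R => Disjoint (cells R) W

theorem mem_openRects {W : Finset (Fin n × Fin n)} {R : Rect n} :
    R ∈ openRects W k ↔ (R.1.card = k ∧ R.2.card = k) ∧ Disjoint (cells R) W := by
  simp [openRects, mem_sizeSets]

theorem disjoint_cells_iff_rows {W : Finset (Fin n × Fin n)} {R : Rect n} :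
    Disjoint (cells R) W ↔ R.1 ⊆ freeRows W R.2 := by
  simp only [Finset.disjoint_left, cells, Finset.mem_product, Finset.subset_iff, freeRows,
    Finset.mem_filter, Finset.mem_univ, true_and, Prod.forall]
  constructor
  · intro h _ hr c hc; exact h _ c ⟨hr, hc⟩
  · rintro h r c ⟨hr, hc⟩; exact h hr c hc

theorem disjoint_cells_iff_cols {W : Finset (Fin n × Fin n)} {R : Rect n} :
    Disjoint (cells R) W ↔ R.2 ⊆ freeCols W R.1 := by
  simp only [Finset.disjoint_left, cells, Finset.mem_product, Finset.subset_iff, freeCols,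
    Finset.mem_filter, Finset.mem_univ, true_and, Prod.forall]
  constructor
  · intro h _ hc r hr; exact h r _ ⟨hr, hc⟩
  · rintro h r c ⟨hr, hc⟩; exact h hc r hr

theorem sum_openRects_rows (W : Finset (Fin n × Fin n)) (F : Rect n → ℝ) :
    ∑ R ∈ openRects W k, F R
      = ∑ T ∈ sizeSets n k, ∑ S ∈ (freeRows W T).powersetCard k, F (S, T) := by
  rw [openRects, Finset.sum_filter, Finset.sum_product_right]
  refine Finset.sum_congr rfl fun T _ => ?_
  rw [← Finset.sum_filter]
  refine Finset.sum_congr ?_ fun _ _ => rfl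
  ext S
  rw [Finset.mem_filter, disjoint_cells_iff_rows, mem_sizeSets, Finset.mem_powersetCard, and_comm]

theorem sum_openRects_cols (W : Finset (Fin n × Fin n)) (F : Rect n → ℝ) :
    ∑ R ∈ openRects W k, F R
      = ∑ S ∈ sizeSets n k, ∑ T ∈ (freeCols W S).powersetCard k, F (S, T) := by
  rw [openRects, Finset.sum_filter, Finset.sum_product]
  refine Finset.sum_congr rfl fun S _ => ?_
  rw [← Finset.sum_filter]
  refine Finset.sum_congr ?_ fun _ _ => rfl
  ext T
  rw [Finset.mem_filter, disjoint_cells_iff_cols, mem_sizeSets, Finset.mem_powersetCard, and_comm]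

/-- The `k × k` rectangles disjoint from `W` with a row and a column that do not meet `W`. -/
def forcedRects (W : Finset (Fin n × Fin n)) (k : ℕ) : Finset (Rect n) :=
  (openRects W k).filter fun R => ¬ Disjoint R.1 (emptyRows W) ∧ ¬ Disjoint R.2 (emptyCols W)

/-- A rectangle with a private row and a private column belongs to every packing: the rectangle
covering the entry at their intersection has no other rows and columns. -/
theorem exists_eq_of_mem_forcedRects {W : Finset (Fin n × Fin n)} {R : Rect n}
    (hR : R ∈ forcedRects W k) {ω : Fin m → Rect n} (hω : ω ∈ packings (sizeSets n k) m)
    (hU : tupleUnion ω = W ∪ cells R) : ∃ j, ω j = R := by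
  obtain ⟨hopen, hr, hc⟩ := Finset.mem_filter.1 hR
  obtain ⟨⟨hR1, hR2⟩, -⟩ := mem_openRects.1 hopen
  obtain ⟨r, hrS, hrE⟩ := Finset.not_disjoint_iff.1 hr
  obtain ⟨c, hcT, hcE⟩ := Finset.not_disjoint_iff.1 hc
  rw [mem_emptyRows] at hrE
  rw [mem_emptyCols] at hcE
  have hmem : (r, c) ∈ tupleUnion ω := by
    rw [hU]
    exact Finset.mem_union_right _ (Finset.mem_product.2 ⟨hrS, hcT⟩)
  obtain ⟨j, hj⟩ := mem_tupleUnion.1 hmem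
  have hj' := Finset.mem_product.1 hj
  have hsub : cells (ω j) ⊆ W ∪ cells R := hU ▸ fun p hp => mem_tupleUnion.2 ⟨j, hp⟩
  have hcols : (ω j).2 ⊆ R.2 := fun c' hc' => by
    have := hsub (Finset.mem_product.2 ⟨hj'.1, hc'⟩ : (r, c') ∈ cells (ω j))
    rcases Finset.mem_union.1 this with h | h
    · exact absurd h (hrE c')
    · exact (Finset.mem_product.1 h).2
  have hrows : (ω j).1 ⊆ R.1 := fun r' hr' => by
    have := hsub (Finset.mem_product.2 ⟨hr', hj'.2⟩ : (r', c) ∈ cells (ω j))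
    rcases Finset.mem_union.1 this with h | h
    · exact absurd h (hcE r')
    · exact (Finset.mem_product.1 h).1
  have hC := (mem_packings.1 hω).1 j
  rw [mem_sizeSets, mem_sizeSets] at hC
  exact ⟨j, Prod.ext (Finset.eq_of_subset_of_card_le hrows (by rw [hC.1, hR1]))
    (Finset.eq_of_subset_of_card_le hcols (by rw [hC.2, hR2]))⟩

/-- If the proportion of rows and of columns meeting `W` is at most `v`, then a random rectangle
disjoint from `W` has a private row and a private column with probability at least
`(1 - v ^ k) ^ 2`. The rows are drawn given the columns, and conversely. -/
theorem le_card_forcedRects (W : Finset (Fin n × Fin n)) (k : ℕ) {v : ℝ} (hv0 : 0 ≤ v)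
    (hv1 : v ≤ 1) (hrows : (n : ℝ) - (emptyRows W).card ≤ v * n)
    (hcols : (n : ℝ) - (emptyCols W).card ≤ v * n) :
    (1 - v ^ k) ^ 2 * (openRects W k).card ≤ (forcedRects W k).card := by
  have hcard : ∀ A : Finset (Fin n), (A.card : ℝ) ≤ n := fun A => by
    exact_mod_cast (Finset.card_le_univ A).trans_eq (Fintype.card_fin n)
  have hvk : 0 ≤ 1 - v ^ k := sub_nonneg.2 (pow_le_one₀ hv0 hv1)
  set G : Rect n → ℝ := fun R => if ¬ Disjoint R.2 (emptyCols W) then 1 else 0 with hG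
  have hfree : ∀ T, ((freeRows W T).card : ℝ) - (emptyRows W).card
      ≤ v * (freeRows W T).card := fun T => by
    nlinarith [hcard (freeRows W T)]
  have hfree' : ∀ S, ((freeCols W S).card : ℝ) - (emptyCols W).card
      ≤ v * (freeCols W S).card := fun S => by
    nlinarith [hcard (freeCols W S)]
  have h1 : (1 - v ^ k) * (openRects W k).card ≤ ∑ R ∈ openRects W k, G R := by
    have : ((openRects W k).card : ℝ) = ∑ R ∈ openRects W k, 1 := by simp
    rw [this, sum_openRects_cols, sum_openRects_cols, Finset.mul_sum]
    refine Finset.sum_le_sum fun S _ => ?_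
    have := le_card_filter_not_disjoint k (emptyCols_subset_freeCols W S) (hfree' S)
    simp only [hG, Finset.sum_boole]
    simpa [Finset.card_powersetCard] using this
  have h2 : (1 - v ^ k) * ∑ R ∈ openRects W k, G R ≤ (forcedRects W k).card := by
    have : ((forcedRects W k).card : ℝ) = ∑ R ∈ openRects W k,
        G R * (if ¬ Disjoint R.1 (emptyRows W) then 1 else 0) := by
      rw [forcedRects, Finset.card_filter]
      push_cast
      refine Finset.sum_congr rfl fun R _ => ?_
      by_cases ha : Disjoint R.1 (emptyRows W) <;> by_cases hb : Disjoint R.2 (emptyCols W) <;>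
        simp [hG, ha, hb]
    rw [this, sum_openRects_rows, sum_openRects_rows, Finset.mul_sum]
    refine Finset.sum_le_sum fun T _ => ?_
    have := le_card_filter_not_disjoint k (emptyRows_subset_freeRows W T) (hfree T)
    simp only [hG]
    by_cases hT : Disjoint T (emptyCols W)
    · simp [hT]
    · simp only [hT, not_false_eq_true, if_true, one_mul, Finset.sum_boole]
      simpa [Finset.card_powersetCard] using this
  calc (1 - v ^ k) ^ 2 * (openRects W k).card
      = (1 - v ^ k) * ((1 - v ^ k) * (openRects W k).card) := by ring
    _ ≤ (1 - v ^ k) * ∑ R ∈ openRects W k, G R := by gcongr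
    _ ≤ _ := h2

theorem card_inter_cells_rows (K : Finset (Fin n × Fin n)) (R : Rect n) :
    (K ∩ cells R).card = ∑ r ∈ R.1, (R.2.filter fun c => (r, c) ∈ K).card := by
  simp only [Finset.card_filter]
  rw [← Finset.sum_product', Finset.inter_comm, ← Finset.filter_mem_eq_inter, Finset.card_filter]
  rfl

/-- The exponential moment of the overlap of `K` with a random rectangle disjoint from `W`. Given
the columns, the rows are a uniform subset of the free rows, which include the empty ones;
averaging over the rows leaves an exponential moment of a sum over the columns. -/
theorem sum_openRects_exp_le (W K : Finset (Fin n × Fin n)) {μ D : ℝ} (hμ : 0 ≤ μ) (hD : 0 < D)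
    (hDn : D ≤ n) (hrows : D + k ≤ (emptyRows W).card + 1)
    (hcols : D + k ≤ (emptyCols W).card + 1)
    (hsmall : 2 * k * μ * n ≤ D) :
    ∑ R ∈ openRects W k, Real.exp (μ * (K ∩ cells R).card)
      ≤ Real.exp (4 * k ^ 2 * μ * K.card / D ^ 2) * (openRects W k).card := by
  have hn0 : (0 : ℝ) < n := hD.trans_le hDn
  have hk0 : (0 : ℝ) ≤ k := by positivity
  set h : Fin n → ℝ := fun c =>
    2 * k / D * μ * (Finset.univ.filter fun r => (r, c) ∈ K).card with hh
  have hμk : μ * k ≤ 1 := by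
    by_contra hlt
    push Not at hlt
    have : (n : ℝ) < μ * k * n := by nlinarith
    nlinarith
  have hh0 : ∀ c, 0 ≤ h c := fun c => by positivity
  have hh1 : ∀ c, h c ≤ 1 := fun c => by
    have : ((Finset.univ.filter fun r => (r, c) ∈ K).card : ℝ) ≤ n := by
      exact_mod_cast (Finset.card_le_univ _).trans_eq (Fintype.card_fin n)
    calc h c ≤ 2 * k / D * μ * n := by simp only [hh]; gcongr
      _ = (2 * k * μ * n) / D := by ring
      _ ≤ 1 := (div_le_one hD).2 hsmall
  have hstep1 : ∑ R ∈ openRects W k, Real.exp (μ * (K ∩ cells R).card)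
      ≤ ∑ R ∈ openRects W k, Real.exp (∑ c ∈ R.2, h c) := by
    rw [sum_openRects_rows, sum_openRects_rows]
    refine Finset.sum_le_sum fun T hT => ?_
    rw [mem_sizeSets] at hT
    have hx : ∀ S : Finset (Fin n), μ * ((K ∩ cells (S, T)).card : ℝ)
        = ∑ r ∈ S, μ * ((T.filter fun c => (r, c) ∈ K).card : ℝ) := fun S => by
      rw [card_inter_cells_rows, Nat.cast_sum, Finset.mul_sum]
    simp only [hx]
    refine (sum_powersetCard_exp_le hD k (freeRows W T) (fun r _ => by positivity)
      (fun r _ => ?_) ?_).trans ?_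
    · have : ((T.filter fun c => (r, c) ∈ K).card : ℝ) ≤ k := by
        exact_mod_cast (Finset.card_filter_le _ _).trans_eq hT
      exact (by gcongr : _ ≤ μ * (k : ℝ)).trans hμk
    · have : ((emptyRows W).card : ℝ) ≤ (freeRows W T).card := by
        exact_mod_cast Finset.card_le_card (emptyRows_subset_freeRows W T)
      linarith
    · rw [Finset.sum_const, Finset.card_powersetCard, nsmul_eq_mul]
      gcongr
      have : ∑ c ∈ T, h c
          = 2 * k / D * ∑ r, μ * ((T.filter fun c => (r, c) ∈ K).card : ℝ) := by
        simp only [hh, Finset.card_filter, Nat.cast_sum]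
        rw [← Finset.mul_sum, ← Finset.mul_sum, Finset.sum_comm]
        ring
      rw [this]
      refine mul_le_mul_of_nonneg_left ?_ (by positivity)
      exact Finset.sum_le_sum_of_subset_of_nonneg (Finset.subset_univ _)
        fun r _ _ => by positivity
  have hstep2 : ∑ R ∈ openRects W k, Real.exp (∑ c ∈ R.2, h c)
      ≤ ∑ R ∈ openRects W k, Real.exp (4 * k ^ 2 * μ * K.card / D ^ 2) := by
    rw [sum_openRects_cols, sum_openRects_cols]
    refine Finset.sum_le_sum fun S _ => ?_
    refine (sum_powersetCard_exp_le hD k (freeCols W S) (fun c _ => hh0 c)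
      (fun c _ => hh1 c) ?_).trans ?_
    · have : ((emptyCols W).card : ℝ) ≤ (freeCols W S).card := by
        exact_mod_cast Finset.card_le_card (emptyCols_subset_freeCols W S)
      linarith
    · rw [Finset.sum_const, Finset.card_powersetCard, nsmul_eq_mul]
      gcongr
      have hK : ∑ c, ((Finset.univ.filter fun r => (r, c) ∈ K).card : ℝ) = K.card := by
        simp only [Finset.card_filter, Nat.cast_sum]
        rw [Finset.sum_comm, ← Finset.sum_product']
        simp
      calc 2 * k / D * ∑ c ∈ freeCols W S, h c ≤ 2 * k / D * ∑ c, h c := by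
            refine mul_le_mul_of_nonneg_left ?_ (by positivity)
            exact Finset.sum_le_sum_of_subset_of_nonneg (Finset.subset_univ _) fun c _ _ => hh0 c
        _ = _ := by
            simp only [hh]
            rw [← Finset.mul_sum, hK]
            field_simp
            ring
  refine (hstep1.trans hstep2).trans_eq ?_
  rw [Finset.sum_const, nsmul_eq_mul, mul_comm]

/-! ### Overlaps when many rows and columns stay empty -/

variable {n m k : ℕ}

theorem available_sizeSets_eq {ω : Fin m → Rect n} {i : Fin m}
    (h : (available (sizeSets n k) ω i).Nonempty) :
    available (sizeSets n k) ω i = openRects (restUnion ω i) k := by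
  obtain ⟨R₀, hR₀⟩ := h
  ext R
  rw [mem_available_iff hR₀, mem_openRects, mem_sizeSets, mem_sizeSets]

/-- If, on the event `χ`, at least a proportion `δ` of the rows and columns is not met by the
other rectangles, then the overlap of a fixed support with the rectangles in positions `J` has a
bounded exponential moment. -/
theorem sum_packingWeight_sizeSets_mul_exp_le (hk : 1 ≤ k) (hn : 0 < n)
    {K : Finset (Fin n × Fin n)} (hK : K ∈ supports n k m) {μ δ : ℝ} (hμ : 0 ≤ μ) (hδ0 : 0 < δ)
    (hδ1 : δ ≤ 1) (J : Finset (Fin m)) (χ : (Fin m → Rect n) → Prop) [DecidablePred χ]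
    (hχ : ∀ ω, ∀ i ∈ J, ∀ R, χ (Function.update ω i R) ↔ χ ω)
    (hempty : ∀ ω, χ ω → ∀ i ∈ J, (available (sizeSets n k) ω i).Nonempty →
      δ * n + k ≤ (emptyRows (restUnion ω i)).card + 1 ∧
      δ * n + k ≤ (emptyCols (restUnion ω i)).card + 1)
    (hsmall : 2 * k * μ ≤ δ) (hsmall' : 4 * μ * m * k ^ 4 ≤ δ ^ 2 * n ^ 2) :
    ∑ ω, packingWeight (sizeSets n k) m ω * (if χ ω then
        Real.exp (∑ i ∈ J, μ * (K ∩ cells (ω i)).card) else 0)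
      ≤ Real.exp (8 * μ * m ^ 2 * k ^ 4 / (δ ^ 4 * n ^ 2)) * (supports n k m).card := by
  have hnR : (0 : ℝ) < n := by exact_mod_cast hn
  have hkR : (1 : ℝ) ≤ k := by exact_mod_cast hk
  have hKcard : (K.card : ℝ) = m * k ^ 2 := by
    rw [card_le_of_mem_unionsOfRectangles (fun S hS => mem_sizeSets.1 hS) hK]
    push_cast
    ring
  set y : ℝ := 4 * μ * m * k ^ 4 / (δ ^ 2 * n ^ 2) with hy
  have hy0 : 0 ≤ y := by positivity
  have hy1 : y ≤ 1 := (div_le_one (by positivity)).2 hsmall'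
  have key := sum_packingWeight_mul_exp_le (m := m) (C := sizeSets n k)
    (fun S hS => Finset.card_pos.1 (by rw [mem_sizeSets.1 hS]; omega)) K hμ J χ hχ
    (κ := (δ ^ 2)⁻¹) (β := 2 * y) (by positivity) (by positivity) ?_
  · refine key.trans ?_
    change _ ≤ _ * ((unionsOfRectangles (sizeSets n k) m).card : ℝ)
    gcongr
    calc (1 + (δ ^ 2)⁻¹ * (2 * y)) ^ J.card ≤ Real.exp ((δ ^ 2)⁻¹ * (2 * y)) ^ J.card := by
          gcongr
          rw [add_comm]
          exact Real.add_one_le_exp _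
      _ ≤ Real.exp ((δ ^ 2)⁻¹ * (2 * y)) ^ m := by
          refine pow_le_pow_right₀ (Real.one_le_exp (by positivity)) ?_
          exact (Finset.card_le_univ J).trans_eq (Fintype.card_fin m)
      _ = _ := by
          rw [← Real.exp_nat_mul]
          congr 1
          rw [hy]
          field_simp
          ring
  · intro ω hω i hi hne
    obtain ⟨hr, hc⟩ := hempty ω hω i hi hne
    rw [available_sizeSets_eq hne]
    refine ⟨forcedRects (restUnion ω i) k, Finset.filter_subset _ _, ?_, ?_, ?_⟩
    · intro R hR ω' hω' hU
      exact exists_eq_of_mem_forcedRects hR hω' hU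
    · have h := le_card_forcedRects (restUnion ω i) k (v := 1 - δ) (by linarith) (by linarith)
        (by linarith) (by linarith)
      have hpow : (1 - δ) ^ k ≤ 1 - δ :=
        pow_le_of_le_one (by linarith) (by linarith) (by omega)
      have h2 : δ ^ 2 ≤ (1 - (1 - δ) ^ k) ^ 2 := by
        gcongr
        linarith
      rw [inv_mul_eq_div, le_div_iff₀ (by positivity), mul_comm]
      exact (by gcongr : _ ≤ (1 - (1 - δ) ^ k) ^ 2 * ((openRects (restUnion ω i) k).card : ℝ)).trans h
    · have h := sum_openRects_exp_le (k := k) (restUnion ω i) K (D := δ * n) hμ (by positivity)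
        (mul_le_of_le_one_left hnR.le hδ1) hr hc (by gcongr)
      have hexp : 4 * k ^ 2 * μ * K.card / (δ * n) ^ 2 = y := by
        rw [hKcard, hy]
        ring
      rw [hexp] at h
      rw [Finset.sum_sub_distrib, Finset.sum_const, nsmul_eq_mul, mul_one]
      have := exp_sub_one_le_two_mul hy0 hy1
      have hcard : (0 : ℝ) ≤ (openRects (restUnion ω i) k).card := by positivity
      nlinarith

/-- The entries covered by the rectangles of `ω` with index in `s`. -/
def unionOn (ω : Fin m → Rect n) (s : Finset (Fin m)) : Finset (Fin n × Fin n) :=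
  s.biUnion fun j => cells (ω j)

theorem mem_unionOn {ω : Fin m → Rect n} {s : Finset (Fin m)} {p : Fin n × Fin n} :
    p ∈ unionOn ω s ↔ ∃ j ∈ s, p ∈ cells (ω j) := by
  simp [unionOn]

theorem card_emptyRows_unionOn_le {ω : Fin m → Rect n} (s t : Finset (Fin m))
    (ht : ∀ j ∈ t, (ω j).1.card = k) :
    (emptyRows (unionOn ω s)).card ≤ (emptyRows (unionOn ω t)).card + (t \ s).card * k := by
  have hsub : emptyRows (unionOn ω s)
      ⊆ emptyRows (unionOn ω t) ∪ (t \ s).biUnion fun j => (ω j).1 := by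
    intro r hr
    by_contra hcon
    rw [Finset.mem_union, not_or] at hcon
    refine hcon.1 (mem_emptyRows.2 fun c hc => ?_)
    obtain ⟨j, hjt, hj⟩ := mem_unionOn.1 hc
    by_cases hjs : j ∈ s
    · exact mem_emptyRows.1 hr c (mem_unionOn.2 ⟨j, hjs, hj⟩)
    · exact hcon.2 (Finset.mem_biUnion.2
        ⟨j, Finset.mem_sdiff.2 ⟨hjt, hjs⟩, (Finset.mem_product.1 hj).1⟩)
  refine (Finset.card_le_card hsub).trans ((Finset.card_union_le _ _).trans ?_)
  gcongr
  exact Finset.card_biUnion_le_card_mul _ _ _ fun j hj => (ht j (Finset.mem_sdiff.1 hj).1).le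

theorem card_emptyCols_unionOn_le {ω : Fin m → Rect n} (s t : Finset (Fin m))
    (ht : ∀ j ∈ t, (ω j).2.card = k) :
    (emptyCols (unionOn ω s)).card ≤ (emptyCols (unionOn ω t)).card + (t \ s).card * k := by
  have hsub : emptyCols (unionOn ω s)
      ⊆ emptyCols (unionOn ω t) ∪ (t \ s).biUnion fun j => (ω j).2 := by
    intro c hc
    by_contra hcon
    rw [Finset.mem_union, not_or] at hcon
    refine hcon.1 (mem_emptyCols.2 fun r hr => ?_)
    obtain ⟨j, hjt, hj⟩ := mem_unionOn.1 hr
    by_cases hjs : j ∈ s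
    · exact mem_emptyCols.1 hc r (mem_unionOn.2 ⟨j, hjs, hj⟩)
    · exact hcon.2 (Finset.mem_biUnion.2
        ⟨j, Finset.mem_sdiff.2 ⟨hjt, hjs⟩, (Finset.mem_product.1 hj).2⟩)
  refine (Finset.card_le_card hsub).trans ((Finset.card_union_le _ _).trans ?_)
  gcongr
  exact Finset.card_biUnion_le_card_mul _ _ _ fun j hj => (ht j (Finset.mem_sdiff.1 hj).1).le

theorem card_of_available_nonempty {ω : Fin m → Rect n} {i : Fin m}
    (h : (available (sizeSets n k) ω i).Nonempty) {j : Fin m} (hj : j ≠ i) :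
    (ω j).1.card = k ∧ (ω j).2.card = k := by
  obtain ⟨R₀, hR₀⟩ := h
  have := (mem_packings.1 (Finset.mem_filter.1 hR₀).2).1 j
  simpa [hj, mem_sizeSets] using this

theorem supports_nonempty (hmk : m * k ≤ n) : (supports n k m).Nonempty := by
  refine (consecutiveSupports_nonempty hmk).mono ?_
  simp only [consecutiveSupports, supports, unionsOfRectangles_eq_image]
  refine Finset.image_subset_image fun ω hω => ?_
  rw [mem_packings] at hω ⊢
  refine ⟨fun i => ⟨mem_sizeSets.2 ?_, mem_sizeSets.2 ?_⟩, hω.2⟩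
  · exact card_of_mem_consecutiveSets (hω.1 i).1
  · exact card_of_mem_consecutiveSets (hω.1 i).2

theorem emptyRows_empty : emptyRows (∅ : Finset (Fin n × Fin n)) = Finset.univ := by
  ext r; simp [mem_emptyRows]

theorem emptyCols_empty : emptyCols (∅ : Finset (Fin n × Fin n)) = Finset.univ := by
  ext r; simp [mem_emptyCols]

/-- When the rectangles use at most half of the rows and columns, there are always enough empty
ones. -/
theorem sum_exp_inter_supports_le_of_two_mul_le (hk : 1 ≤ k) (hm : 1 ≤ m) (hmk : 2 * (m * k) ≤ n)
    {l : ℝ} (hl : 4 * (l ^ 2 * k) ≤ 1) (hl' : 16 * (l ^ 2 * (m ^ 2 * k ^ 4)) ≤ n ^ 2)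
    {K : Finset (Fin n × Fin n)} (hK : K ∈ supports n k m) :
    ∑ K' ∈ supports n k m, Real.exp (l ^ 2 * (K ∩ K').card)
      ≤ Real.exp (128 * (l ^ 2 * (m ^ 2 * k ^ 4)) / n ^ 2) * (supports n k m).card := by
  classical
  have hkR : (1 : ℝ) ≤ k := by exact_mod_cast hk
  have hmR : (1 : ℝ) ≤ m := by exact_mod_cast hm
  have hmkR : 2 * ((m : ℝ) * k) ≤ n := by exact_mod_cast hmk
  have hn : 0 < n := lt_of_lt_of_le (by positivity) hmk
  have key := sum_packingWeight_sizeSets_mul_exp_le hk hn hK (sq_nonneg l) (δ := 1 / 2)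
    (by norm_num) (by norm_num) Finset.univ (fun _ => True) (fun _ _ _ _ => Iff.rfl) ?_
    (by linarith) ?_
  · have hL : ∑ K' ∈ supports n k m, Real.exp (l ^ 2 * (K ∩ K').card)
        = ∑ ω, packingWeight (sizeSets n k) m ω * (if True then
          Real.exp (∑ i ∈ Finset.univ, l ^ 2 * (K ∩ cells (ω i)).card) else 0) := by
      rw [supports, ← sum_packingWeight_mul]
      refine Finset.sum_congr rfl fun ω _ => ?_
      by_cases hω : ω ∈ packings (sizeSets n k) m
      · simp only [if_true]
        rw [card_inter_tupleUnion hω, Nat.cast_sum, Finset.mul_sum]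
      · simp [packingWeight, hω]
    rw [hL]
    refine key.trans_eq ?_
    congr 2
    ring
  · intro ω _ i _ hne
    have hcard : ((Finset.univ.erase i) \ (∅ : Finset (Fin m))).card = m - 1 := by simp
    have h1 := card_emptyRows_unionOn_le (k := k) (ω := ω) ∅ (Finset.univ.erase i) fun j hj =>
      (card_of_available_nonempty hne (Finset.ne_of_mem_erase hj)).1
    have h2 := card_emptyCols_unionOn_le (k := k) (ω := ω) ∅ (Finset.univ.erase i) fun j hj =>
      (card_of_available_nonempty hne (Finset.ne_of_mem_erase hj)).2
    rw [hcard] at h1 h2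
    have e : unionOn ω ∅ = ∅ := by simp [unionOn]
    rw [e, emptyRows_empty, Finset.card_univ, Fintype.card_fin] at h1
    rw [e, emptyCols_empty, Finset.card_univ, Fintype.card_fin] at h2
    have h1R : (n : ℝ) ≤ (emptyRows (restUnion ω i)).card + (m - 1) * k := by
      have : (n : ℝ) ≤ (emptyRows (restUnion ω i)).card + ((m - 1 : ℕ) : ℝ) * k := by
        exact_mod_cast h1
      rwa [Nat.cast_sub hm, Nat.cast_one] at this
    have h2R : (n : ℝ) ≤ (emptyCols (restUnion ω i)).card + (m - 1) * k := by
      have : (n : ℝ) ≤ (emptyCols (restUnion ω i)).card + ((m - 1 : ℕ) : ℝ) * k := by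
        exact_mod_cast h2
      rwa [Nat.cast_sub hm, Nat.cast_one] at this
    constructor <;> linarith
  · have : (m : ℝ) ≤ m ^ 2 := by nlinarith
    have h3 : l ^ 2 * (m * (k : ℝ) ^ 4) ≤ l ^ 2 * (m ^ 2 * k ^ 4) := by gcongr
    linarith

/-- The supports that leave at least one row in `64`, and one column in `64`, empty. -/
def sparseSupports (n k m : ℕ) : Finset (Finset (Fin n × Fin n)) :=
  (supports n k m).filter fun K => n ≤ 64 * (emptyRows K).card ∧ n ≤ 64 * (emptyCols K).card

/-- The positions congruent to `b` modulo `256`. -/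
def residueBlock (m b : ℕ) : Finset (Fin m) := Finset.univ.filter fun i => i.val % 256 = b

theorem card_residueBlock_le (m b : ℕ) : (residueBlock m b).card ≤ m / 256 + 1 := by
  rw [← Finset.card_range (m / 256 + 1)]
  refine Finset.card_le_card_of_injOn (fun i => i.val / 256) (fun i _ => ?_) ?_
  · have := i.isLt
    simp only [Finset.coe_range, Set.mem_Iio]
    omega
  · intro i hi j hj hij
    simp only [residueBlock, Finset.coe_filter, Finset.mem_univ, true_and, Set.mem_ofPred_eq] at hi hj
    simp only at hij
    exact Fin.ext (by omega)

/-- Jensen's inequality splits the exponential of a sum over all positions into blocks, each of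
which involves only a small proportion of the positions. -/
theorem exp_sum_le_sum_residueBlock (x : Fin m → ℝ) :
    Real.exp (∑ i, x i)
      ≤ ∑ b ∈ Finset.range 256, (1 / 256) * Real.exp (∑ i ∈ residueBlock m b, 256 * x i) := by
  have hsum : ∑ i, x i
      = ∑ b ∈ Finset.range 256, (1 / 256 : ℝ) • ∑ i ∈ residueBlock m b, 256 * x i := by
    rw [← Finset.sum_fiberwise_of_maps_to (s := Finset.univ) (t := Finset.range 256)
      (g := fun i : Fin m => i.val % 256)
      (fun i _ => Finset.mem_range.2 (Nat.mod_lt _ (by norm_num)))]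
    refine Finset.sum_congr rfl fun b _ => ?_
    rw [← Finset.mul_sum, smul_eq_mul]
    simp [residueBlock]
  rw [hsum]
  exact convexOn_exp.map_sum_le (fun _ _ => by norm_num) (by simp) fun _ _ => Set.mem_univ _

/-- The overlap of a support with a sparse one. After Jensen's inequality only one block of
rectangles is resampled; the others leave a 64th of the rows empty, and the rectangles of the block
are too few to fill more than half of these. -/
theorem sum_exp_inter_sparseSupports_le (hk : 1 ≤ k) (hm : 1 ≤ m) (hmk : m * k ≤ n)
    (hkn : 1024 * k ^ 2 ≤ n) {l : ℝ} (hl : 2 ^ 16 * (l ^ 2 * k) ≤ 1)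
    (hl' : 2 ^ 24 * (l ^ 2 * (m ^ 2 * k ^ 4)) ≤ n ^ 2)
    {K : Finset (Fin n × Fin n)} (hK : K ∈ supports n k m) :
    ∑ K' ∈ sparseSupports n k m, Real.exp (l ^ 2 * (K ∩ K').card)
      ≤ Real.exp (2 ^ 39 * (l ^ 2 * (m ^ 2 * k ^ 4)) / n ^ 2) * (supports n k m).card := by
  classical
  have hkR : (1 : ℝ) ≤ k := by exact_mod_cast hk
  have hmR : (1 : ℝ) ≤ m := by exact_mod_cast hm
  have hn : 0 < n := lt_of_lt_of_le (by positivity) hkn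
  have hblock : ∀ b ∈ Finset.range 256,
      ∑ ω, packingWeight (sizeSets n k) m ω *
        (if n ≤ 64 * (emptyRows (unionOn ω (Finset.univ \ residueBlock m b))).card ∧
            n ≤ 64 * (emptyCols (unionOn ω (Finset.univ \ residueBlock m b))).card then
          Real.exp (∑ i ∈ residueBlock m b, (256 * l ^ 2) * (K ∩ cells (ω i)).card) else 0)
      ≤ Real.exp (2 ^ 39 * (l ^ 2 * (m ^ 2 * k ^ 4)) / n ^ 2) * (supports n k m).card := by
    intro b _
    have key := sum_packingWeight_sizeSets_mul_exp_le hk hn hK (μ := 256 * l ^ 2)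
      (by positivity) (δ := 1 / 128) (by norm_num) (by norm_num) (residueBlock m b)
      (fun ω => n ≤ 64 * (emptyRows (unionOn ω (Finset.univ \ residueBlock m b))).card ∧
        n ≤ 64 * (emptyCols (unionOn ω (Finset.univ \ residueBlock m b))).card) ?_ ?_
      (by linarith) ?_
    · refine key.trans_eq ?_
      congr 2
      ring
    · intro ω i hi R
      have : unionOn (Function.update ω i R) (Finset.univ \ residueBlock m b)
          = unionOn ω (Finset.univ \ residueBlock m b) := by
        unfold unionOn
        refine Finset.biUnion_congr rfl fun j hj => ?_
        rw [Function.update_of_ne]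
        rintro rfl
        exact (Finset.mem_sdiff.1 hj).2 hi
      rw [this]
    · rintro ω ⟨hr, hc⟩ i hi hne
      have hcard : (Finset.univ.erase i \ (Finset.univ \ residueBlock m b)).card + 1
          ≤ m / 256 + 1 := by
        refine le_trans ?_ (card_residueBlock_le m b)
        rw [← Finset.card_erase_add_one hi]
        refine Nat.add_le_add_right (Finset.card_le_card fun j hj => ?_) 1
        simp only [Finset.mem_sdiff, Finset.mem_erase, Finset.mem_univ, true_and, not_not] at hj ⊢
        tauto
      set q := (Finset.univ.erase i \ (Finset.univ \ residueBlock m b)).card with hq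
      have hqk : 256 * (q * k) ≤ n := by
        have : 256 * q ≤ m := by omega
        nlinarith
      have h1 := card_emptyRows_unionOn_le (k := k) (ω := ω) (Finset.univ \ residueBlock m b)
        (Finset.univ.erase i) fun j hj =>
          (card_of_available_nonempty hne (Finset.ne_of_mem_erase hj)).1
      have h2 := card_emptyCols_unionOn_le (k := k) (ω := ω) (Finset.univ \ residueBlock m b)
        (Finset.univ.erase i) fun j hj =>
          (card_of_available_nonempty hne (Finset.ne_of_mem_erase hj)).2
      rw [← hq] at h1 h2
      have h256 : 256 * k ≤ n := by nlinarith
      have h1' : n + 128 * k ≤ 128 * (emptyRows (restUnion ω i)).card := by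
        change _ ≤ 128 * (emptyRows (unionOn ω (Finset.univ.erase i))).card
        omega
      have h2' : n + 128 * k ≤ 128 * (emptyCols (restUnion ω i)).card := by
        change _ ≤ 128 * (emptyCols (unionOn ω (Finset.univ.erase i))).card
        omega
      have h1R : (n : ℝ) + 128 * k ≤ 128 * (emptyRows (restUnion ω i)).card := by
        exact_mod_cast h1'
      have h2R : (n : ℝ) + 128 * k ≤ 128 * (emptyCols (restUnion ω i)).card := by
        exact_mod_cast h2'
      constructor <;> linarith
    · have : (m : ℝ) ≤ m ^ 2 := by nlinarith
      have h3 : l ^ 2 * (m * (k : ℝ) ^ 4) ≤ l ^ 2 * (m ^ 2 * k ^ 4) := by gcongr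
      linarith
  have hanti : ∀ ω : Fin m → Rect n, ∀ s, unionOn ω s ⊆ tupleUnion ω := fun ω s p hp => by
    obtain ⟨j, -, hj⟩ := mem_unionOn.1 hp
    exact mem_tupleUnion.2 ⟨j, hj⟩
  have hantir : ∀ ω : Fin m → Rect n, ∀ s,
      (emptyRows (tupleUnion ω)).card ≤ (emptyRows (unionOn ω s)).card := fun ω s =>
    Finset.card_le_card fun r hr => mem_emptyRows.2 fun c hc =>
      mem_emptyRows.1 hr c (hanti ω s hc)
  have hantic : ∀ ω : Fin m → Rect n, ∀ s,
      (emptyCols (tupleUnion ω)).card ≤ (emptyCols (unionOn ω s)).card := fun ω s =>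
    Finset.card_le_card fun c hc => mem_emptyCols.2 fun r hr =>
      mem_emptyCols.1 hc r (hanti ω s hr)
  rw [sparseSupports, Finset.sum_filter, supports, ← sum_packingWeight_mul]
  calc _ ≤ ∑ ω, ∑ b ∈ Finset.range 256, (1 / 256) * (packingWeight (sizeSets n k) m ω *
        (if n ≤ 64 * (emptyRows (unionOn ω (Finset.univ \ residueBlock m b))).card ∧
            n ≤ 64 * (emptyCols (unionOn ω (Finset.univ \ residueBlock m b))).card then
          Real.exp (∑ i ∈ residueBlock m b, (256 * l ^ 2) * (K ∩ cells (ω i)).card) else 0)) := by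
        refine Finset.sum_le_sum fun ω _ => ?_
        have hw := packingWeight_nonneg (sizeSets n k) m ω
        by_cases hω : ω ∈ packings (sizeSets n k) m
        · split_ifs with hsparse
          · rw [card_inter_tupleUnion hω, Nat.cast_sum, Finset.mul_sum]
            refine (mul_le_mul_of_nonneg_left (exp_sum_le_sum_residueBlock _) hw).trans ?_
            rw [Finset.mul_sum]
            refine Finset.sum_le_sum fun b _ => ?_
            rw [if_pos ⟨hsparse.1.trans (Nat.mul_le_mul_left 64 (hantir ω _)),
              hsparse.2.trans (Nat.mul_le_mul_left 64 (hantic ω _))⟩]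
            simp only [mul_assoc]
            exact (mul_left_comm _ _ _).le
          · rw [mul_zero]
            refine Finset.sum_nonneg fun b _ => ?_
            refine mul_nonneg (by norm_num) (mul_nonneg hw ?_)
            split_ifs <;> positivity
        · simp [packingWeight, hω]
    _ = ∑ b ∈ Finset.range 256, (1 / 256) * ∑ ω, packingWeight (sizeSets n k) m ω *
        (if n ≤ 64 * (emptyRows (unionOn ω (Finset.univ \ residueBlock m b))).card ∧
            n ≤ 64 * (emptyCols (unionOn ω (Finset.univ \ residueBlock m b))).card then
          Real.exp (∑ i ∈ residueBlock m b, (256 * l ^ 2) * (K ∩ cells (ω i)).card) else 0) := by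
        rw [Finset.sum_comm]
        simp only [Finset.mul_sum]
    _ ≤ ∑ b ∈ Finset.range 256, (1 / 256) *
        (Real.exp (2 ^ 39 * (l ^ 2 * (m ^ 2 * k ^ 4)) / n ^ 2) * (supports n k m).card) :=
        Finset.sum_le_sum fun b hb => mul_le_mul_of_nonneg_left (hblock b hb) (by norm_num)
    _ = _ := by
        rw [Finset.sum_const, Finset.card_range, nsmul_eq_mul, supports]
        push_cast
        ring

/-! ### The number of supports from below -/

variable {n m k : ℕ}

theorem card_compl_emptyRows_le {K : Finset (Fin n × Fin n)} (hK : K ∈ supports n k m) :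
    n ≤ (emptyRows K).card + m * k := by
  rw [supports, unionsOfRectangles_eq_image, Finset.mem_image] at hK
  obtain ⟨ω, hω, rfl⟩ := hK
  have h := card_emptyRows_unionOn_le (k := k) (ω := ω) ∅ Finset.univ fun j _ =>
    mem_sizeSets.1 ((mem_packings.1 hω).1 j).1
  simpa [unionOn, tupleUnion, emptyRows_empty] using h

theorem card_compl_emptyCols_le {K : Finset (Fin n × Fin n)} (hK : K ∈ supports n k m) :
    n ≤ (emptyCols K).card + m * k := by
  rw [supports, unionsOfRectangles_eq_image, Finset.mem_image] at hK
  obtain ⟨ω, hω, rfl⟩ := hK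
  have h := card_emptyCols_unionOn_le (k := k) (ω := ω) ∅ Finset.univ fun j _ =>
    mem_sizeSets.1 ((mem_packings.1 hω).1 j).2
  simpa [unionOn, tupleUnion, emptyCols_empty] using h

theorem union_cells_mem_supports {W : Finset (Fin n × Fin n)} (hW : W ∈ supports n k m)
    {R : Rect n} (hR : R ∈ openRects W k) : W ∪ cells R ∈ supports n k (m + 1) := by
  rw [supports, unionsOfRectangles_eq_image, Finset.mem_image] at hW ⊢
  obtain ⟨ω, hω, rfl⟩ := hW
  obtain ⟨hRk, hdis⟩ := mem_openRects.1 hR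
  rw [mem_packings] at hω
  have hdis' : ∀ i, Disjoint (cells R) (cells (ω i)) := fun i =>
    hdis.mono_right fun p hp => mem_tupleUnion.2 ⟨i, hp⟩
  refine ⟨Fin.cons R ω, mem_packings.2 ⟨?_, ?_⟩, ?_⟩
  · intro i
    refine Fin.cases ?_ (fun j => ?_) i
    · simpa [mem_sizeSets] using hRk
    · simpa using hω.1 j
  · intro i j
    refine Fin.cases ?_ (fun i' => ?_) i <;> refine Fin.cases ?_ (fun j' => ?_) j
    · simp
    · intro _; simpa using hdis' j'
    · intro _; simpa using (hdis' i').symm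
    · intro hij
      simpa using hω.2 i' j' fun h => hij (by rw [h])
  · ext p
    simp [mem_tupleUnion, Fin.exists_fin_succ, or_comm]

/-- A support in `supports n k (m + 1)` arises from at most `m + 1` pairs of a smaller support and a
forced rectangle, because the forced rectangle is one of the rectangles of any fixed packing. -/
theorem sum_card_forcedRects_le (n k m : ℕ) :
    ∑ W ∈ supports n k m, (forcedRects W k).card ≤ (m + 1) * (supports n k (m + 1)).card := by
  classical
  rw [← Finset.card_sigma, mul_comm]
  set P := (supports n k m).sigma fun W => forcedRects W k with hP
  have hopen : ∀ p ∈ P, p.2 ∈ openRects p.1 k := fun p hp =>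
    (Finset.mem_filter.1 (Finset.mem_sigma.1 hp).2).1
  refine Finset.card_le_mul_card_image_of_maps_to
    (f := fun p : (_ : Finset (Fin n × Fin n)) × Rect n => p.1 ∪ cells p.2)
    (fun p hp => union_cells_mem_supports (Finset.mem_sigma.1 hp).1 (hopen p hp)) _ ?_ |>.trans_eq
      (mul_comm _ _)
  intro K hK
  rw [supports, unionsOfRectangles_eq_image, Finset.mem_image] at hK
  obtain ⟨ω, hω, hωK⟩ := hK
  calc _ ≤ (Finset.univ.image ω).card := by
        refine Finset.card_le_card_of_injOn (fun p => p.2) ?_ ?_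
        · intro p hp
          obtain ⟨hp, hpK⟩ := Finset.mem_filter.1 hp
          obtain ⟨j, hj⟩ := exists_eq_of_mem_forcedRects (Finset.mem_sigma.1 hp).2 hω
            (hωK.trans hpK.symm)
          exact Finset.mem_image.2 ⟨j, Finset.mem_univ _, hj⟩
        · rintro ⟨W, R⟩ hp ⟨W', R'⟩ hp' (rfl : R = R')
          obtain ⟨hp, hpK⟩ := Finset.mem_filter.1 hp
          obtain ⟨hp', hpK'⟩ := Finset.mem_filter.1 hp'
          have h1 := (mem_openRects.1 (hopen _ hp)).2
          have h2 := (mem_openRects.1 (hopen _ hp')).2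
          have e1 : W = K \ cells R := by
            rw [← hpK, Finset.union_sdiff_right]
            exact (Finset.sdiff_eq_self_of_disjoint h1.symm).symm
          have e2 : W' = K \ cells R := by
            rw [← hpK', Finset.union_sdiff_right]
            exact (Finset.sdiff_eq_self_of_disjoint h2.symm).symm
          rw [e1, e2]
    _ ≤ m + 1 := Finset.card_image_le.trans_eq (by simp)

theorem choose_mul_pow_sub_le {a b : ℕ} (hka : k ≤ a) (hab : a ≤ b) :
    b.choose k * (a - k) ^ k ≤ a.choose k * (b - k) ^ k := by
  have hdesc : ∀ i ≤ k, b.descFactorial i * (a - k) ^ i ≤ a.descFactorial i * (b - k) ^ i := by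
    intro i
    induction i with
    | zero => simp
    | succ i ih =>
      intro hi
      rw [Nat.descFactorial_succ, Nat.descFactorial_succ, pow_succ, pow_succ]
      have h : (b - i) * (a - k) ≤ (a - i) * (b - k) := by
        obtain ⟨x, rfl⟩ := Nat.exists_eq_add_of_le hka
        obtain ⟨y, rfl⟩ := Nat.exists_eq_add_of_le hab
        obtain ⟨z, rfl⟩ := Nat.exists_eq_add_of_le (Nat.le_of_succ_le hi)
        have e1 : i + z + x + y - i = z + x + y := by omega
        have e2 : i + z + x - (i + z) = x := by omega
        have e3 : i + z + x - i = z + x := by omega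
        have e4 : i + z + x + y - (i + z) = x + y := by omega
        rw [e1, e2, e3, e4]
        nlinarith [Nat.zero_le (z * y)]
      calc _ = ((b - i) * (a - k)) * (b.descFactorial i * (a - k) ^ i) := by ring
        _ ≤ ((a - i) * (b - k)) * (a.descFactorial i * (b - k) ^ i) :=
          Nat.mul_le_mul h (ih (Nat.le_of_succ_le hi))
        _ = _ := by ring
  have h := hdesc k le_rfl
  rw [Nat.descFactorial_eq_factorial_mul_choose, Nat.descFactorial_eq_factorial_mul_choose,
    mul_assoc, mul_assoc] at h
  exact Nat.le_of_mul_le_mul_left h (Nat.factorial_pos k)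

theorem pow_mul_choose_le_choose {a b : ℕ} (hk : 1 ≤ k) (hkb : k < b) (hab : a ≤ b) {s : ℝ}
    (hs : (b : ℝ) - a ≤ s) :
    (max 0 (1 - s / (b - k))) ^ k * b.choose k ≤ a.choose k := by
  have hbk : (0 : ℝ) < b - k := sub_pos.2 (by exact_mod_cast hkb)
  rcases le_or_gt (1 - s / (b - k)) 0 with h0 | h0
  · rw [max_eq_left h0, zero_pow (by omega), zero_mul]
    positivity
  · rw [max_eq_right h0.le]
    have hsb : s < b - k := by
      rw [sub_pos, div_lt_one hbk] at h0
      exact h0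
    have hka : k ≤ a := by
      have : (k : ℝ) < a := by linarith
      exact (by exact_mod_cast this : k < a).le
    have h : (b.choose k : ℝ) * ((a : ℝ) - k) ^ k ≤ a.choose k * ((b : ℝ) - k) ^ k := by
      have := choose_mul_pow_sub_le hka hab
      rw [← Nat.cast_sub hka, ← Nat.cast_sub hkb.le]
      exact_mod_cast this
    have h2 : (1 - s / (b - k)) * (b - k) ≤ (a : ℝ) - k := by
      rw [sub_mul, div_mul_cancel₀ _ hbk.ne']
      linarith
    have h3 : ((1 - s / (b - k)) * (b - k)) ^ k ≤ ((a : ℝ) - k) ^ k :=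
      pow_le_pow_left₀ (by positivity) h2 k
    refine le_of_mul_le_mul_right ?_ (pow_pos hbk k)
    calc _ = b.choose k * ((1 - s / (b - k)) * (b - k)) ^ k := by rw [mul_pow]; ring
      _ ≤ b.choose k * ((a : ℝ) - k) ^ k := by gcongr
      _ ≤ _ := h

theorem sum_powersetCard_sum (k : ℕ) (x : Fin n → ℝ) :
    n * ∑ T ∈ sizeSets n k, ∑ c ∈ T, x c = k * n.choose k * ∑ c, x c := by
  have hcount : ∀ c : Fin n, (n : ℝ) * ((sizeSets n k).filter fun T => c ∈ T).card
      = k * n.choose k := by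
    intro c
    have hd : (sizeSets n k).filter (fun T => ¬ c ∈ T)
        = (Finset.univ.erase c).powersetCard k := by
      ext T
      simp only [Finset.mem_filter, mem_sizeSets, Finset.mem_powersetCard, Finset.subset_erase,
        Finset.subset_univ, true_and]
      tauto
    have hsplit := Finset.card_filter_add_card_filter_not (s := sizeSets n k) (fun T => c ∈ T)
    rw [hd, Finset.card_powersetCard, Finset.card_erase_of_mem (Finset.mem_univ c),
      sizeSets_eq_powersetCard, Finset.card_powersetCard, Finset.card_univ, Fintype.card_fin]
      at hsplit
    rw [sizeSets_eq_powersetCard]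
    obtain ⟨n', rfl⟩ : ∃ n', n = n' + 1 := ⟨n - 1, by have := c.isLt; omega⟩
    rcases k with _ | k'
    · simp only [Nat.choose_zero_right, add_eq_right] at hsplit
      rw [hsplit]; simp
    · rw [Nat.add_sub_cancel, Nat.choose_succ_succ, add_left_inj] at hsplit
      rw [hsplit]
      have := Nat.add_one_mul_choose_eq n' k'
      rw [mul_comm ((k' + 1 : ℕ) : ℝ)]
      exact_mod_cast this
  have : ∑ T ∈ sizeSets n k, ∑ c ∈ T, x c
      = ∑ c, x c * ((sizeSets n k).filter fun T => c ∈ T).card := by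
    have : ∀ T : Finset (Fin n), ∑ c ∈ T, x c = ∑ c, if c ∈ T then x c else 0 := fun T => by
      rw [Finset.sum_ite_mem, Finset.univ_inter]
    simp only [this]
    rw [Finset.sum_comm]
    refine Finset.sum_congr rfl fun c _ => ?_
    rw [← Finset.sum_filter, Finset.sum_const, nsmul_eq_mul, mul_comm]
  rw [this, Finset.mul_sum, Finset.mul_sum]
  refine Finset.sum_congr rfl fun c _ => ?_
  rw [← hcount c]
  ring

theorem card_eq_sum_col (W : Finset (Fin n × Fin n)) :
    (W.card : ℝ) = ∑ c, ((Finset.univ.filter fun r => (r, c) ∈ W).card : ℝ) := by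
  simp only [Finset.card_filter, Nat.cast_sum]
  rw [← Finset.sum_product_right' , ← Nat.cast_sum]
  simp

theorem card_sub_card_freeRows_le (W : Finset (Fin n × Fin n)) (T : Finset (Fin n)) :
    (n : ℝ) - (freeRows W T).card
      ≤ ∑ c ∈ T, ((Finset.univ.filter fun r => (r, c) ∈ W).card : ℝ) := by
  have : (Finset.univ : Finset (Fin n)) ⊆ freeRows W T ∪ T.biUnion fun c =>
      Finset.univ.filter fun r => (r, c) ∈ W := by
    intro r _
    by_cases h : ∀ c ∈ T, (r, c) ∉ W
    · exact Finset.mem_union_left _ (by simpa [freeRows] using h)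
    · push Not at h
      obtain ⟨c, hc, hrc⟩ := h
      exact Finset.mem_union_right _ (Finset.mem_biUnion.2 ⟨c, hc, by simpa using hrc⟩)
  have h1 := (Finset.card_le_card this).trans (Finset.card_union_le _ _)
  have h2 := h1.trans (Nat.add_le_add_left Finset.card_biUnion_le _)
  rw [Finset.card_univ, Fintype.card_fin] at h2
  rw [sub_le_iff_le_add, add_comm]
  exact_mod_cast h2

/-- A set with at most `n * k` entries leaves many open rectangles. Convexity handles the columns
in which the set has many entries. -/
theorem le_card_openRects (hk : 1 ≤ k) (hkn : 1024 * k ^ 2 ≤ n) {W : Finset (Fin n × Fin n)}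
    (hW : W.card ≤ n * k) :
    (511 / 512 : ℝ) ^ k * (n.choose k : ℝ) ^ 2 ≤ (openRects W k).card := by
  have hkR : (1 : ℝ) ≤ k := by exact_mod_cast hk
  have hknR : 1024 * (k : ℝ) ^ 2 ≤ n := by exact_mod_cast hkn
  have hkn' : k < n := by nlinarith
  have hnk : (0 : ℝ) < n - k := sub_pos.2 (by exact_mod_cast hkn')
  have hn : (0 : ℝ) < n := by linarith
  have hWR : (W.card : ℝ) ≤ n * k := by exact_mod_cast hW
  have hC : (0 : ℝ) < n.choose k := by exact_mod_cast Nat.choose_pos hkn'.le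
  have hcardC : ((sizeSets n k).card : ℝ) = n.choose k := by
    rw [sizeSets_eq_powersetCard, Finset.card_powersetCard, Finset.card_univ, Fintype.card_fin]
  set x : Fin n → ℝ := fun c => ((Finset.univ.filter fun r => (r, c) ∈ W).card : ℝ) with hx
  set z : Finset (Fin n) → ℝ := fun T => max 0 (1 - (∑ c ∈ T, x c) / (n - k)) with hz
  have hzsum : (511 / 512 : ℝ) * n.choose k ≤ ∑ T ∈ sizeSets n k, z T := by
    have h1 : ∑ T ∈ sizeSets n k, (1 - (∑ c ∈ T, x c) / (n - k)) ≤ ∑ T ∈ sizeSets n k, z T :=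
      Finset.sum_le_sum fun T _ => le_max_right _ _
    refine le_trans ?_ h1
    rw [Finset.sum_sub_distrib, ← Finset.sum_div, Finset.sum_const, nsmul_eq_mul, mul_one, hcardC]
    have h2 := sum_powersetCard_sum k x
    rw [← card_eq_sum_col W] at h2
    have h3 : ∑ T ∈ sizeSets n k, ∑ c ∈ T, x c ≤ k ^ 2 * n.choose k := by
      refine le_of_mul_le_mul_left ?_ hn
      rw [h2]
      calc (k : ℝ) * n.choose k * W.card ≤ k * n.choose k * (n * k) := by gcongr
        _ = _ := by ring
    have h4 : (∑ T ∈ sizeSets n k, ∑ c ∈ T, x c) / (n - k) ≤ 1 / 512 * n.choose k := by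
      rw [div_le_iff₀ hnk]
      have : (k : ℝ) ^ 2 ≤ 1 / 512 * (n - k) := by nlinarith
      nlinarith
    linarith
  have hopen : n.choose k * ∑ T ∈ sizeSets n k, z T ^ k ≤ (openRects W k).card := by
    have : ((openRects W k).card : ℝ) = ∑ R ∈ openRects W k, 1 := by simp
    rw [this, sum_openRects_rows, Finset.mul_sum]
    refine Finset.sum_le_sum fun T _ => ?_
    rw [Finset.sum_const, Finset.card_powersetCard, nsmul_eq_mul, mul_one, mul_comm]
    exact pow_mul_choose_le_choose hk hkn' ((Finset.card_le_univ _).trans_eq (Fintype.card_fin n))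
      (card_sub_card_freeRows_le W T)
  refine le_trans ?_ hopen
  have hjensen := Real.pow_arith_mean_le_arith_mean_pow (sizeSets n k)
    (fun _ => (n.choose k : ℝ)⁻¹) z (fun _ _ => by positivity)
    (by rw [Finset.sum_const, nsmul_eq_mul, hcardC, mul_inv_cancel₀ hC.ne'])
    (fun _ _ => le_max_left _ _) k
  rw [← Finset.mul_sum, ← Finset.mul_sum] at hjensen
  have hmean : (511 / 512 : ℝ) ≤ (n.choose k : ℝ)⁻¹ * ∑ T ∈ sizeSets n k, z T := by
    rw [inv_mul_eq_div, le_div_iff₀ hC]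
    exact hzsum
  have h5 := (pow_le_pow_left₀ (by norm_num) hmean k).trans hjensen
  rw [inv_mul_eq_div, le_div_iff₀ hC] at h5
  calc _ = n.choose k * ((511 / 512 : ℝ) ^ k * n.choose k) := by ring
    _ ≤ _ := by gcongr

theorem prod_one_sub_div_sq (hm : 1 ≤ m) :
    ∏ j ∈ Finset.range m, (1 - ((j : ℝ) / m) ^ 2) = (2 * m).factorial / (2 * (m : ℝ) ^ (2 * m)) := by
  have hm0 : (m : ℝ) ≠ 0 := by positivity
  have h1 : ∀ j ∈ Finset.range m, (1 - ((j : ℝ) / m) ^ 2)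
      = ((m - j : ℕ) : ℝ) * ((m + j : ℕ) : ℝ) / (m : ℝ) ^ 2 := by
    intro j hj
    rw [Nat.cast_sub (Finset.mem_range.1 hj).le]
    push_cast
    field_simp
    ring
  have h2 : ∏ j ∈ Finset.range m, (m - j) = m.factorial := by
    rw [← Nat.descFactorial_eq_prod_range, Nat.descFactorial_self]
  have h3 : (m - 1).factorial * ∏ j ∈ Finset.range m, (m + j) = (2 * m - 1).factorial := by
    rw [← Nat.ascFactorial_eq_prod_range]
    have := Nat.factorial_mul_ascFactorial (m - 1) m
    rwa [Nat.sub_add_cancel hm, show m - 1 + m = 2 * m - 1 by omega] at this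
  have h4 : 2 * (m.factorial * ∏ j ∈ Finset.range m, (m + j)) = (2 * m).factorial := by
    rw [← Nat.mul_factorial_pred (by omega : m ≠ 0), ← Nat.mul_factorial_pred (by omega : 2 * m ≠ 0),
      ← h3]
    ring
  rw [Finset.prod_congr rfl h1, Finset.prod_div_distrib, Finset.prod_mul_distrib,
    Finset.prod_const, Finset.card_range, ← Nat.cast_prod, ← Nat.cast_prod, h2, ← h4, ← pow_mul]
  push_cast
  field_simp

theorem le_prod_one_sub_div_sq (hm : 1 ≤ m) :
    1 / 2 * (4 / Real.exp 2) ^ m ≤ ∏ j ∈ Finset.range m, (1 - ((j : ℝ) / m) ^ 2) := by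
  have hm0 : (0 : ℝ) < m := by exact_mod_cast hm
  rw [prod_one_sub_div_sq hm]
  have h := Real.pow_div_factorial_le_exp ((2 * m : ℕ) : ℝ) (by positivity) (2 * m)
  rw [div_le_iff₀ (by positivity)] at h
  have he : Real.exp ((2 * m : ℕ) : ℝ) = Real.exp 2 ^ m := by
    rw [← Real.exp_nat_mul]; push_cast; ring_nf
  rw [he] at h
  rw [div_pow, le_div_iff₀ (by positivity)]
  have : ((2 * m : ℕ) : ℝ) ^ (2 * m) = 4 ^ m * (m : ℝ) ^ (2 * m) := by
    push_cast
    rw [mul_pow, pow_mul]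
    norm_num
  rw [this] at h
  have e0 := Real.exp_pos 2
  calc _ = 4 ^ m * (m : ℝ) ^ (2 * m) / Real.exp 2 ^ m := by ring
    _ ≤ _ := by
      rw [div_le_iff₀ (by positivity)]
      linarith

/-- Rectangles are added one at a time: after `i` of them, at most the proportion `i / m` of the rows
and columns is met, so the next one is forced with probability at least `(1 - (i / m) ^ 2) ^ 2`. -/
theorem prod_le_factorial_mul_card_supports (hk : 2 ≤ k) (hkn : 1024 * k ^ 2 ≤ n)
    (hmk : m * k ≤ n) {j : ℕ} (hj : j ≤ m) :
    ∏ i ∈ Finset.range j,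
        ((511 / 512 : ℝ) ^ k * (n.choose k : ℝ) ^ 2 * (1 - ((i : ℝ) / m) ^ 2) ^ 2)
      ≤ (j.factorial : ℝ) * ((supports n k j).card : ℝ) := by
  induction j with
  | zero =>
    have : 0 < (supports n k 0).card := Finset.card_pos.2 (supports_nonempty (by omega))
    simpa using this
  | succ j ih =>
    have hm0 : (0 : ℝ) < m := by exact_mod_cast (by omega : 0 < m)
    have hmkR : (m : ℝ) * k ≤ n := by exact_mod_cast hmk
    have hjm : (j : ℝ) ≤ m := by exact_mod_cast (by omega : j ≤ m)
    have hv1 : (j : ℝ) / m ≤ 1 := (div_le_one hm0).2 hjm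
    have hv0 : 0 ≤ (j : ℝ) / m := by positivity
    have hjk : (j : ℝ) * k ≤ j / m * n := by
      calc (j : ℝ) * k = j / m * (m * k) := by field_simp
        _ ≤ _ := by gcongr
    set c : ℝ := (511 / 512 : ℝ) ^ k * (n.choose k : ℝ) ^ 2 * (1 - ((j : ℝ) / m) ^ 2) ^ 2 with hc
    have hW : ∀ W ∈ supports n k j, c ≤ (forcedRects W k).card := by
      intro W hW
      have hr : (n : ℝ) ≤ (emptyRows W).card + j * k := by
        exact_mod_cast card_compl_emptyRows_le hW
      have hc' : (n : ℝ) ≤ (emptyCols W).card + j * k := by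
        exact_mod_cast card_compl_emptyCols_le hW
      have h1 := le_card_forcedRects W k hv0 hv1 (by linarith) (by linarith)
      have hWc : W.card ≤ n * k := by
        rw [card_le_of_mem_unionsOfRectangles (fun S hS => mem_sizeSets.1 hS) hW]
        calc j * k ^ 2 = (j * k) * k := by ring
          _ ≤ (m * k) * k := by gcongr; omega
          _ ≤ _ := by gcongr
      have h2 := le_card_openRects (by omega) hkn hWc
      refine le_trans ?_ h1
      have h3 : ((j : ℝ) / m) ^ k ≤ ((j : ℝ) / m) ^ 2 := pow_le_pow_of_le_one hv0 hv1 hk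
      have h4 : ((j : ℝ) / m) ^ 2 ≤ 1 := pow_le_one₀ hv0 hv1
      rw [hc, mul_comm]
      gcongr
    have hsum : c * (supports n k j).card ≤ (j + 1) * (supports n k (j + 1)).card := by
      have h1 := Finset.card_nsmul_le_sum (supports n k j)
        (fun W => ((forcedRects W k).card : ℝ)) c hW
      rw [nsmul_eq_mul, mul_comm] at h1
      refine h1.trans ?_
      exact_mod_cast sum_card_forcedRects_le n k j
    have hc0 : 0 ≤ c := by positivity
    rw [Finset.prod_range_succ, Nat.factorial_succ]
    calc _ ≤ (j.factorial * (supports n k j).card : ℝ) * c :=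
          mul_le_mul_of_nonneg_right (ih (by omega)) hc0
      _ = j.factorial * (c * (supports n k j).card) := by ring
      _ ≤ j.factorial * ((j + 1) * (supports n k (j + 1)).card) := by gcongr
      _ = _ := by push_cast; ring

/-- The number of supports from below, compared with the `C(n, k) ^ (2 m) / m!` unordered tuples of
arbitrary rectangles. The worst case is `m = n / 2`, `k = 2`. -/
theorem le_factorial_mul_card_supports (hk : 2 ≤ k) (hm : 1 ≤ m) (hkn : 1024 * k ^ 2 ≤ n)
    (hmk : m * k ≤ n) :
    1 / 4 * (4 / Real.exp 2) ^ n * (511 / 512 : ℝ) ^ n * (n.choose k : ℝ) ^ (2 * m)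
      ≤ m.factorial * (supports n k m).card := by
  refine le_trans ?_ (prod_le_factorial_mul_card_supports hk hkn hmk le_rfl)
  rw [Finset.prod_mul_distrib, Finset.prod_const, Finset.card_range, Finset.prod_pow, mul_pow,
    ← pow_mul, ← pow_mul, mul_comm k m]
  have h := le_prod_one_sub_div_sq hm
  have h2 : (1 / 2 * (4 / Real.exp 2) ^ m) ^ 2 = 1 / 4 * (4 / Real.exp 2) ^ (m * 2) := by
    rw [mul_pow, ← pow_mul]; norm_num
  have h3 := pow_le_pow_left₀ (by positivity) h 2
  rw [h2] at h3
  have he : 4 / Real.exp 2 ≤ 1 := by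
    rw [div_le_one (Real.exp_pos 2)]
    have : Real.exp 2 = Real.exp 1 * Real.exp 1 := by rw [← Real.exp_add]; norm_num
    nlinarith [Real.exp_one_gt_d9]
  have h4 : (4 / Real.exp 2) ^ n ≤ (4 / Real.exp 2) ^ (m * 2) :=
    pow_le_pow_of_le_one (by positivity) he (by nlinarith)
  have h5 : (511 / 512 : ℝ) ^ n ≤ (511 / 512 : ℝ) ^ (m * k) :=
    pow_le_pow_of_le_one (by norm_num) (by norm_num) hmk
  calc _ = ((511 / 512 : ℝ) ^ n * (n.choose k : ℝ) ^ (2 * m)) * (1 / 4 * (4 / Real.exp 2) ^ n) := by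
        ring
    _ ≤ ((511 / 512 : ℝ) ^ (m * k) * (n.choose k : ℝ) ^ (2 * m))
        * (1 / 4 * (4 / Real.exp 2) ^ (m * 2)) := by gcongr
    _ ≤ _ := by gcongr

/-! ### The number of supports meeting almost all rows or columns -/

section Maps

variable {ι α : Type*} [Fintype ι] [DecidableEq ι] [Fintype α] [DecidableEq α]

theorem card_filter_injOn (A : Finset ι) :
    (Finset.univ.filter fun φ : ι → α => Set.InjOn φ A).card
      = (Fintype.card α).descFactorial A.card * Fintype.card α ^ (Fintype.card ι - A.card) := by
  classical
  have e : {φ : ι → α // Set.InjOn φ A} ≃ ({x // x ∈ A} ↪ α) × ({x // ¬ x ∈ A} → α) :=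
    ((Equiv.piEquivPiSubtypeProd (fun x => x ∈ A) fun _ => α).subtypeEquiv
      (q := fun p => Function.Injective p.1) fun φ => Set.injOn_iff_injective).trans
    ((Equiv.prodSubtypeFstEquivSubtypeProd (p := fun f : {x // x ∈ A} → α =>
      Function.Injective f)).trans
      (Equiv.prodCongr (Equiv.subtypeInjectiveEquivEmbedding _ _) (Equiv.refl _)))
  rw [← Fintype.card_subtype, Fintype.card_congr e, Fintype.card_prod, Fintype.card_embedding_eq,
    Fintype.card_fun, Fintype.card_subtype_compl]
  simp

/-- A map with at least `q` values is injective on some set of `q` points. -/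
theorem card_filter_le_card_image_le (q : ℕ) :
    (Finset.univ.filter fun φ : ι → α => q ≤ (Finset.univ.image φ).card).card
      ≤ (Fintype.card ι).choose q *
        ((Fintype.card α).descFactorial q * Fintype.card α ^ (Fintype.card ι - q)) := by
  classical
  have hsub : (Finset.univ.filter fun φ : ι → α => q ≤ (Finset.univ.image φ).card)
      ⊆ ((Finset.univ : Finset ι).powersetCard q).biUnion fun A =>
        Finset.univ.filter fun φ : ι → α => Set.InjOn φ A := by
    intro φ hφ
    obtain ⟨B, hB, hBq⟩ := Finset.exists_subset_card_eq (Finset.mem_filter.1 hφ).2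
    obtain ⟨A, hA, hAinj⟩ : ∃ A : Finset ι, A.image φ = B ∧ Set.InjOn φ A := by
      obtain ⟨A, -, hinj, himg⟩ := Finset.exists_subset_injOn_image_eq_of_surjOn
        (f := φ) (s := Set.univ) (t := B) (fun b hb => by
          obtain ⟨a, -, ha⟩ := Finset.mem_image.1 (hB hb)
          exact ⟨a, Set.mem_univ _, ha⟩)
      exact ⟨A, by simpa using himg, hinj⟩
    refine Finset.mem_biUnion.2 ⟨A, Finset.mem_powersetCard.2 ⟨Finset.subset_univ _, ?_⟩,
      Finset.mem_filter.2 ⟨Finset.mem_univ _, hAinj⟩⟩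
    rw [← hBq, ← hA, Finset.card_image_of_injOn hAinj]
  refine (Finset.card_le_card hsub).trans ?_
  refine (Finset.card_biUnion_le_card_mul _ _
    ((Fintype.card α).descFactorial q * Fintype.card α ^ (Fintype.card ι - q))
    fun A hA => ?_).trans_eq ?_
  · rw [card_filter_injOn, (Finset.mem_powersetCard.1 hA).2]
  · rw [Finset.card_powersetCard, Finset.card_univ]

end Maps

variable {n m k : ℕ}

/-- The `m`-tuples of `k`-subsets of `[n]` that together cover at least `q` elements. -/
def coveringTuples (n k m q : ℕ) : Finset (Fin m → Finset (Fin n)) :=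
  Finset.univ.filter fun S => (∀ i, S i ∈ sizeSets n k) ∧ q ≤ (Finset.univ.biUnion S).card

/-- Enumerating each of the subsets turns a tuple of subsets into `k! ^ m` maps with the same
values. -/
theorem card_coveringTuples_le (n k m q : ℕ) :
    k.factorial ^ m * (coveringTuples n k m q).card
      ≤ (m * k).choose q * (n.descFactorial q * n ^ (m * k - q)) := by
  classical
  have hbound := card_filter_le_card_image_le (ι := Fin m × Fin k) (α := Fin n) q
  simp only [Fintype.card_prod, Fintype.card_fin] at hbound
  refine le_trans ?_ hbound
  set A : Finset (Fin m → Fin k → Fin n) := Finset.univ.filter fun φ =>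
    (∀ i, Function.Injective (φ i)) ∧
      q ≤ (Finset.univ.biUnion fun i => Finset.univ.image (φ i)).card with hA
  have hle : A.card ≤ (Finset.univ.filter fun φ : Fin m × Fin k → Fin n =>
      q ≤ (Finset.univ.image φ).card).card := by
    refine Finset.card_le_card_of_injOn (fun φ x => φ x.1 x.2) ?_ ?_
    · intro φ hφ
      refine Finset.mem_filter.2 ⟨Finset.mem_univ _, (Finset.mem_filter.1 hφ).2.2.trans_eq ?_⟩
      congr 1
      ext v
      simp
    · intro φ _ ψ _ h
      exact funext fun i => funext fun x => congrFun h (i, x)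
  refine le_trans ?_ hle
  refine Finset.mul_card_image_le_card_of_maps_to
    (f := fun (φ : Fin m → Fin k → Fin n) i => Finset.univ.image (φ i)) ?_ _ ?_
  · intro φ hφ
    obtain ⟨hinj, hq⟩ := (Finset.mem_filter.1 hφ).2
    refine Finset.mem_filter.2 ⟨Finset.mem_univ _, fun i => mem_sizeSets.2 ?_, hq⟩
    rw [Finset.card_image_of_injective _ (hinj i), Finset.card_univ, Fintype.card_fin]
  · intro S hS
    obtain ⟨hSk, hSq⟩ := (Finset.mem_filter.1 hS).2
    have hcard : k.factorial ^ m = (Finset.univ : Finset (Fin m → Equiv.Perm (Fin k))).card := by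
      rw [Finset.card_univ, Fintype.card_fun, Fintype.card_perm, Fintype.card_fin,
        Fintype.card_fin]
    rw [hcard]
    let e : ∀ i, Fin k ↪o Fin n := fun i => (S i).orderEmbOfFin (mem_sizeSets.1 (hSk i))
    refine Finset.card_le_card_of_injOn (fun σ i x => e i (σ i x)) ?_ ?_
    · intro σ _
      have himg : (fun i => Finset.univ.image fun x => e i (σ i x)) = S := by
        funext i
        have h1 : (Finset.univ.image fun x => e i (σ i x)) = Finset.univ.image (e i) := by
          ext v
          simp only [Finset.mem_image, Finset.mem_univ, true_and]
          exact ((σ i).exists_congr_left.trans (by simp))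
        rw [h1]
        exact Finset.image_orderEmbOfFin_univ _ _
      refine Finset.mem_filter.2 ⟨Finset.mem_filter.2 ⟨Finset.mem_univ _,
        fun i => (e i).injective.comp (σ i).injective, ?_⟩, himg⟩
      rwa [himg]
    · intro σ _ τ _ h
      exact funext fun i => Equiv.ext fun x => (e i).injective (congrFun (congrFun h i) x)

theorem injective_of_mem_packings (hk : 1 ≤ k) {ω : Fin m → Rect n}
    (hω : ω ∈ packings (sizeSets n k) m) : Function.Injective ω := by
  intro i j hij
  by_contra hne
  have h := mem_packings.1 hω
  have hd := h.2 i j hne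
  rw [hij, disjoint_self] at hd
  have h1 := mem_sizeSets.1 (h.1 j).1
  have h2 := mem_sizeSets.1 (h.1 j).2
  have : (cells (ω j)).card = 0 := by rw [hd]; rfl
  rw [cells, Finset.card_product, h1, h2] at this
  have := Nat.mul_pos hk hk
  omega

/-- Every support is the union of at least `m!` ordered packings. -/
theorem factorial_mul_card_filter_supports_le (hk : 1 ≤ k)
    (p : Finset (Fin n × Fin n) → Prop) [DecidablePred p] :
    m.factorial * ((supports n k m).filter p).card
      ≤ ((packings (sizeSets n k) m).filter fun ω => p (tupleUnion ω)).card := by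
  classical
  refine Finset.mul_card_image_le_card_of_maps_to (f := tupleUnion) ?_ _ ?_
  · intro ω hω
    obtain ⟨hω, hp⟩ := Finset.mem_filter.1 hω
    refine Finset.mem_filter.2 ⟨?_, hp⟩
    rw [supports, unionsOfRectangles_eq_image]
    exact Finset.mem_image_of_mem _ hω
  · intro K hK
    obtain ⟨hK, hp⟩ := Finset.mem_filter.1 hK
    rw [supports, unionsOfRectangles_eq_image, Finset.mem_image] at hK
    obtain ⟨ω, hω, rfl⟩ := hK
    have hinj := injective_of_mem_packings hk hω
    rw [mem_packings] at hω
    have : m.factorial = (Finset.univ : Finset (Equiv.Perm (Fin m))).card := by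
      rw [Finset.card_univ, Fintype.card_perm, Fintype.card_fin]
    rw [this]
    refine Finset.card_le_card_of_injOn (fun σ => ω ∘ σ) ?_ ?_
    · intro σ _
      have hU : tupleUnion (ω ∘ σ) = tupleUnion ω := by
        ext x
        simp only [mem_tupleUnion, Function.comp]
        exact σ.exists_congr_left.trans (by simp)
      simp only [Finset.coe_filter, Finset.mem_filter, Set.mem_ofPred_eq]
      refine ⟨⟨mem_packings.2 ⟨fun i => hω.1 _, fun i j hij => hω.2 _ _ ?_⟩, ?_⟩, hU⟩
      · exact fun h => hij (σ.injective h)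
      · rwa [hU]
    · intro σ _ τ _ h
      exact Equiv.ext fun i => hinj (congrFun h i)

theorem card_emptyRows_tupleUnion {ω : Fin m → Rect n} (h : ∀ i, (ω i).2.Nonempty) :
    (emptyRows (tupleUnion ω)).card = n - (Finset.univ.biUnion fun i => (ω i).1).card := by
  have : emptyRows (tupleUnion ω) = (Finset.univ.biUnion fun i => (ω i).1)ᶜ := by
    ext r
    simp only [mem_emptyRows, mem_tupleUnion, cells, Finset.mem_product, Finset.mem_compl,
      Finset.mem_biUnion, Finset.mem_univ, true_and, not_exists, not_and]
    constructor
    · intro hr i hi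
      obtain ⟨c, hc⟩ := h i
      exact hr c i hi hc
    · intro hr c i hi
      exact absurd hi (hr i)
  rw [this, Finset.card_compl, Fintype.card_fin]

theorem card_emptyCols_tupleUnion {ω : Fin m → Rect n} (h : ∀ i, (ω i).1.Nonempty) :
    (emptyCols (tupleUnion ω)).card = n - (Finset.univ.biUnion fun i => (ω i).2).card := by
  have : emptyCols (tupleUnion ω) = (Finset.univ.biUnion fun i => (ω i).2)ᶜ := by
    ext c
    simp only [mem_emptyCols, mem_tupleUnion, cells, Finset.mem_product, Finset.mem_compl,
      Finset.mem_biUnion, Finset.mem_univ, true_and, not_exists, not_and]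
    constructor
    · intro hc i hi
      obtain ⟨r, hr⟩ := h i
      exact hc r i hr hi
    · intro hc r i _ hi
      exact absurd hi (hc i)
  rw [this, Finset.card_compl, Fintype.card_fin]

theorem card_piFinset_sizeSets (n k m : ℕ) :
    (Fintype.piFinset fun _ : Fin m => sizeSets n k).card = n.choose k ^ m := by
  rw [Fintype.card_piFinset_const, sizeSets_eq_powersetCard, Finset.card_powersetCard,
    Finset.card_univ, Fintype.card_fin]

/-- If fewer than `n / 64` rows (or columns) of a support are empty, then the row sets (or the column
sets) of each of its packings cover all but `n / 64` elements; the other sides are arbitrary. -/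
theorem factorial_mul_card_supports_sdiff_le (hk : 1 ≤ k) :
    m.factorial * (supports n k m \ sparseSupports n k m).card
      ≤ 2 * ((coveringTuples n k m (n - n / 64)).card * n.choose k ^ m) := by
  classical
  have hne : ∀ ω ∈ packings (sizeSets n k) m, ∀ i, (ω i).1.Nonempty ∧ (ω i).2.Nonempty := by
    intro ω hω i
    have h := (mem_packings.1 hω).1 i
    exact ⟨Finset.card_pos.1 (by rw [mem_sizeSets.1 h.1]; omega),
      Finset.card_pos.1 (by rw [mem_sizeSets.1 h.2]; omega)⟩
  have hsub : supports n k m \ sparseSupports n k m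
      ⊆ ((supports n k m).filter fun K => 64 * (emptyRows K).card < n) ∪
        (supports n k m).filter fun K => 64 * (emptyCols K).card < n := by
    intro K hK
    simp only [sparseSupports, Finset.mem_sdiff, Finset.mem_filter, Finset.mem_union] at hK ⊢
    by_contra hcon
    exact hK.2 ⟨hK.1, by by_contra h; exact hcon (Or.inl ⟨hK.1, by omega⟩),
      by by_contra h; exact hcon (Or.inr ⟨hK.1, by omega⟩)⟩
  have hrows : ((packings (sizeSets n k) m).filter
      fun ω => 64 * (emptyRows (tupleUnion ω)).card < n).card
      ≤ (coveringTuples n k m (n - n / 64)).card * n.choose k ^ m := by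
    rw [← card_piFinset_sizeSets, ← Finset.card_product]
    refine Finset.card_le_card_of_injOn (fun ω => (fun i => (ω i).1, fun i => (ω i).2)) ?_ ?_
    · intro ω hω
      obtain ⟨hω, hlt⟩ := Finset.mem_filter.1 hω
      rw [card_emptyRows_tupleUnion fun i => (hne ω hω i).2] at hlt
      refine Finset.mem_product.2 ⟨Finset.mem_filter.2 ⟨Finset.mem_univ _,
        fun i => ((mem_packings.1 hω).1 i).1, ?_⟩,
        Fintype.mem_piFinset.2 fun i => ((mem_packings.1 hω).1 i).2⟩
      change _ ≤ (Finset.univ.biUnion fun i => (ω i).1).card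
      omega
    · intro ω _ ω' _ h
      obtain ⟨h1, h2⟩ := Prod.ext_iff.1 h
      exact funext fun i => Prod.ext (congrFun h1 i) (congrFun h2 i)
  have hcols : ((packings (sizeSets n k) m).filter
      fun ω => 64 * (emptyCols (tupleUnion ω)).card < n).card
      ≤ (coveringTuples n k m (n - n / 64)).card * n.choose k ^ m := by
    rw [← card_piFinset_sizeSets, ← Finset.card_product]
    refine Finset.card_le_card_of_injOn (fun ω => (fun i => (ω i).2, fun i => (ω i).1)) ?_ ?_
    · intro ω hω
      obtain ⟨hω, hlt⟩ := Finset.mem_filter.1 hω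
      rw [card_emptyCols_tupleUnion fun i => (hne ω hω i).1] at hlt
      refine Finset.mem_product.2 ⟨Finset.mem_filter.2 ⟨Finset.mem_univ _,
        fun i => ((mem_packings.1 hω).1 i).2, ?_⟩,
        Fintype.mem_piFinset.2 fun i => ((mem_packings.1 hω).1 i).1⟩
      change _ ≤ (Finset.univ.biUnion fun i => (ω i).2).card
      omega
    · intro ω _ ω' _ h
      obtain ⟨h1, h2⟩ := Prod.ext_iff.1 h
      exact funext fun i => Prod.ext (congrFun h2 i) (congrFun h1 i)
  have h1 := factorial_mul_card_filter_supports_le (m := m) (n := n) hk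
    fun K => 64 * (emptyRows K).card < n
  have h2 := factorial_mul_card_filter_supports_le (m := m) (n := n) hk
    fun K => 64 * (emptyCols K).card < n
  calc _ ≤ m.factorial * (((supports n k m).filter fun K => 64 * (emptyRows K).card < n).card +
        ((supports n k m).filter fun K => 64 * (emptyCols K).card < n).card) :=
        Nat.mul_le_mul_left _ ((Finset.card_le_card hsub).trans (Finset.card_union_le _ _))
    _ ≤ _ := by linarith [h1.trans hrows, h2.trans hcols]

/-! ### Numerical estimates -/

/-- The upper half of Stirling's formula, up to a factor `√n`. -/
theorem factorial_mul_exp_le {n : ℕ} (hn : 1 ≤ n) :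
    (n.factorial : ℝ) * Real.exp n ≤ Real.exp 1 * (n : ℝ) ^ (n + 1) := by
  induction n, hn using Nat.le_induction with
  | base => simp
  | succ n hn ih =>
    have hn0 : (0 : ℝ) < n := by exact_mod_cast hn
    have h := Real.one_sub_div_pow_le_exp_neg (n := n + 1) (t := 1) (by push_cast; linarith)
    have e : 1 - 1 / ((n + 1 : ℕ) : ℝ) = n / (n + 1) := by push_cast; field_simp; ring
    rw [e, div_pow, div_le_iff₀ (by positivity), Real.exp_neg, inv_mul_eq_div,
      le_div_iff₀ (Real.exp_pos 1)] at h
    rw [Nat.factorial_succ]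
    push_cast
    rw [Real.exp_add]
    calc _ = ((n : ℝ) + 1) * Real.exp 1 * (n.factorial * Real.exp n) := by ring
      _ ≤ ((n : ℝ) + 1) * Real.exp 1 * (Real.exp 1 * (n : ℝ) ^ (n + 1)) := by gcongr
      _ = ((n : ℝ) + 1) * Real.exp 1 * ((n : ℝ) ^ (n + 1) * Real.exp 1) := by ring
      _ ≤ ((n : ℝ) + 1) * Real.exp 1 * ((n : ℝ) + 1) ^ (n + 1) := by gcongr
      _ = _ := by ring

theorem pow_div_factorial_div_le (n : ℕ) :
    (n : ℝ) ^ (n / 64) / (n / 64).factorial ≤ Real.exp (0.082 * n) := by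
  set t := n / 64 with ht
  have htn : (t : ℝ) ≤ n / 64 := by rw [ht]; exact Nat.cast_div_le
  have h := Real.pow_div_factorial_le_exp ((n : ℝ) / 64) (by positivity) t
  have h64 : (64 : ℝ) ^ t ≤ Real.exp (4.2 * t) := by
    have : (64 : ℝ) ≤ Real.exp 4.2 := by
      have h2 : Real.log 64 ≤ 4.2 := by
        rw [show (64 : ℝ) = 2 ^ 6 by norm_num, Real.log_pow]
        have := Real.log_two_lt_d9
        push_cast
        linarith
      exact (Real.log_le_iff_le_exp (by norm_num)).1 h2
    calc (64 : ℝ) ^ t ≤ Real.exp 4.2 ^ t := by gcongr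
      _ = _ := by rw [← Real.exp_nat_mul, mul_comm]
  calc (n : ℝ) ^ t / t.factorial = 64 ^ t * (((n : ℝ) / 64) ^ t / t.factorial) := by
        rw [div_pow]; field_simp
    _ ≤ Real.exp (4.2 * t) * Real.exp (n / 64) := by gcongr
    _ ≤ _ := by
      rw [← Real.exp_add]
      refine Real.exp_le_exp.2 ?_
      have : (0 : ℝ) ≤ n := by positivity
      linarith

theorem descFactorial_sub_mul_choose_le {n t : ℕ} (ht : t ≤ n) :
    (n.descFactorial (n - t) : ℝ) * n.choose t
      ≤ n.factorial * ((n : ℝ) ^ t / t.factorial) / t.factorial := by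
  have h1 : t.factorial * n.descFactorial (n - t) = n.factorial := by
    have := Nat.factorial_mul_descFactorial (Nat.sub_le n t)
    rwa [Nat.sub_sub_self ht] at this
  have h2 : (n.descFactorial (n - t) : ℝ) = n.factorial / t.factorial := by
    rw [eq_div_iff (by positivity), mul_comm]
    exact_mod_cast h1
  have h3 : (n.choose t : ℝ) ≤ n ^ t / t.factorial := Nat.choose_le_pow_div t n
  rw [h2]
  calc _ ≤ (n.factorial : ℝ) / t.factorial * (n ^ t / t.factorial) := by gcongr
    _ = _ := by ring

/-- Almost all supports leave a positive proportion of the rows and columns empty: compared with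
`le_factorial_mul_card_supports`, covering almost all rows costs a factor `exp (-n)`. -/
theorem card_supports_sdiff_le (hk : 2 ≤ k) (hm : 1 ≤ m) (hkn : 1024 * k ^ 2 ≤ n)
    (hmk : m * k ≤ n) :
    ((supports n k m \ sparseSupports n k m).card : ℝ) / (supports n k m).card
      ≤ 32 * n * Real.exp (-(n / 8)) := by
  have hkn' : 1024 * k ≤ n := by nlinarith
  have hn : 1 ≤ n := by omega
  have hnR : (0 : ℝ) < n := by exact_mod_cast hn
  have hlow := le_factorial_mul_card_supports hk hm hkn hmk
  have hup := factorial_mul_card_supports_sdiff_le (n := n) (m := m) (by omega : 1 ≤ k)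
  have hcov := card_coveringTuples_le n k m (n - n / 64)
  set t := n / 64 with ht
  have htn : t ≤ n := Nat.div_le_self _ _
  set B : ℝ := ((supports n k m \ sparseSupports n k m).card : ℝ) with hB
  set F : ℝ := ((supports n k m).card : ℝ) with hF
  set V : ℝ := ((coveringTuples n k m (n - t)).card : ℝ) with hV
  set C : ℝ := (n.choose k : ℝ) with hC
  have hC0 : 0 < C := by
    rw [hC]
    have : 0 < n.choose k := Nat.choose_pos (by omega)
    exact_mod_cast this
  have hF0 : 0 < F := by
    rw [hF]
    have : 0 < (supports n k m).card := Finset.card_pos.2 (supports_nonempty hmk)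
    exact_mod_cast this
  have hupR : (m.factorial : ℝ) * B ≤ 2 * (V * C ^ m) := by
    rw [hB, hV, hC]
    exact_mod_cast hup
  have hfac : (k.factorial : ℝ) * C = n.descFactorial k := by
    rw [hC, ← Nat.cast_mul, ← Nat.descFactorial_eq_factorial_mul_choose]
  -- The normalization of the tuples of subsets is `n ^ (m * k)` up to a small factor.
  have hdesc : (n : ℝ) ^ (m * k) * (511 / 512 : ℝ) ^ n ≤ ((k.factorial : ℝ) * C) ^ m := by
    have h1 : (n : ℝ) * (511 / 512) ≤ (n - k : ℕ) := by
      rw [Nat.cast_sub (by omega)]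
      have : 1024 * (k : ℝ) ≤ n := by exact_mod_cast hkn'
      linarith
    have h2 : ((n - k : ℕ) : ℝ) ^ k ≤ n.descFactorial k := by
      have h := Nat.pow_sub_le_descFactorial n k
      have h3 : (n - k) ^ k ≤ (n + 1 - k) ^ k := Nat.pow_le_pow_left (by omega) k
      exact_mod_cast h3.trans h
    rw [hfac]
    calc (n : ℝ) ^ (m * k) * (511 / 512 : ℝ) ^ n
        ≤ (n : ℝ) ^ (m * k) * (511 / 512 : ℝ) ^ (m * k) := by
          gcongr ?_ * ?_
          exact pow_le_pow_of_le_one (by norm_num) (by norm_num) hmk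
      _ = (((n : ℝ) * (511 / 512)) ^ k) ^ m := by rw [← mul_pow, ← pow_mul, mul_comm m k]
      _ ≤ (((n - k : ℕ) : ℝ) ^ k) ^ m := by gcongr
      _ ≤ _ := by gcongr
  -- The number of tuples covering almost everything, normalized.
  have hcovR : (k.factorial : ℝ) ^ m * V
      ≤ (n : ℝ) ^ (m * k) * (Real.exp 1 * n * Real.exp (-n) * Real.exp (0.082 * n) ^ 2) := by
    have h1 : (k.factorial : ℝ) ^ m * V ≤ ((m * k).choose (n - t) : ℝ) *
        (n.descFactorial (n - t) * (n : ℝ) ^ (m * k - (n - t))) := by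
      rw [hV]
      exact_mod_cast hcov
    refine h1.trans ?_
    rcases lt_or_ge (m * k) (n - t) with hlt | hge
    · rw [Nat.choose_eq_zero_of_lt hlt, Nat.cast_zero, zero_mul]
      positivity
    have h2 : ((m * k).choose (n - t) : ℝ) ≤ n.choose t := by
      rw [← Nat.choose_symm htn]
      exact_mod_cast Nat.choose_le_choose _ hmk
    have h3 := descFactorial_sub_mul_choose_le htn
    have h4 := pow_div_factorial_div_le n
    rw [← ht] at h4
    have h5 := factorial_mul_exp_le hn
    have hpow : (n : ℝ) ^ (m * k) * n ^ t = n ^ (m * k - (n - t)) * n ^ n := by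
      rw [← pow_add, ← pow_add]
      congr 1
      omega
    set Y : ℝ := (n : ℝ) ^ t / t.factorial with hY
    have hY0 : 0 ≤ Y := by positivity
    have h6 : (n.factorial : ℝ) ≤ Real.exp 1 * n * Real.exp (-n) * n ^ n := by
      rw [Real.exp_neg]
      rw [← le_div_iff₀ (Real.exp_pos _)] at h5
      refine h5.trans_eq ?_
      rw [pow_succ]
      field_simp
    refine le_of_mul_le_mul_right ?_ (pow_pos hnR t)
    calc _ = (((m * k).choose (n - t) : ℝ) * n.descFactorial (n - t)) * n ^ t
          * (n : ℝ) ^ (m * k - (n - t)) := by ring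
      _ ≤ ((n.choose t : ℝ) * n.descFactorial (n - t)) * n ^ t
          * (n : ℝ) ^ (m * k - (n - t)) := by gcongr
      _ ≤ (n.factorial * Y / t.factorial) * n ^ t * (n : ℝ) ^ (m * k - (n - t)) := by
          gcongr
          rw [mul_comm]
          exact h3
      _ = n.factorial * Y ^ 2 * (n : ℝ) ^ (m * k - (n - t)) := by rw [hY]; ring
      _ ≤ (Real.exp 1 * n * Real.exp (-n) * n ^ n) * Real.exp (0.082 * n) ^ 2
          * (n : ℝ) ^ (m * k - (n - t)) := by gcongr
      _ = _ := by
          linear_combination (-(Real.exp 1 * n * Real.exp (-n) * Real.exp (0.082 * n) ^ 2)) * hpow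
  set Z : ℝ := Real.exp 1 * n * Real.exp (-n) * Real.exp (0.082 * n) ^ 2 with hZ
  set ρ : ℝ := (511 / 512 : ℝ) ^ n with hρ
  have hρ0 : 0 < ρ := by positivity
  have hVC : V * C ^ m * ρ ≤ Z * C ^ (2 * m) := by
    refine le_of_mul_le_mul_left ?_ (by positivity : (0 : ℝ) < k.factorial ^ m * n ^ (m * k))
    calc _ = ((k.factorial : ℝ) ^ m * V) * ((n : ℝ) ^ (m * k) * ρ) * C ^ m := by ring
      _ ≤ ((n : ℝ) ^ (m * k) * Z) * ((k.factorial : ℝ) * C) ^ m * C ^ m := by gcongr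
      _ = _ := by rw [mul_pow]; ring
  have hmain : 1 / 4 * (4 / Real.exp 2) ^ n * ρ ^ 2 * B ≤ 2 * Z * F := by
    have h1 : 1 / 4 * (4 / Real.exp 2) ^ n * ρ * C ^ (2 * m) * (V * C ^ m * ρ)
        ≤ (m.factorial * F) * (Z * C ^ (2 * m)) :=
      mul_le_mul hlow hVC (by positivity) (by positivity)
    refine le_of_mul_le_mul_left ?_ (by positivity : (0 : ℝ) < m.factorial * C ^ (2 * m))
    calc _ = 1 / 4 * (4 / Real.exp 2) ^ n * ρ ^ 2 * C ^ (2 * m) * (m.factorial * B) := by ring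
      _ ≤ 1 / 4 * (4 / Real.exp 2) ^ n * ρ ^ 2 * C ^ (2 * m) * (2 * (V * C ^ m)) := by gcongr
      _ = 2 * (1 / 4 * (4 / Real.exp 2) ^ n * ρ * C ^ (2 * m) * (V * C ^ m * ρ)) := by ring
      _ ≤ 2 * ((m.factorial * F) * (Z * C ^ (2 * m))) :=
        mul_le_mul_of_nonneg_left h1 (by norm_num)
      _ = _ := by ring
  -- Since `Z` is about `exp (-0.836 n)` and `2 - 2 log 2 < 0.62`, the exponents leave a margin.
  have hρ' : Real.exp (-(0.002 * n)) ≤ ρ := by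
    have h1 : Real.exp (-0.002) ≤ 511 / 512 := by
      have := Real.add_one_le_exp (0.002 : ℝ)
      rw [Real.exp_neg, inv_le_comm₀ (Real.exp_pos _) (by norm_num)]
      refine le_trans ?_ this
      norm_num
    calc Real.exp (-(0.002 * n)) = Real.exp (-0.002) ^ n := by
          rw [← Real.exp_nat_mul]; ring_nf
      _ ≤ _ := pow_le_pow_left₀ (Real.exp_pos _).le h1 n
  have h4 : Real.exp (-(0.62 * n)) ≤ (4 / Real.exp 2) ^ n := by
    have h1 : Real.exp (1.38 : ℝ) ≤ 4 := by
      rw [← Real.le_log_iff_exp_le (by norm_num), show (4 : ℝ) = 2 ^ 2 by norm_num, Real.log_pow]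
      have := Real.log_two_gt_d9
      push_cast
      linarith
    have h2 : Real.exp (-0.62) ≤ 4 / Real.exp 2 := by
      rw [le_div_iff₀ (Real.exp_pos _), ← Real.exp_add]
      refine le_trans (Real.exp_le_exp.2 ?_) h1
      norm_num
    calc Real.exp (-(0.62 * n)) = Real.exp (-0.62) ^ n := by
          rw [← Real.exp_nat_mul]; ring_nf
      _ ≤ _ := pow_le_pow_left₀ (Real.exp_pos _).le h2 n
  rw [div_le_iff₀ hF0]
  have hE : 1 / 4 * Real.exp (-(0.624 * n)) * B ≤ 2 * Z * F := by
    refine le_trans (mul_le_mul_of_nonneg_right ?_ (by positivity)) hmain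
    calc 1 / 4 * Real.exp (-(0.624 * n))
        = 1 / 4 * Real.exp (-(0.62 * n)) * Real.exp (-(0.002 * n)) ^ 2 := by
          rw [← Real.exp_nat_mul, mul_assoc, ← Real.exp_add]
          congr 2
          push_cast
          ring
      _ ≤ _ := by gcongr
  have hZ' : Z ≤ 3 * n * Real.exp (-(0.836 * n)) := by
    have h1 : Real.exp (-n) * Real.exp (0.082 * n) ^ 2 = Real.exp (-(0.836 * n)) := by
      rw [← Real.exp_nat_mul, ← Real.exp_add]
      congr 1
      push_cast
      ring
    rw [hZ, mul_assoc _ (Real.exp (-n)), h1]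
    have := Real.exp_one_lt_three.le
    gcongr
  refine le_of_mul_le_mul_left ?_ (by positivity : (0 : ℝ) < 1 / 4 * Real.exp (-(0.624 * n)))
  calc _ ≤ 2 * Z * F := hE
    _ ≤ 2 * (3 * n * Real.exp (-(0.836 * n))) * F := by gcongr
    _ ≤ 8 * n * Real.exp (-(0.624 * n) + -(n / 8)) * F := by
        have : Real.exp (-(0.836 * n)) ≤ Real.exp (-(0.624 * n) + -(n / 8)) :=
          Real.exp_le_exp.2 (by linarith)
        have h0 := Real.exp_pos (-(0.836 * (n : ℝ)))
        gcongr ?_ * F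
        nlinarith
    _ = _ := by rw [Real.exp_add]; ring

/-! ### Random permutations of the rows and columns -/

section Permutations

variable {α : Type*} [Fintype α] [DecidableEq α]

/-- The exponential moment of a sum over part of the graph of a random permutation. The value of the
permutation at a new point is uniform among the values that are not yet used. -/
theorem sum_perm_exp_partial_le {g : α → α → ℝ} (h0 : ∀ r s, 0 ≤ g r s) (h1 : ∀ r s, g r s ≤ 1)
    {D : ℝ} (hD : 0 < D) (A : Finset α) (hA : D + A.card ≤ Fintype.card α + 1) :
    ∑ π : Equiv.Perm α, Real.exp (∑ r ∈ A, g r (π r))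
      ≤ (Fintype.card α).factorial * Real.exp (2 / D * ∑ r ∈ A, ∑ s, g r s) := by
  induction A using Finset.induction_on with
  | empty => simp [Fintype.card_perm]
  | insert i A hi ih =>
    rw [Finset.card_insert_of_notMem hi] at hA
    push_cast at hA
    set Φ : Equiv.Perm α → ℝ := fun π => Real.exp (∑ r ∈ A, g r (π r)) with hΦ
    set B : Finset α := Aᶜ with hB
    have hBcard : D ≤ B.card := by
      rw [hB, Finset.card_compl, Nat.cast_sub (Finset.card_le_univ A)]
      linarith
    have hBpos : (0 : ℝ) < B.card := hD.trans_le hBcard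
    have hswap : ∀ j ∈ B, ∑ π, Φ π * Real.exp (g i (π i)) = ∑ π, Φ π * Real.exp (g i (π j)) := by
      intro j hj
      rw [← Equiv.sum_comp (Equiv.mulRight (Equiv.swap i j))]
      refine Finset.sum_congr rfl fun π _ => ?_
      have hΦ' : Φ (π * Equiv.swap i j) = Φ π := by
        simp only [hΦ]
        congr 1
        refine Finset.sum_congr rfl fun r hr => ?_
        rw [Equiv.Perm.mul_apply, Equiv.swap_apply_of_ne_of_ne]
        · rintro rfl; exact hi hr
        · rintro rfl; exact (Finset.mem_compl.1 hj) hr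
      simp [hΦ']
    set u : ℝ := ∑ s, (Real.exp (g i s) - 1) with hu
    have hpt : ∀ π : Equiv.Perm α, ∑ j ∈ B, Real.exp (g i (π j)) ≤ B.card + u := by
      intro π
      have : ∑ j ∈ B, (Real.exp (g i (π j)) - 1) ≤ u := by
        rw [hu, ← Equiv.sum_comp π]
        exact Finset.sum_le_univ_sum_of_nonneg fun s => sub_nonneg.2 (Real.one_le_exp (h0 _ _))
      rw [Finset.sum_sub_distrib, Finset.sum_const, nsmul_eq_mul, mul_one] at this
      linarith
    have hu0 : 0 ≤ u := Finset.sum_nonneg fun s _ => sub_nonneg.2 (Real.one_le_exp (h0 _ _))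
    have hu2 : u ≤ 2 * ∑ s, g i s := by
      rw [hu, Finset.mul_sum]
      exact Finset.sum_le_sum fun s _ => exp_sub_one_le_two_mul (h0 _ _) (h1 _ _)
    have hstep : ∑ π, Φ π * Real.exp (g i (π i)) ≤ (1 + u / B.card) * ∑ π, Φ π := by
      refine le_of_mul_le_mul_left ?_ hBpos
      calc (B.card : ℝ) * ∑ π, Φ π * Real.exp (g i (π i))
          = ∑ j ∈ B, ∑ π, Φ π * Real.exp (g i (π j)) := by
            rw [← Finset.sum_congr rfl hswap, Finset.sum_const, nsmul_eq_mul]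
        _ = ∑ π, Φ π * ∑ j ∈ B, Real.exp (g i (π j)) := by
            rw [Finset.sum_comm]
            simp only [Finset.mul_sum]
        _ ≤ ∑ π, Φ π * (B.card + u) :=
            Finset.sum_le_sum fun π _ => mul_le_mul_of_nonneg_left (hpt π) (Real.exp_pos _).le
        _ = _ := by
            rw [← Finset.sum_mul]
            field_simp
    calc ∑ π : Equiv.Perm α, Real.exp (∑ r ∈ insert i A, g r (π r))
        = ∑ π, Φ π * Real.exp (g i (π i)) := by
          refine Finset.sum_congr rfl fun π _ => ?_
          rw [Finset.sum_insert hi, Real.exp_add, mul_comm]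
      _ ≤ (1 + u / B.card) * ∑ π, Φ π := hstep
      _ ≤ Real.exp (2 / D * ∑ s, g i s) *
          ((Fintype.card α).factorial * Real.exp (2 / D * ∑ r ∈ A, ∑ s, g r s)) := by
          have hΦ0 : 0 ≤ ∑ π, Φ π := Finset.sum_nonneg fun π _ => (Real.exp_pos _).le
          refine mul_le_mul ?_ (ih (by linarith)) hΦ0 (Real.exp_pos _).le
          have : u / B.card ≤ 2 / D * ∑ s, g i s := by
            calc u / B.card ≤ (2 * ∑ s, g i s) / D :=
                  div_le_div₀ (hu0.trans hu2) hu2 hD hBcard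
              _ = _ := by ring
          linarith [Real.add_one_le_exp (2 / D * ∑ s, g i s)]
      _ = _ := by
          rw [Finset.sum_insert hi, mul_add, Real.exp_add]
          ring

/-- The exponential moment of a sum over the graph of a random permutation; the sum is split into
two halves by convexity. -/
theorem sum_perm_exp_le [Nonempty α] {f : α → α → ℝ} (h0 : ∀ r s, 0 ≤ f r s)
    (h1 : ∀ r s, 2 * f r s ≤ 1) :
    ∑ π : Equiv.Perm α, Real.exp (∑ r, f r (π r))
      ≤ (Fintype.card α).factorial * Real.exp (8 / Fintype.card α * ∑ r, ∑ s, f r s) := by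
  set N := Fintype.card α with hN
  have hN0 : (0 : ℝ) < N := by exact_mod_cast Fintype.card_pos (α := α)
  obtain ⟨A, -, hA⟩ := Finset.exists_subset_card_eq
    (s := (Finset.univ : Finset α)) (n := N / 2) (by rw [Finset.card_univ]; omega)
  have hAc : Aᶜ.card = N - N / 2 := by rw [Finset.card_compl, hA]
  have hhalf : ∀ B : Finset α, 2 * B.card ≤ N + 1 →
      ∑ π : Equiv.Perm α, Real.exp (2 * ∑ r ∈ B, f r (π r))
        ≤ N.factorial * Real.exp (8 / N * ∑ r, ∑ s, f r s) := by
    intro B hB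
    have hBR : 2 * (B.card : ℝ) ≤ N + 1 := by exact_mod_cast hB
    have := sum_perm_exp_partial_le (g := fun r s => 2 * f r s)
      (fun r s => by have := h0 r s; positivity) h1 (D := N / 2) (by positivity) B (by linarith)
    simp only [← Finset.mul_sum] at this
    refine this.trans (mul_le_mul_of_nonneg_left (Real.exp_le_exp.2 ?_) (Nat.cast_nonneg _))
    have h2 : ∑ r ∈ B, ∑ s, f r s ≤ ∑ r, ∑ s, f r s :=
      Finset.sum_le_univ_sum_of_nonneg fun r => Finset.sum_nonneg fun s _ => h0 r s
    calc 2 / ((N : ℝ) / 2) * (2 * ∑ r ∈ B, ∑ s, f r s) = 8 / N * ∑ r ∈ B, ∑ s, f r s := by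
          field_simp; ring
      _ ≤ _ := by gcongr
  have hconv : ∀ π : Equiv.Perm α, Real.exp (∑ r, f r (π r))
      ≤ 1 / 2 * Real.exp (2 * ∑ r ∈ A, f r (π r)) + 1 / 2 * Real.exp (2 * ∑ r ∈ Aᶜ, f r (π r)) := by
    intro π
    rw [← Finset.sum_add_sum_compl A, Real.exp_add, two_mul, two_mul, Real.exp_add, Real.exp_add]
    nlinarith [sq_nonneg (Real.exp (∑ r ∈ A, f r (π r)) - Real.exp (∑ r ∈ Aᶜ, f r (π r)))]
  refine (Finset.sum_le_sum fun π _ => hconv π).trans ?_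
  rw [Finset.sum_add_distrib, ← Finset.mul_sum, ← Finset.mul_sum]
  have e1 := hhalf A (by omega)
  have e2 := hhalf Aᶜ (by omega)
  linarith

end Permutations

variable {n m k : ℕ}

/-- The set obtained from `K` by permuting the rows and the columns. -/
def permute (π σ : Equiv.Perm (Fin n)) (K : Finset (Fin n × Fin n)) : Finset (Fin n × Fin n) :=
  Finset.univ.filter fun p => (π p.1, σ p.2) ∈ K

theorem mem_permute {π σ : Equiv.Perm (Fin n)} {K : Finset (Fin n × Fin n)} {p : Fin n × Fin n} :
    p ∈ permute π σ K ↔ (π p.1, σ p.2) ∈ K := by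
  simp [permute]

theorem permute_mem_supports (π σ : Equiv.Perm (Fin n)) {K : Finset (Fin n × Fin n)}
    (hK : K ∈ supports n k m) : permute π σ K ∈ supports n k m := by
  rw [supports, unionsOfRectangles_eq_image, Finset.mem_image] at hK ⊢
  obtain ⟨ω, hω, rfl⟩ := hK
  rw [mem_packings] at hω
  have hcells : ∀ (i : Fin m) (p : Fin n × Fin n),
      p ∈ cells ((ω i).1.map π.symm.toEmbedding, (ω i).2.map σ.symm.toEmbedding)
        ↔ (π p.1, σ p.2) ∈ cells (ω i) := by
    intro i p
    simp only [cells, Finset.mem_product, Finset.mem_map_equiv, Equiv.symm_symm]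
  refine ⟨fun i => ((ω i).1.map π.symm.toEmbedding, (ω i).2.map σ.symm.toEmbedding),
    mem_packings.2 ⟨fun i => ?_, fun i j hij => ?_⟩, ?_⟩
  · simpa [mem_sizeSets] using hω.1 i
  · rw [Finset.disjoint_left]
    intro p hp hp'
    exact Finset.disjoint_left.1 (hω.2 i j hij) ((hcells i p).1 hp) ((hcells j p).1 hp')
  · ext p
    simp only [mem_tupleUnion, mem_permute, hcells]

theorem sum_supports_permute (π σ : Equiv.Perm (Fin n)) (Φ : Finset (Fin n × Fin n) → ℝ) :
    ∑ K ∈ supports n k m, Φ (permute π σ K) = ∑ K ∈ supports n k m, Φ K := by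
  refine Finset.sum_bij' (fun K _ => permute π σ K) (fun K _ => permute π.symm σ.symm K)
    (fun K hK => permute_mem_supports π σ hK) (fun K hK => permute_mem_supports _ _ hK) ?_ ?_ ?_
  · intro K _
    ext p
    simp [mem_permute]
  · intro K _
    ext p
    simp [mem_permute]
  · intro K _
    rfl

/-- When the means of the entries are so small that a whole row is not informative, the symmetry
under permutations of the rows and columns suffices: it replaces the overlap of two supports by
the product of their densities. -/
theorem sum_exp_inter_supports_le_of_mul_le (hn : 0 < n) {l : ℝ} (hl : 16 * (l ^ 2 * n) ≤ 1)
    {K : Finset (Fin n × Fin n)} (hK : K ∈ supports n k m) :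
    ∑ K' ∈ supports n k m, Real.exp (l ^ 2 * (K ∩ K').card)
      ≤ Real.exp (64 * (l ^ 2 * (m ^ 2 * k ^ 4)) / n ^ 2) * (supports n k m).card := by
  have hnR : (0 : ℝ) < n := by exact_mod_cast hn
  have : Nonempty (Fin n) := ⟨⟨0, hn⟩⟩
  have hcardle : ∀ s : Finset (Fin n), (s.card : ℝ) ≤ n := fun s => by
    exact_mod_cast (Finset.card_le_univ s).trans_eq (Fintype.card_fin n)
  have hfact : (0 : ℝ) < n.factorial := by exact_mod_cast n.factorial_pos
  have hcard : ∀ K ∈ supports n k m, (K.card : ℝ) = m * k ^ 2 := fun K hK => by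
    rw [card_le_of_mem_unionsOfRectangles (fun S hS => mem_sizeSets.1 hS) hK]
    push_cast
    ring
  set x : Finset (Fin n × Fin n) → Fin n → ℝ :=
    fun W c => ((Finset.univ.filter fun r => (r, c) ∈ W).card : ℝ) with hx
  have hx0 : ∀ W c, 0 ≤ x W c := fun W c => by positivity
  have hrow : ∑ K' ∈ supports n k m, Real.exp (l ^ 2 * (K ∩ K').card)
      ≤ ∑ K' ∈ supports n k m, Real.exp (∑ c, 8 * l ^ 2 / n * (x K c * x K' c)) := by
    refine le_of_mul_le_mul_left ?_ hfact
    calc (n.factorial : ℝ) * ∑ K' ∈ supports n k m, Real.exp (l ^ 2 * (K ∩ K').card)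
        = ∑ π : Equiv.Perm (Fin n), ∑ K' ∈ supports n k m,
            Real.exp (l ^ 2 * (K ∩ permute π (Equiv.refl _) K').card) := by
          simp only [sum_supports_permute _ _ fun K' => Real.exp (l ^ 2 * (K ∩ K').card)]
          rw [Finset.sum_const, Finset.card_univ, Fintype.card_perm, Fintype.card_fin,
            nsmul_eq_mul]
      _ = ∑ K' ∈ supports n k m, ∑ π : Equiv.Perm (Fin n), Real.exp (∑ r, l ^ 2 *
            ((Finset.univ.filter fun c => (r, c) ∈ K ∧ (π r, c) ∈ K').card : ℝ)) := by
          rw [Finset.sum_comm]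
          refine Finset.sum_congr rfl fun K' _ => Finset.sum_congr rfl fun π _ => ?_
          rw [← Finset.mul_sum]
          congr 2
          rw [← Nat.cast_sum]
          congr 1
          simp only [Finset.card_filter]
          rw [← Fintype.sum_prod_type (f := fun p : Fin n × Fin n =>
            if (p.1, p.2) ∈ K ∧ (π p.1, p.2) ∈ K' then 1 else 0), ← Finset.card_filter]
          congr 1
          ext p
          simp [mem_permute]
      _ ≤ ∑ K' ∈ supports n k m, n.factorial *
            Real.exp (∑ c, 8 * l ^ 2 / n * (x K c * x K' c)) := by
          refine Finset.sum_le_sum fun K' _ => ?_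
          refine (sum_perm_exp_le (f := fun r s => l ^ 2 *
            ((Finset.univ.filter fun c => (r, c) ∈ K ∧ (s, c) ∈ K').card : ℝ))
            (fun r s => by positivity) (fun r s => ?_)).trans_eq ?_
          · have := mul_le_mul_of_nonneg_left
              (hcardle (Finset.univ.filter fun c => (r, c) ∈ K ∧ (s, c) ∈ K')) (sq_nonneg l)
            have h0 : 0 ≤ l ^ 2 * (n : ℝ) := by positivity
            linarith
          · rw [Fintype.card_fin]
            congr 2
            have hcount : ∑ r, ∑ s, l ^ 2 *
                ((Finset.univ.filter fun c => (r, c) ∈ K ∧ (s, c) ∈ K').card : ℝ)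
                = l ^ 2 * ∑ c, x K c * x K' c := by
              simp only [← Finset.mul_sum, hx, Finset.card_filter, Nat.cast_sum]
              congr 1
              simp only [Finset.sum_mul_sum]
              symm
              rw [Finset.sum_comm]
              refine Finset.sum_congr rfl fun r _ => ?_
              rw [Finset.sum_comm]
              refine Finset.sum_congr rfl fun s _ => Finset.sum_congr rfl fun c _ => ?_
              by_cases h1 : (r, c) ∈ K <;> by_cases h2 : (s, c) ∈ K' <;> simp [h1, h2]
            rw [hcount, ← Finset.mul_sum]
            ring
      _ = _ := by rw [Finset.mul_sum]
  refine hrow.trans ?_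
  refine le_of_mul_le_mul_left ?_ hfact
  have hxσ : ∀ (σ : Equiv.Perm (Fin n)) (K' : Finset (Fin n × Fin n)) (c : Fin n),
      x (permute (Equiv.refl _) σ K') c = x K' (σ c) := by
    intro σ K' c
    simp [hx, mem_permute]
  calc (n.factorial : ℝ) *
        ∑ K' ∈ supports n k m, Real.exp (∑ c, 8 * l ^ 2 / n * (x K c * x K' c))
      = ∑ K' ∈ supports n k m, ∑ σ : Equiv.Perm (Fin n),
          Real.exp (∑ c, 8 * l ^ 2 / n * (x K c * x K' (σ c))) := by
        rw [Finset.sum_comm]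
        simp only [← hxσ]
        simp only [sum_supports_permute _ _ fun K' =>
          Real.exp (∑ c, 8 * l ^ 2 / n * (x K c * x K' c))]
        rw [Finset.sum_const, Finset.card_univ, Fintype.card_perm, Fintype.card_fin,
          nsmul_eq_mul]
    _ ≤ ∑ K' ∈ supports n k m, n.factorial *
          Real.exp (64 * (l ^ 2 * (m ^ 2 * k ^ 4)) / n ^ 2) := by
        refine Finset.sum_le_sum fun K' hK' => ?_
        refine (sum_perm_exp_le (f := fun c d => 8 * l ^ 2 / n * (x K c * x K' d))
          (fun c d => by have := hx0 K c; have := hx0 K' d; positivity)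
          (fun c d => ?_)).trans_eq ?_
        · have h1 : x K c * x K' d ≤ n * n :=
            mul_le_mul (hcardle _) (hcardle _) (hx0 _ _) hnR.le
          calc 2 * (8 * l ^ 2 / n * (x K c * x K' d)) ≤ 2 * (8 * l ^ 2 / n * (n * n)) := by gcongr
            _ = 16 * (l ^ 2 * n) := by field_simp; ring
            _ ≤ 1 := hl
        · rw [Fintype.card_fin]
          congr 2
          have : ∑ c, ∑ d, 8 * l ^ 2 / n * (x K c * x K' d)
              = 8 * l ^ 2 / n * ((m * k ^ 2) * (m * k ^ 2)) := by
            have hsum : ∀ W ∈ supports n k m, ∑ c, x W c = m * k ^ 2 := fun W hW => by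
              rw [← hcard W hW, card_eq_sum_col W]
            simp only [← Finset.mul_sum]
            rw [hsum K' hK', ← Finset.sum_mul, hsum K hK]
          rw [this]
          field_simp
          ring
    _ = _ := by
        rw [Finset.sum_const, nsmul_eq_mul]
        ring

/-! ### Total variation bounds and the limit -/

variable {n m k : ℕ}

theorem tvDist_nonneg {Ω : Type*} [MeasurableSpace Ω] (μ ν : Measure Ω) : 0 ≤ tvDist μ ν := by
  unfold tvDist
  positivity

/-- The bound for small rectangles: the second moment is taken over the sparse supports only, and
`δ` bounds the proportion of the others. -/
theorem tvDist_supports_le_of_two_le (hk : 2 ≤ k) (hm : 1 ≤ m) (hkn : 1024 * k ^ 2 ≤ n)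
    (hmk : m * k ≤ n) {l x δ : ℝ} (hx : 2 ^ 24 * x ≤ 1) (hl : l ^ 2 * k ≤ x)
    (hl' : l ^ 2 * (m ^ 2 * k ^ 4) ≤ x * n ^ 2) (hδ : 32 * n * Real.exp (-(n / 8)) ≤ δ)
    (hδ2 : 2 * δ ≤ 1) :
    tvDist (nullLaw n (gaussianReal 0 1))
        (plantedLaw (supports n k m) (gaussianReal l 1) (gaussianReal 0 1))
      ≤ √(Real.exp (2 ^ 39 * x) * (1 + 2 * δ) - 1) + δ := by
  have hn : (0 : ℝ) < n := by
    have : 0 < n := lt_of_lt_of_le (by positivity) hkn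
    exact_mod_cast this
  have hsub : sparseSupports n k m ⊆ supports n k m := Finset.filter_subset _ _
  have hr := (card_supports_sdiff_le hk hm hkn hmk).trans hδ
  have hδ0 : 0 ≤ δ := le_trans (by positivity) hδ
  have hF : (0 : ℝ) < (supports n k m).card := by
    exact_mod_cast Finset.card_pos.2 (supports_nonempty hmk)
  have hsplit : ((supports n k m \ sparseSupports n k m).card : ℝ)
      = (supports n k m).card - (sparseSupports n k m).card := by
    rw [Finset.card_sdiff_of_subset hsub, Nat.cast_sub (Finset.card_le_card hsub)]
  have hr' := (div_le_iff₀ hF).1 hr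
  have hGF : ((supports n k m).card : ℝ) ≤ (1 + 2 * δ) * (sparseSupports n k m).card := by
    have : (1 - δ) * (supports n k m).card ≤ (sparseSupports n k m).card := by linarith
    nlinarith
  have hG : (sparseSupports n k m).Nonempty := by
    rw [← Finset.card_pos]
    have : (0 : ℝ) < (sparseSupports n k m).card := by nlinarith
    exact_mod_cast this
  refine (tvDist_le_of_subfamily l hG hsub (A := Real.exp (2 ^ 39 * x) * (1 + 2 * δ))
    fun K hK => ?_).trans (add_le_add_right hr _)
  refine (sum_exp_inter_sparseSupports_le (by omega) hm hmk hkn ?_ ?_ (hsub hK)).trans ?_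
  · linarith
  · nlinarith
  · rw [mul_assoc]
    gcongr
    rw [div_le_iff₀ (by positivity), mul_assoc]
    gcongr

/-- The bound in all regimes; `x` bounds the square of the ratio of `l` to
`min (n / (m k ^ 2)) (1 / √k)`. -/
theorem tvDist_supports_le (hk : 1 ≤ k) (hm : 1 ≤ m) (hmk : m * k ≤ n) {l x δ : ℝ}
    (hx : 2 ^ 24 * x ≤ 1) (hl : l ^ 2 * k ≤ x) (hl' : l ^ 2 * (m ^ 2 * k ^ 4) ≤ x * n ^ 2)
    (hδ : 32 * n * Real.exp (-(n / 8)) ≤ δ) (hδ2 : 2 * δ ≤ 1) :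
    tvDist (nullLaw n (gaussianReal 0 1))
        (plantedLaw (supports n k m) (gaussianReal l 1) (gaussianReal 0 1))
      ≤ √(Real.exp (2 ^ 39 * x) * (1 + 2 * δ) - 1) + δ := by
  have hkR : (1 : ℝ) ≤ k := by exact_mod_cast hk
  have hmR : (1 : ℝ) ≤ m := by exact_mod_cast hm
  have hn : 0 < n := lt_of_lt_of_le (by positivity) hmk
  have hnR : (0 : ℝ) < n := by exact_mod_cast hn
  have hx0 : 0 ≤ x := le_trans (by positivity) hl
  have hδ0 : 0 ≤ δ := le_trans (by positivity) hδ
  have hl'' : l ^ 2 * (m ^ 2 * k ^ 4) / n ^ 2 ≤ x := (div_le_iff₀ (by positivity)).2 hl'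
  have hxn : 2 ^ 24 * (x * n ^ 2) ≤ (n : ℝ) ^ 2 := by nlinarith [sq_nonneg (n : ℝ)]
  -- It suffices to bound the distance with a better constant and without `δ`.
  have hweak : ∀ C : ℝ, C ≤ 2 ^ 39 → √(Real.exp (C * x) - 1)
      ≤ √(Real.exp (2 ^ 39 * x) * (1 + 2 * δ) - 1) + δ := by
    intro C hC
    have h1 : Real.exp (C * x) ≤ Real.exp (2 ^ 39 * x) * (1 + 2 * δ) := by
      calc Real.exp (C * x) ≤ Real.exp (2 ^ 39 * x) := by gcongr
        _ ≤ _ := le_mul_of_one_le_right (Real.exp_pos _).le (by linarith)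
    have h2 := Real.sqrt_le_sqrt (sub_le_sub_right h1 1)
    linarith
  have hwhole : ∀ C : ℝ, C ≤ 2 ^ 39 → (∀ K ∈ supports n k m,
      ∑ K' ∈ supports n k m, Real.exp (l ^ 2 * (K ∩ K').card)
        ≤ Real.exp (C * x) * (supports n k m).card) →
      tvDist (nullLaw n (gaussianReal 0 1))
        (plantedLaw (supports n k m) (gaussianReal l 1) (gaussianReal 0 1))
        ≤ √(Real.exp (2 ^ 39 * x) * (1 + 2 * δ) - 1) + δ := by
    intro C hC h
    have := tvDist_le_of_subfamily l (supports_nonempty hmk) subset_rfl h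
    simp only [sdiff_self, Finset.bot_eq_empty, Finset.card_empty, Nat.cast_zero, zero_div,
      add_zero] at this
    exact this.trans (hweak C hC)
  rcases Nat.lt_or_ge 1 k with hk2 | hk1
  · rcases le_or_gt (1024 * k ^ 2) n with hkn | hkn
    · exact tvDist_supports_le_of_two_le hk2 hm hkn hmk hx hl hl' hδ hδ2
    have hknR : (n : ℝ) < 1024 * k ^ 2 := by exact_mod_cast hkn
    rcases le_or_gt (2 * (m * k)) n with hmk2 | hmk2
    · refine hwhole 128 (by norm_num) fun K hK => ?_
      refine (sum_exp_inter_supports_le_of_two_mul_le hk hm hmk2 ?_ ?_ hK).trans ?_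
      · linarith
      · have : 0 ≤ x * (n : ℝ) ^ 2 := by positivity
        linarith
      · rw [mul_div_assoc]
        gcongr
    · have hmk2R : (n : ℝ) < 2 * (m * k) := by exact_mod_cast hmk2
      refine hwhole 64 (by norm_num) fun K hK => ?_
      -- In this regime `n` is comparable to `m * k`, so that `l` is small compared with `1 / k`.
      have h1 : l ^ 2 * k ^ 2 ≤ 4 * x := by
        have h2 : (n : ℝ) ^ 2 ≤ (2 * (m * k)) ^ 2 := by gcongr
        have h3 : l ^ 2 * k ^ 2 * (n : ℝ) ^ 2 ≤ 4 * x * n ^ 2 := by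
          calc l ^ 2 * k ^ 2 * (n : ℝ) ^ 2 ≤ l ^ 2 * k ^ 2 * (2 * (m * k)) ^ 2 := by gcongr
            _ = 4 * (l ^ 2 * (m ^ 2 * k ^ 4)) := by ring
            _ ≤ _ := by linarith
        exact le_of_mul_le_mul_right h3 (by positivity)
      refine (sum_exp_inter_supports_le_of_mul_le hn ?_ hK).trans ?_
      · have : l ^ 2 * n ≤ l ^ 2 * (1024 * k ^ 2) := by gcongr
        nlinarith
      · rw [mul_div_assoc]
        gcongr
  · obtain rfl : k = 1 := by omega
    have hsupp : supports n 1 m = consecutiveSupports n 1 m := by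
      rw [supports, consecutiveSupports, sizeSets_one]
    rw [hsupp]
    have hl1 : l ^ 2 * ((1 : ℕ) : ℝ) ^ 2 ≤ x := by simpa using hl
    refine (tvDist_consecutiveSupports_le le_rfl hmk (by linarith)).trans ?_
    refine le_trans ?_ (hweak 32 (by norm_num))
    gcongr

theorem tendsto_mul_exp_neg_div : Tendsto (fun n : ℕ => 32 * (n : ℝ) * Real.exp (-(n / 8)))
    atTop (nhds 0) := by
  have h := (Real.tendsto_pow_mul_exp_neg_atTop_nhds_zero 1).comp
    (tendsto_natCast_atTop_atTop.atTop_div_const (by norm_num : (0 : ℝ) < 8))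
  have h2 := h.const_mul 256
  rw [mul_zero] at h2
  refine h2.congr fun n => ?_
  simp only [Function.comp, pow_one]
  ring

theorem tendsto_sqrt_exp_bound {x δ : ℕ → ℝ} (hx : Tendsto x atTop (nhds 0))
    (hδ : Tendsto δ atTop (nhds 0)) :
    Tendsto (fun n => √(Real.exp (2 ^ 39 * x n) * (1 + 2 * δ n) - 1) + δ n) atTop (nhds 0) := by
  have h1 := (Real.continuous_exp.tendsto _).comp (hx.const_mul (2 ^ 39))
  have h2 := (h1.mul ((hδ.const_mul 2).const_add 1)).sub_const 1
  have h3 := ((Real.continuous_sqrt.tendsto _).comp h2).add hδ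
  simpa [Function.comp_def] using h3

theorem tendsto_tvDist_supports {m k : ℕ → ℕ} {lam : ℕ → ℝ}
    (hm : ∀ᶠ n in atTop, 1 ≤ m n) (hk : ∀ᶠ n in atTop, 1 ≤ k n)
    (hmk : ∀ᶠ n in atTop, m n * k n ≤ n)
    (ho : lam =o[atTop] (fun n : ℕ =>
      min ((n : ℝ) / ((m n : ℝ) * (k n : ℝ) ^ 2)) (1 / Real.sqrt (k n : ℝ)))) :
    Tendsto (fun n : ℕ => tvDist (nullLaw n (gaussianReal 0 1))
      (plantedLaw (supports n (k n) (m n)) (gaussianReal (lam n) 1) (gaussianReal 0 1)))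
      atTop (nhds 0) := by
  set g : ℕ → ℝ := fun n =>
    min ((n : ℝ) / ((m n : ℝ) * (k n : ℝ) ^ 2)) (1 / Real.sqrt (k n : ℝ)) with hg
  have hx : Tendsto (fun n => (lam n / g n) ^ 2) atTop (nhds 0) := by
    simpa using ho.tendsto_div_nhds_zero.pow 2
  have hδ := tendsto_mul_exp_neg_div
  refine squeeze_zero' (Eventually.of_forall fun n => tvDist_nonneg _ _) ?_
    (tendsto_sqrt_exp_bound hx hδ)
  filter_upwards [hm, hk, hmk, hx.eventually_le_const (by norm_num : (0 : ℝ) < 1 / 2 ^ 24),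
    hδ.eventually_le_const (by norm_num : (0 : ℝ) < 1 / 2)] with n hm hk hmk hxn hδn
  have hkR : (0 : ℝ) < k n := by exact_mod_cast hk
  have hmR : (0 : ℝ) < m n := by exact_mod_cast hm
  have hnR : (0 : ℝ) < n := by exact_mod_cast (Nat.mul_pos hm hk).trans_le hmk
  have hg0 : 0 < g n := by
    simp only [hg]
    positivity
  have hlg : lam n ^ 2 = (lam n / g n) ^ 2 * g n ^ 2 := by
    rw [div_pow, div_mul_cancel₀ _ (by positivity)]
  refine tvDist_supports_le hk hm hmk (by linarith) ?_ ?_ le_rfl (by linarith)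
  · have h1 : g n ^ 2 * k n ≤ 1 := by
      have h2 : g n ^ 2 ≤ (1 / Real.sqrt (k n : ℝ)) ^ 2 :=
        pow_le_pow_left₀ hg0.le (min_le_right _ _) 2
      rw [div_pow, Real.sq_sqrt hkR.le, one_pow] at h2
      calc g n ^ 2 * k n ≤ 1 / k n * k n := by gcongr
        _ = 1 := by field_simp
    rw [hlg, mul_assoc]
    exact mul_le_of_le_one_right (sq_nonneg _) h1
  · have h1 : g n ^ 2 * ((m n : ℝ) ^ 2 * (k n : ℝ) ^ 4) ≤ (n : ℝ) ^ 2 := by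
      have h2 : g n ^ 2 ≤ ((n : ℝ) / ((m n : ℝ) * (k n : ℝ) ^ 2)) ^ 2 :=
        pow_le_pow_left₀ hg0.le (min_le_left _ _) 2
      calc g n ^ 2 * ((m n : ℝ) ^ 2 * (k n : ℝ) ^ 4)
          ≤ ((n : ℝ) / ((m n : ℝ) * (k n : ℝ) ^ 2)) ^ 2
            * ((m n : ℝ) ^ 2 * (k n : ℝ) ^ 4) := by gcongr
        _ = (n : ℝ) ^ 2 := by field_simp
    rw [hlg, mul_assoc]
    gcongr

theorem tendsto_tvDist_consecutiveSupports {m k : ℕ → ℕ} {lam : ℕ → ℝ}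
    (hk : ∀ᶠ n in atTop, 1 ≤ k n) (hmk : ∀ᶠ n in atTop, m n * k n ≤ n)
    (ho : lam =o[atTop] (fun n : ℕ => 1 / (k n : ℝ))) :
    Tendsto (fun n : ℕ => tvDist (nullLaw n (gaussianReal 0 1))
      (plantedLaw (consecutiveSupports n (k n) (m n)) (gaussianReal (lam n) 1)
        (gaussianReal 0 1)))
      atTop (nhds 0) := by
  have hx : Tendsto (fun n => (lam n / (1 / (k n : ℝ))) ^ 2) atTop (nhds 0) := by
    simpa using ho.tendsto_div_nhds_zero.pow 2
  have hlim : Tendsto (fun n => √(Real.exp (32 * (lam n / (1 / (k n : ℝ))) ^ 2) - 1))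
      atTop (nhds 0) := by
    have h1 := (Real.continuous_exp.tendsto _).comp (hx.const_mul 32)
    have h2 := (Real.continuous_sqrt.tendsto _).comp (h1.sub_const 1)
    simpa [Function.comp_def] using h2
  refine squeeze_zero' (Eventually.of_forall fun n => tvDist_nonneg _ _) ?_ hlim
  filter_upwards [hk, hmk, hx.eventually_le_const one_pos] with n hk hmk hxn
  have e : (lam n / (1 / (k n : ℝ))) ^ 2 = lam n ^ 2 * (k n : ℝ) ^ 2 := by
    rw [div_div_eq_mul_div, div_one, mul_pow]
  rw [e] at hxn ⊢
  exact tvDist_consecutiveSupports_le hk hmk hxn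

end PlantedSubmatrix

theorem theorem2 (m k : ℕ → ℕ) (lam : ℕ → ℝ)
    (hm : ∀ᶠ n in atTop, 1 ≤ m n) (hk : ∀ᶠ n in atTop, 1 ≤ k n)
    (hmk : ∀ᶠ n in atTop, m n * k n ≤ n)
    (hlam : ∀ᶠ n in atTop, 0 < lam n) :
    (lam =o[atTop] (fun n : ℕ =>
        min ((n : ℝ) / ((m n : ℝ) * (k n : ℝ) ^ 2)) (1 / Real.sqrt (k n : ℝ))) →
      Tendsto (fun n : ℕ =>
        PlantedSubmatrix.tvDist
          (PlantedSubmatrix.nullLaw n (gaussianReal 0 1))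
          (PlantedSubmatrix.plantedLaw (PlantedSubmatrix.supports n (k n) (m n))
            (gaussianReal (lam n) 1) (gaussianReal 0 1)))
        atTop (nhds 0)) ∧
    (lam =o[atTop] (fun n : ℕ => 1 / (k n : ℝ)) →
      Tendsto (fun n : ℕ =>
        PlantedSubmatrix.tvDist
          (PlantedSubmatrix.nullLaw n (gaussianReal 0 1))
          (PlantedSubmatrix.plantedLaw (PlantedSubmatrix.consecutiveSupports n (k n) (m n))
            (gaussianReal (lam n) 1) (gaussianReal 0 1)))
        atTop (nhds 0)) := by
  exact ⟨PlantedSubmatrix.tendsto_tvDist_supports hm hk hmk,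
    PlantedSubmatrix.tendsto_tvDist_consecutiveSupports hk hmk⟩
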